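/- Let $\Bbbk$ be a field of characteristic $0$. **The Heisenberg category.** Let $\mathcal H'$ be the $\Bbbk$-linear monoidal category generated by two objects $\mathsf P$ (upward strand) and $\mathsf Q$ (downward strand). Its morphisms are $\Bbbk$-linear combinations of oriented planar diagrams, read from bottom to top, built from crossings, cups and caps, modulo planar isotopy (so $\mathsf P$ and $\mathsf Q$ are biadjoint, and the crossings of other orientation are rotations of the upward crossing) and the local relations: crossings of equally oriented strands square to the identity and satisfy the braid relation; the double crossing $\mathsf{QP}\to\mathsf{PQ}\to\mathsf{QP}$ is the identity minus the composite $\mathsf{QP}\to\mathbf 1\to\mathsf{QP}$ of cap and cup; the double crossing $\mathsf{PQ}\to\mathsf{QP}\to\mathsf{PQ}$ is the identity; a counterclockwise circle is $1$; a left curl is $0$. The Heisenberg category $\mathcal H$ is the idempotent completion of the additive completion of $\mathcal H'$. The group $S_n$ acts on $\mathsf P^{\otimes n}$ and on $\mathsf Q^{\otimes n}$ by crossings; the strands of $\mathsf P^{\otimes n}$ are numbered from the left, those of $\mathsf Q^{\otimes n}$ from the right. For a partition $\lambda\vdash n$ let $e_\lambda\in\Bbbk[S_n]$ be the idempotent multiple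 of the Young symmetrizer (row sum times signed column sum) of the standard filling of $\lambda$ row by row, and let $\mathsf P^\lambda$ and $\mathsf Q^\lambda$ be the images of $e_\lambda$ in $\mathsf P^{\otimes n}$ and $\mathsf Q^{\otimes n}$. Write $\lambda^t$ for the conjugate partition. **Branching maps.** For $\mu\vdash n-1$ and $\lambda=\mu+\square\vdash n$ let $\sigma\in S_n$ move the entry of the box $\lambda\setminus\mu$ in the filling of $\lambda$ to the last place, keeping the order of the other entries. Let $\iota:\mathsf P^{\lambda}\to\mathsf P^{\mu}\mathsf P$ be the composite of the inclusion $\mathsf P^\lambda\to\mathsf P^{\otimes n}$, the action of $\sigma$, and the projection to $\mathsf P^\mu\mathsf P$. Let $\rho:\mathsf P^\mu\mathsf P\to\mathsf P^\lambda$ be the composite of inclusion, action of $\sigma^{-1}$, and projection. Define $\iota:\mathsf Q^{\lambda^t}\to\mathsf Q\mathsf Q^{\mu^t}$ and $\rho:\mathsf Q\mathsf Q^{\mu^t}\to\mathsf Q^{\lambda^t}$ in the same way. **The complexes.** Let $a=(a_{\lambda\mu})$ and $b=(b_{\lambda\mu})$ be families of nonzero scalars in $\Bbbk$, indexed by pairs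 of partitions. For $n\ge 0$ put $\Sigma_n=\bigoplus_{\lambda\vdash n}\mathsf P^\lambda\mathsf Q^{\lambda^t}$. Let $\mathsf d^-_a:\Sigma_n\to\Sigma_{n-1}$ and $\mathsf d^+_b:\Sigma_{n-1}\to\Sigma_n$ be the morphisms whose components for $\lambda=\mu+\square$ are $$a_{\lambda\mu}\cdot\Bigl(\mathsf P^\lambda\mathsf Q^{\lambda^t}\xrightarrow{\ \iota\otimes\iota\ }\mathsf P^\mu\mathsf P\mathsf Q\mathsf Q^{\mu^t}\xrightarrow{\ \mathrm{id}\otimes\mathrm{cap}\otimes\mathrm{id}\ }\mathsf P^\mu\mathsf Q^{\mu^t}\Bigr),\qquad b_{\lambda\mu}\cdot\Bigl(\mathsf P^\mu\mathsf Q^{\mu^t}\xrightarrow{\ \mathrm{id}\otimes\mathrm{cup}\otimes\mathrm{id}\ }\mathsf P^\mu\mathsf P\mathsf Q\mathsf Q^{\mu^t}\xrightarrow{\ \rho\otimes\rho\ }\mathsf P^\lambda\mathsf Q^{\lambda^t}\Bigr),$$ all other components being $0$. If $\mathsf d^-_a\mathsf d^-_a=0$, let $\Sigma^-_a$ be the complex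 over $\mathcal H$ with $\Sigma_n$ in homological degree $n$ and differential $\mathsf d^-_a$. If $\mathsf d^+_b\mathsf d^+_b=0$, let $\Sigma^+_b$ be the complex with $\Sigma_n$ in homological degree $-n$ and differential $\mathsf d^+_b$. **The category $\mathcal H_n$.** For $n\in\mathbb N$ let $\mathcal H_n$ be the category of families, indexed by $m\in\mathbb N$, of $(\Bbbk[S_m],\Bbbk[S_n])$-bimodules. The category $\mathcal H$ acts on it: $\mathsf P$ acts by induction from $S_m$ to $S_{m+1}$, $\mathsf Q$ by restriction from $S_{m+1}$ to $S_m$, upward and downward crossings by the transposition of the last two points, and cups and caps by the units and counits of the two adjunctions between induction and restriction. The image in $\mathcal H_n$ of an object, morphism or complex $X$ of $\mathcal H$ is $X\cdot\Bbbk[S_n]$, where $\Bbbk[S_n]$ is the regular bimodule, placed at $m=n$. Let $\mathcal K(\mathcal H_n)$ be the homotopy category of complexes over $\mathcal H_n$. **Theorem.** There are nonzero scalars $a_{\lambda\mu}$ with $\mathsf d^-_a\mathsf d^-_a=0$, and there are nonzero scalars $b_{\lambda\mu}$ with $\mathsf d^+_b\mathsf d^+_b=0$. For every such choice of $a$ and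 $b$, and for every $n\in\mathbb N$, the images of $\Sigma^+_b$ and $\Sigma^-_a$ in $\mathcal K(\mathcal H_n)$ are homotopy equivalent. -/

import Mathlib

open CategoryTheory MonoidalCategory Limits Idempotents
open Equiv

universe u

set_option linter.unusedVariables false

namespace Heis

/-- Objects of Khovanov's Heisenberg category before additive and idempotent completion: tensor words
in the generators `P = Q_+` (an upward strand) and `Q = Q_-` (a downward strand). -/
inductive Ob : Type
  | one : Ob
  | P : Ob
  | Q : Ob
  | tensor : Ob → Ob → Ob

local notation:70 X:71 "⊗ₒ" Y:70 => Ob.tensor X Y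

/-- Formal `k`-linear combinations of planar diagrams, built from the generating diagrams by vertical
composition (`comp f g`: first the lower diagram `f`, then `g` on top of it) and by adding identity
strands on the left (`wl`) or on the right (`wr`). The generators are the crossing `s` of two upward
strands, the crossing `t` of two downward strands, and the four oriented cups and caps. Diagrams are
read from bottom to top. -/
inductive Term (k : Type u) : Ob → Ob → Type u
  | id (X : Ob) : Term k X X
  | comp {X Y Z : Ob} (f : Term k X Y) (g : Term k Y Z) : Term k X Z
  | wl (X : Ob) {Y Z : Ob} (f : Term k Y Z) : Term k (X ⊗ₒ Y) (X ⊗ₒ Z)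
  | wr {X Y : Ob} (f : Term k X Y) (Z : Ob) : Term k (X ⊗ₒ Z) (Y ⊗ₒ Z)
  | α (X Y Z : Ob) : Term k ((X ⊗ₒ Y) ⊗ₒ Z) (X ⊗ₒ (Y ⊗ₒ Z))
  | αi (X Y Z : Ob) : Term k (X ⊗ₒ (Y ⊗ₒ Z)) ((X ⊗ₒ Y) ⊗ₒ Z)
  | l (X : Ob) : Term k (.one ⊗ₒ X) X
  | li (X : Ob) : Term k X (.one ⊗ₒ X)
  | r (X : Ob) : Term k (X ⊗ₒ .one) X
  | ri (X : Ob) : Term k X (X ⊗ₒ .one)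
  | zero (X Y : Ob) : Term k X Y
  | add {X Y : Ob} (f g : Term k X Y) : Term k X Y
  | smul {X Y : Ob} (c : k) (f : Term k X Y) : Term k X Y
  | s : Term k (.P ⊗ₒ .P) (.P ⊗ₒ .P)
  | t : Term k (.Q ⊗ₒ .Q) (.Q ⊗ₒ .Q)
  | cupQP : Term k .one (.Q ⊗ₒ .P)
  | capQP : Term k (.Q ⊗ₒ .P) .one
  | cupPQ : Term k .one (.P ⊗ₒ .Q)
  | capPQ : Term k (.P ⊗ₒ .Q) .one

namespace Term

local infixr:80 "≫ₜ" => Term.comp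
local infixr:81 "◁ₜ" => Term.wl
local infixl:81 "▷ₜ" => Term.wr

variable {k : Type u}

/-- Two nested cups. -/
def nestL (X Y : Ob) (cup : Term k .one (X ⊗ₒ Y)) : Term k .one ((X ⊗ₒ X) ⊗ₒ (Y ⊗ₒ Y)) :=
  cup ≫ₜ (X ◁ₜ (li Y ≫ₜ (cup ▷ₜ Y) ≫ₜ α X Y Y)) ≫ₜ αi X X (Y ⊗ₒ Y)

/-- Two nested caps. -/
def nestR (X Y : Ob) (cap : Term k (X ⊗ₒ Y) .one) : Term k ((X ⊗ₒ X) ⊗ₒ (Y ⊗ₒ Y)) .one :=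
  α X X (Y ⊗ₒ Y) ≫ₜ (X ◁ₜ (αi X Y Y ≫ₜ (cap ▷ₜ Y) ≫ₜ l Y)) ≫ₜ cap

/-- The upward crossing next to a downward strand. -/
def sMid : Term k (.P ⊗ₒ (.P ⊗ₒ .Q)) (.P ⊗ₒ (.P ⊗ₒ .Q)) :=
  αi .P .P .Q ≫ₜ (s ▷ₜ .Q) ≫ₜ α .P .P .Q

/-- The sideways crossing `PQ → QP`, a rotated upward crossing. -/
def crossPQ : Term k (.P ⊗ₒ .Q) (.Q ⊗ₒ .P) :=
  li _ ≫ₜ (cupQP ▷ₜ (.P ⊗ₒ .Q)) ≫ₜ α _ _ _ ≫ₜ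
    (.Q ◁ₜ (sMid ≫ₜ (.P ◁ₜ capPQ) ≫ₜ r _))

/-- The sideways crossing `QP → PQ`, a rotated upward crossing. -/
def crossQP : Term k (.Q ⊗ₒ .P) (.P ⊗ₒ .Q) :=
  ri _ ≫ₜ ((.Q ⊗ₒ .P) ◁ₜ cupPQ) ≫ₜ α _ _ _ ≫ₜ (.Q ◁ₜ sMid) ≫ₜ αi _ _ _ ≫ₜ
    (capQP ▷ₜ (.P ⊗ₒ .Q)) ≫ₜ l _

/-- The upward crossing rotated by 180 degrees with cups on the left and caps on the right. -/
def rotLeft : Term k (.Q ⊗ₒ .Q) (.Q ⊗ₒ .Q) :=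
  li _ ≫ₜ (nestL .Q .P cupQP ▷ₜ (.Q ⊗ₒ .Q)) ≫ₜ α _ _ _ ≫ₜ
    ((.Q ⊗ₒ .Q) ◁ₜ ((s ▷ₜ (.Q ⊗ₒ .Q)) ≫ₜ nestR .P .Q capPQ)) ≫ₜ r _

/-- The upward crossing rotated by 180 degrees with cups on the right and caps on the left. -/
def rotRight : Term k (.Q ⊗ₒ .Q) (.Q ⊗ₒ .Q) :=
  ri _ ≫ₜ ((.Q ⊗ₒ .Q) ◁ₜ (nestL .P .Q cupPQ ≫ₜ (s ▷ₜ (.Q ⊗ₒ .Q)))) ≫ₜ αi _ _ _ ≫ₜ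
    (nestR .Q .P capQP ▷ₜ (.Q ⊗ₒ .Q)) ≫ₜ l _

/-- The curl of an upward strand that turns to its left. -/
def leftCurl : Term k .P .P :=
  li _ ≫ₜ (cupQP ▷ₜ .P) ≫ₜ α _ _ _ ≫ₜ (.Q ◁ₜ s) ≫ₜ αi _ _ _ ≫ₜ (capQP ▷ₜ .P) ≫ₜ l _

/-- A crossing of the first two of three strands. -/
def first (X : Ob) (f : Term k (X ⊗ₒ X) (X ⊗ₒ X)) :
    Term k ((X ⊗ₒ X) ⊗ₒ X) ((X ⊗ₒ X) ⊗ₒ X) := f ▷ₜ X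

/-- A crossing of the last two of three strands. -/
def second (X : Ob) (f : Term k (X ⊗ₒ X) (X ⊗ₒ X)) :
    Term k ((X ⊗ₒ X) ⊗ₒ X) ((X ⊗ₒ X) ⊗ₒ X) := α X X X ≫ₜ (X ◁ₜ f) ≫ₜ αi X X X

/-- The relations between diagrams: the axioms of a `k`-linear strict-up-to-coherence monoidal
category, invariance under planar isotopy (`zigzag₁` to `rot_right`: cups and caps straighten, and the
downward crossing is the upward crossing rotated in either direction), and the local relations: the
symmetric group relations for strands with equal orientation, the two relations for double crossings of
strands with opposite orientation, a counterclockwise circle is `1`, a left curl is `0`. -/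
inductive Rel [CommRing k] : ∀ {X Y : Ob}, Term k X Y → Term k X Y → Prop
  -- equivalence relation and congruence
  | refl {X Y : Ob} (f : Term k X Y) : Rel f f
  | symm {X Y : Ob} {f g : Term k X Y} : Rel f g → Rel g f
  | trans {X Y : Ob} {f g h : Term k X Y} : Rel f g → Rel g h → Rel f h
  | comp {X Y Z : Ob} {f f' : Term k X Y} {g g' : Term k Y Z} :
      Rel f f' → Rel g g' → Rel (f ≫ₜ g) (f' ≫ₜ g')
  | wl (X : Ob) {Y Z : Ob} {f f' : Term k Y Z} : Rel f f' → Rel (X ◁ₜ f) (X ◁ₜ f')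
  | wr {X Y : Ob} {f f' : Term k X Y} (Z : Ob) : Rel f f' → Rel (f ▷ₜ Z) (f' ▷ₜ Z)
  | add {X Y : Ob} {f f' g g' : Term k X Y} : Rel f f' → Rel g g' → Rel (f.add g) (f'.add g')
  | smul {X Y : Ob} (c : k) {f f' : Term k X Y} : Rel f f' → Rel (f.smul c) (f'.smul c)
  -- category
  | id_comp {X Y : Ob} (f : Term k X Y) : Rel (.id X ≫ₜ f) f
  | comp_id {X Y : Ob} (f : Term k X Y) : Rel (f ≫ₜ .id Y) f
  | assoc {X Y Z W : Ob} (f : Term k X Y) (g : Term k Y Z) (h : Term k Z W) :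
      Rel ((f ≫ₜ g) ≫ₜ h) (f ≫ₜ g ≫ₜ h)
  -- `k`-module structure on morphisms
  | add_comm {X Y : Ob} (f g : Term k X Y) : Rel (f.add g) (g.add f)
  | add_assoc {X Y : Ob} (f g h : Term k X Y) : Rel ((f.add g).add h) (f.add (g.add h))
  | zero_add {X Y : Ob} (f : Term k X Y) : Rel ((zero X Y).add f) f
  | zero_smul {X Y : Ob} (f : Term k X Y) : Rel (f.smul 0) (zero X Y)
  | one_smul {X Y : Ob} (f : Term k X Y) : Rel (f.smul 1) f
  | mul_smul {X Y : Ob} (c d : k) (f : Term k X Y) : Rel (f.smul (c * d)) ((f.smul d).smul c)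
  | smul_add {X Y : Ob} (c : k) (f g : Term k X Y) :
      Rel ((f.add g).smul c) ((f.smul c).add (g.smul c))
  | add_smul {X Y : Ob} (c d : k) (f : Term k X Y) :
      Rel (f.smul (c + d)) ((f.smul c).add (f.smul d))
  -- bilinearity of composition and of the tensor product
  | add_comp {X Y Z : Ob} (f f' : Term k X Y) (g : Term k Y Z) :
      Rel (f.add f' ≫ₜ g) ((f ≫ₜ g).add (f' ≫ₜ g))
  | comp_add {X Y Z : Ob} (f : Term k X Y) (g g' : Term k Y Z) :
      Rel (f ≫ₜ g.add g') ((f ≫ₜ g).add (f ≫ₜ g'))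
  | smul_comp {X Y Z : Ob} (c : k) (f : Term k X Y) (g : Term k Y Z) :
      Rel (f.smul c ≫ₜ g) ((f ≫ₜ g).smul c)
  | comp_smul {X Y Z : Ob} (c : k) (f : Term k X Y) (g : Term k Y Z) :
      Rel (f ≫ₜ g.smul c) ((f ≫ₜ g).smul c)
  | wl_add (X : Ob) {Y Z : Ob} (f g : Term k Y Z) :
      Rel (X ◁ₜ f.add g) ((X ◁ₜ f).add (X ◁ₜ g))
  | wl_smul (X : Ob) {Y Z : Ob} (c : k) (f : Term k Y Z) :
      Rel (X ◁ₜ f.smul c) ((X ◁ₜ f).smul c)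
  | add_wr {X Y : Ob} (f g : Term k X Y) (Z : Ob) :
      Rel (f.add g ▷ₜ Z) ((f ▷ₜ Z).add (g ▷ₜ Z))
  | smul_wr {X Y : Ob} (c : k) (f : Term k X Y) (Z : Ob) :
      Rel (f.smul c ▷ₜ Z) ((f ▷ₜ Z).smul c)
  -- monoidal category
  | wl_id (X Y : Ob) : Rel (X ◁ₜ .id Y) (.id (X ⊗ₒ Y))
  | wl_comp (X : Ob) {Y Z W : Ob} (f : Term k Y Z) (g : Term k Z W) :
      Rel (X ◁ₜ (f ≫ₜ g)) ((X ◁ₜ f) ≫ₜ (X ◁ₜ g))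
  | id_wr (X Y : Ob) : Rel (.id X ▷ₜ Y) (.id (X ⊗ₒ Y))
  | comp_wr {X Y Z : Ob} (f : Term k X Y) (g : Term k Y Z) (W : Ob) :
      Rel ((f ≫ₜ g) ▷ₜ W) ((f ▷ₜ W) ≫ₜ (g ▷ₜ W))
  | exchange {X Y Z W : Ob} (f : Term k X Y) (g : Term k Z W) :
      Rel ((X ◁ₜ g) ≫ₜ (f ▷ₜ W)) ((f ▷ₜ Z) ≫ₜ (Y ◁ₜ g))
  | α_nat₁ {X X' : Ob} (f : Term k X X') (Y Z : Ob) :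
      Rel ((f ▷ₜ Y ▷ₜ Z) ≫ₜ α X' Y Z) (α X Y Z ≫ₜ (f ▷ₜ (Y ⊗ₒ Z)))
  | α_nat₂ (X : Ob) {Y Y' : Ob} (f : Term k Y Y') (Z : Ob) :
      Rel (((X ◁ₜ f) ▷ₜ Z) ≫ₜ α X Y' Z) (α X Y Z ≫ₜ (X ◁ₜ (f ▷ₜ Z)))
  | α_nat₃ (X Y : Ob) {Z Z' : Ob} (f : Term k Z Z') :
      Rel (((X ⊗ₒ Y) ◁ₜ f) ≫ₜ α X Y Z') (α X Y Z ≫ₜ (X ◁ₜ Y ◁ₜ f))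
  | l_nat {X Y : Ob} (f : Term k X Y) : Rel ((.one ◁ₜ f) ≫ₜ l Y) (l X ≫ₜ f)
  | r_nat {X Y : Ob} (f : Term k X Y) : Rel ((f ▷ₜ .one) ≫ₜ r Y) (r X ≫ₜ f)
  | α_αi (X Y Z : Ob) : Rel (α X Y Z ≫ₜ αi X Y Z) (.id _)
  | αi_α (X Y Z : Ob) : Rel (αi X Y Z ≫ₜ α X Y Z) (.id _)
  | l_li (X : Ob) : Rel (l X ≫ₜ li X) (.id _)
  | li_l (X : Ob) : Rel (li X ≫ₜ l X) (.id _)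
  | r_ri (X : Ob) : Rel (r X ≫ₜ ri X) (.id _)
  | ri_r (X : Ob) : Rel (ri X ≫ₜ r X) (.id _)
  | pentagon (W X Y Z : Ob) :
      Rel ((α W X Y ▷ₜ Z) ≫ₜ α W (X ⊗ₒ Y) Z ≫ₜ (W ◁ₜ α X Y Z)) (α (W ⊗ₒ X) Y Z ≫ₜ α W X (Y ⊗ₒ Z))
  | triangle (X Y : Ob) : Rel (α X .one Y ≫ₜ (X ◁ₜ l Y)) (r X ▷ₜ Y)
  -- isotopy invariance
  | zigzag₁ : Rel (ri .P ≫ₜ (.P ◁ₜ cupQP) ≫ₜ αi _ _ _ ≫ₜ (capPQ ▷ₜ .P) ≫ₜ l .P) (.id .P)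
  | zigzag₂ : Rel (li .Q ≫ₜ (cupQP ▷ₜ .Q) ≫ₜ α _ _ _ ≫ₜ (.Q ◁ₜ capPQ) ≫ₜ r .Q) (.id .Q)
  | zigzag₃ : Rel (ri .Q ≫ₜ (.Q ◁ₜ cupPQ) ≫ₜ αi _ _ _ ≫ₜ (capQP ▷ₜ .Q) ≫ₜ l .Q) (.id .Q)
  | zigzag₄ : Rel (li .P ≫ₜ (cupPQ ▷ₜ .P) ≫ₜ α _ _ _ ≫ₜ (.P ◁ₜ capQP) ≫ₜ r .P) (.id .P)
  | rot_left : Rel rotLeft t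
  | rot_right : Rel rotRight t
  -- local relations
  | s_s : Rel (s ≫ₜ s) (.id _)
  | t_t : Rel (t ≫ₜ t) (.id _)
  | braid_s : Rel (first .P s ≫ₜ second .P s ≫ₜ first .P s)
      (second .P s ≫ₜ first .P s ≫ₜ second .P s)
  | braid_t : Rel (first .Q t ≫ₜ second .Q t ≫ₜ first .Q t)
      (second .Q t ≫ₜ first .Q t ≫ₜ second .Q t)
  | down_up : Rel ((crossQP ≫ₜ crossPQ).add (capQP ≫ₜ cupQP)) (.id _)
  | up_down : Rel (crossPQ ≫ₜ crossQP) (.id _)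
  | bubble : Rel (cupQP ≫ₜ capQP) (.id _)
  | curl : Rel leftCurl (zero _ _)

end Term

variable (k : Type u) [CommRing k]

/-- Equality of diagrams modulo the relations. -/
def homSetoid (X Y : Ob) : Setoid (Term k X Y) :=
  ⟨Term.Rel, ⟨Term.Rel.refl, Term.Rel.symm, Term.Rel.trans⟩⟩

/-- The `k`-linear monoidal category of diagrams modulo relations, on tensor words. Its objects are put
into the universe of `k`-linear categories. -/
structure HeisPre (k : Type u) : Type (u + 1) where
  ob : Ob

namespace HeisPre

variable {k}

instance : Category.{u} (HeisPre k) where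
  Hom X Y := Quotient (homSetoid k X.ob Y.ob)
  id X := Quotient.mk _ (.id X.ob)
  comp := Quotient.map₂ Term.comp (fun _ _ h _ _ h' => .comp h h')
  id_comp := by rintro X Y ⟨f⟩; exact Quotient.sound (.id_comp f)
  comp_id := by rintro X Y ⟨f⟩; exact Quotient.sound (.comp_id f)
  assoc := by rintro X Y Z W ⟨f⟩ ⟨g⟩ ⟨h⟩; exact Quotient.sound (.assoc f g h)

/-- The morphism represented by a diagram. -/
def diag {X Y : Ob} (f : Term k X Y) : (⟨X⟩ : HeisPre k) ⟶ ⟨Y⟩ := Quotient.mk (homSetoid k X Y) f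

theorem diag_eq {X Y : Ob} {f g : Term k X Y} (h : Term.Rel f g) : diag f = diag g :=
  Quotient.sound (s := homSetoid k X Y) h

instance (X Y : HeisPre k) : Zero (X ⟶ Y) := ⟨diag (.zero X.ob Y.ob)⟩

instance (X Y : HeisPre k) : Add (X ⟶ Y) :=
  ⟨Quotient.map₂ Term.add (fun _ _ h _ _ h' => .add h h')⟩

instance (X Y : HeisPre k) : SMul k (X ⟶ Y) :=
  ⟨fun c => Quotient.map (Term.smul c) (fun _ _ h => .smul _ h)⟩

instance (X Y : HeisPre k) : Neg (X ⟶ Y) := ⟨fun f => (-1 : k) • f⟩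

instance (X Y : HeisPre k) : AddCommGroup (X ⟶ Y) where
  nsmul := nsmulRec
  zsmul := zsmulRec
  add_assoc := by rintro ⟨f⟩ ⟨g⟩ ⟨h⟩; exact Quotient.sound (.add_assoc f g h)
  add_comm := by rintro ⟨f⟩ ⟨g⟩; exact Quotient.sound (.add_comm f g)
  zero_add := by rintro ⟨f⟩; exact Quotient.sound (.zero_add f)
  add_zero := by rintro ⟨f⟩; exact Quotient.sound (.trans (.add_comm _ _) (.zero_add f))
  neg_add_cancel := by
    rintro ⟨f⟩
    refine Quotient.sound (.trans (.add (.refl _) (.symm (.one_smul f))) (.trans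
      (.symm (.add_smul _ _ f)) ?_))
    rw [neg_add_cancel]
    exact .zero_smul f

instance (X Y : HeisPre k) : Module k (X ⟶ Y) where
  one_smul := by rintro ⟨f⟩; exact Quotient.sound (.one_smul f)
  mul_smul := by rintro c d ⟨f⟩; exact Quotient.sound (.mul_smul c d f)
  smul_zero := by
    intro c
    refine Quotient.sound (.trans (.smul c (.symm (.zero_smul (.zero _ _)))) (.trans
      (.symm (.mul_smul _ _ _)) ?_))
    rw [mul_zero]
    exact .zero_smul _
  smul_add := by rintro c ⟨f⟩ ⟨g⟩; exact Quotient.sound (.smul_add c f g)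
  add_smul := by rintro c d ⟨f⟩; exact Quotient.sound (.add_smul c d f)
  zero_smul := by rintro ⟨f⟩; exact Quotient.sound (.zero_smul f)

instance : Preadditive (HeisPre k) where
  add_comp := by rintro X Y Z ⟨f⟩ ⟨f'⟩ ⟨g⟩; exact Quotient.sound (.add_comp f f' g)
  comp_add := by rintro X Y Z ⟨f⟩ ⟨g⟩ ⟨g'⟩; exact Quotient.sound (.comp_add f g g')

instance : Linear k (HeisPre k) where
  smul_comp := by rintro X Y Z c ⟨f⟩ ⟨g⟩; exact Quotient.sound (.smul_comp c f g)
  comp_smul := by rintro X Y Z ⟨f⟩ c ⟨g⟩; exact Quotient.sound (.comp_smul c f g)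

instance : MonoidalCategoryStruct (HeisPre k) where
  tensorObj X Y := ⟨X.ob ⊗ₒ Y.ob⟩
  tensorUnit := ⟨.one⟩
  whiskerLeft X _ _ := Quotient.map (Term.wl X.ob) (fun _ _ h => .wl _ h)
  whiskerRight f Z := Quotient.map (fun f => Term.wr f Z.ob) (fun _ _ h => .wr _ h) f
  associator X Y Z := ⟨diag (.α X.ob Y.ob Z.ob), diag (.αi X.ob Y.ob Z.ob),
    diag_eq (.α_αi _ _ _), diag_eq (.αi_α _ _ _)⟩
  leftUnitor X := ⟨diag (.l X.ob), diag (.li X.ob), diag_eq (.l_li _), diag_eq (.li_l _)⟩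
  rightUnitor X := ⟨diag (.r X.ob), diag (.ri X.ob), diag_eq (.r_ri _), diag_eq (.ri_r _)⟩

theorem wl_comp (X : HeisPre k) {Y Z W : HeisPre k} (f : Y ⟶ Z) (g : Z ⟶ W) :
    X ◁ (f ≫ g) = X ◁ f ≫ X ◁ g := by
  revert f g; rintro ⟨f⟩ ⟨g⟩; exact diag_eq (.wl_comp _ f g)

theorem comp_wr {X Y Z : HeisPre k} (f : X ⟶ Y) (g : Y ⟶ Z) (W : HeisPre k) :
    (f ≫ g) ▷ W = f ▷ W ≫ g ▷ W := by
  revert f g; rintro ⟨f⟩ ⟨g⟩; exact diag_eq (.comp_wr f g _)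

theorem exch {X Y Z W : HeisPre k} (f : X ⟶ Y) (g : Z ⟶ W) :
    X ◁ g ≫ f ▷ W = f ▷ Z ≫ Y ◁ g := by
  revert f g; rintro ⟨f⟩ ⟨g⟩; exact diag_eq (.exchange f g)

theorem assoc_nat₁ {X X' : HeisPre k} (f : X ⟶ X') (Y Z : HeisPre k) :
    f ▷ Y ▷ Z ≫ (α_ X' Y Z).hom = (α_ X Y Z).hom ≫ f ▷ (Y ⊗ Z) := by
  revert f; rintro ⟨f⟩; exact diag_eq (.α_nat₁ f _ _)

theorem assoc_nat₂ (X : HeisPre k) {Y Y' : HeisPre k} (f : Y ⟶ Y') (Z : HeisPre k) :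
    (X ◁ f) ▷ Z ≫ (α_ X Y' Z).hom = (α_ X Y Z).hom ≫ X ◁ (f ▷ Z) := by
  revert f; rintro ⟨f⟩; exact diag_eq (.α_nat₂ _ f _)

theorem assoc_nat₃ (X Y : HeisPre k) {Z Z' : HeisPre k} (f : Z ⟶ Z') :
    (X ⊗ Y) ◁ f ≫ (α_ X Y Z').hom = (α_ X Y Z).hom ≫ X ◁ Y ◁ f := by
  revert f; rintro ⟨f⟩; exact diag_eq (.α_nat₃ _ _ f)

instance : MonoidalCategory (HeisPre k) where
  tensorHom_def _ _ := rfl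
  whiskerLeft_id X Y := diag_eq (.wl_id X.ob Y.ob)
  id_whiskerRight X Y := diag_eq (.id_wr X.ob Y.ob)
  id_tensorHom_id X Y := diag_eq
    (.trans (.comp (.id_wr X.ob Y.ob) (.wl_id X.ob Y.ob)) (.id_comp _))
  tensorHom_comp_tensorHom {X₁ Y₁ Z₁ X₂ Y₂ Z₂} f₁ f₂ g₁ g₂ := by
    change (f₁ ▷ X₂ ≫ Y₁ ◁ f₂) ≫ g₁ ▷ Y₂ ≫ Z₁ ◁ g₂ = (f₁ ≫ g₁) ▷ X₂ ≫ Z₁ ◁ (f₂ ≫ g₂)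
    rw [wl_comp, comp_wr, Category.assoc, ← Category.assoc (Y₁ ◁ f₂), exch]
    simp only [Category.assoc]
  associator_naturality {X₁ X₂ X₃ Y₁ Y₂ Y₃} f₁ f₂ f₃ := by
    change ((f₁ ▷ X₂ ≫ Y₁ ◁ f₂) ▷ X₃ ≫ (Y₁ ⊗ Y₂) ◁ f₃) ≫ (α_ Y₁ Y₂ Y₃).hom =
      (α_ X₁ X₂ X₃).hom ≫ f₁ ▷ (X₂ ⊗ X₃) ≫ Y₁ ◁ (f₂ ▷ X₃ ≫ Y₂ ◁ f₃)
    rw [Category.assoc, assoc_nat₃, comp_wr, wl_comp, Category.assoc, ← Category.assoc ((Y₁ ◁ f₂) ▷ X₃),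
      assoc_nat₂, Category.assoc, ← Category.assoc, assoc_nat₁, Category.assoc]
  leftUnitor_naturality := by rintro X Y ⟨f⟩; exact diag_eq (.l_nat f)
  rightUnitor_naturality := by rintro X Y ⟨f⟩; exact diag_eq (.r_nat f)
  pentagon W X Y Z := diag_eq (.pentagon W.ob X.ob Y.ob Z.ob)
  triangle X Y := diag_eq (.triangle X.ob Y.ob)

instance : MonoidalPreadditive (HeisPre k) where
  whiskerLeft_zero := by
    rintro X Y Z
    refine diag_eq (.trans (.wl _ (.symm (.zero_smul (.zero _ _)))) (.trans (.wl_smul _ _ _) ?_))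
    exact .zero_smul _
  zero_whiskerRight := by
    rintro X Y Z
    refine diag_eq (.trans (.wr _ (.symm (.zero_smul (.zero _ _)))) (.trans (.smul_wr _ _ _) ?_))
    exact .zero_smul _
  whiskerLeft_add := by rintro X Y Z ⟨f⟩ ⟨g⟩; exact diag_eq (.wl_add _ f g)
  add_whiskerRight := by rintro X Y Z ⟨f⟩ ⟨g⟩; exact diag_eq (.add_wr f g _)

end HeisPre
/-- The inclusion `S_n → S_{n+1}` as the stabiliser of the last point. -/
def incl (n : ℕ) : Perm (Fin n) →* Perm (Fin (n + 1)) where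
  toFun σ := (finSuccEquivLast.trans σ.optionCongr).trans finSuccEquivLast.symm
  map_one' := by ext i; induction i using Fin.lastCases <;> simp
  map_mul' σ τ := by ext i; induction i using Fin.lastCases <;> simp

@[simp] theorem incl_castSucc {n : ℕ} (σ : Perm (Fin n)) (i : Fin n) :
    incl n σ i.castSucc = (σ i).castSucc := by simp [incl]

@[simp] theorem incl_last {n : ℕ} (σ : Perm (Fin n)) : incl n σ (Fin.last n) = Fin.last n := by
  simp [incl]

theorem incl_injective (n : ℕ) : Function.Injective (incl n) := by
  intro σ τ h
  ext i
  have := congrArg (fun f => (f i.castSucc).val) h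
  simpa using this

theorem exists_incl {n : ℕ} {σ : Perm (Fin (n + 1))} (h : σ (Fin.last n) = Fin.last n) :
    ∃ τ, incl n τ = σ := by
  have h' : σ⁻¹ (Fin.last n) = Fin.last n := by rw [Perm.inv_eq_iff_eq, h]
  have key : ∀ {ρ : Perm (Fin (n + 1))}, ρ (Fin.last n) = Fin.last n → ∀ i : Fin n,
      ρ i.castSucc ≠ Fin.last n := fun {ρ} hρ i hi =>
    i.castSucc_ne_last (ρ.injective (hi.trans hρ.symm))
  refine ⟨⟨fun i => (σ i.castSucc).castPred (key h i), fun i => (σ⁻¹ i.castSucc).castPred (key h' i),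
    fun i => ?_, fun i => ?_⟩, ?_⟩
  · simp
  · simp
  · ext i
    induction i using Fin.lastCases with
    | last => rw [incl_last, h]
    | cast i => rw [incl_castSucc]; rfl

/-- The transposition of the neighbours `i` and `i + 1` in `Fin (n + 1)` (trivial if `n ≤ i`). -/
def adj (n i : ℕ) : Perm (Fin (n + 1)) :=
  if h : i < n then swap (⟨i, by omega⟩ : Fin (n + 1)) ⟨i + 1, by omega⟩ else 1

theorem adj_of_lt {n i : ℕ} (h : i < n) :
    adj n i = swap (⟨i, by omega⟩ : Fin (n + 1)) ⟨i + 1, by omega⟩ := dif_pos h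

theorem incl_adj {n i : ℕ} (h : i < n) : incl (n + 1) (adj n i) = adj (n + 1) i := by
  rw [adj_of_lt h, adj_of_lt (by omega)]
  ext j
  induction j using Fin.lastCases with
  | last =>
    rw [incl_last, swap_apply_of_ne_of_ne] <;> simp [Fin.ext_iff] <;> omega
  | cast j =>
    rw [incl_castSucc, swap_apply_def, swap_apply_def]
    simp only [Fin.ext_iff, Fin.val_castSucc]
    split_ifs <;> rfl

/-- The Coxeter relations of type `A` for `n` elements of a monoid. -/
structure IsCoxeter {M : Type*} [Monoid M] (n : ℕ) (s : ℕ → M) : Prop where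
  sq : ∀ i < n, s i * s i = 1
  braid : ∀ i, i + 1 < n → s i * s (i + 1) * s i = s (i + 1) * s i * s (i + 1)
  comm : ∀ i j, i + 1 < j → j < n → s i * s j = s j * s i

namespace IsCoxeter

variable {M : Type*} [Monoid M]

/-- `cyc s i m = s_i s_{i+1} ⋯ s_{i+m-1}` -/
def cyc (s : ℕ → M) (i : ℕ) : ℕ → M
  | 0 => 1
  | m + 1 => s i * cyc s (i + 1) m

theorem comm_cyc {n : ℕ} {s : ℕ → M} (h : IsCoxeter n s) (j : ℕ) :
    ∀ m i, j + 1 < i → i + m ≤ n → s j * cyc s i m = cyc s i m * s j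
  | 0, _, _, _ => by simp [cyc]
  | m + 1, i, hi, hm => by
    rw [cyc, ← mul_assoc, h.comm j i hi (by omega), mul_assoc,
      comm_cyc h j m (i + 1) (by omega) (by omega), mul_assoc]

theorem shift_cyc {n : ℕ} {s : ℕ → M} (h : IsCoxeter n s) (j : ℕ) :
    ∀ m i, i ≤ j → j + 1 < i + m → i + m ≤ n → s (j + 1) * cyc s i m = cyc s i m * s j
  | 0, i, h1, h2, _ => by omega
  | m + 1, i, h1, h2, h3 => by
    rcases h1.eq_or_lt with rfl | h1
    · obtain ⟨m, rfl⟩ : ∃ m', m = m' + 1 := ⟨m - 1, by omega⟩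
      simp only [cyc]
      calc s (i + 1) * (s i * (s (i + 1) * cyc s (i + 1 + 1) m))
          = s (i + 1) * s i * s (i + 1) * cyc s (i + 1 + 1) m := by simp only [mul_assoc]
        _ = s i * s (i + 1) * (s i * cyc s (i + 1 + 1) m) := by
          rw [← h.braid i (by omega)]; simp only [mul_assoc]
        _ = _ := by rw [h.comm_cyc i m _ (by omega) (by omega)]; simp only [mul_assoc]
    · rw [cyc, ← mul_assoc, ← h.comm i (j + 1) (by omega) (by omega), mul_assoc,
        shift_cyc h j m (i + 1) (by omega) (by omega) (by omega), mul_assoc]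

theorem mono {n : ℕ} {s : ℕ → M} (h : IsCoxeter (n + 1) s) : IsCoxeter n s :=
  ⟨fun i hi => h.sq i (by omega), fun i hi => h.braid i (by omega),
    fun i j hij hj => h.comm i j hij (by omega)⟩

theorem adj (n : ℕ) : IsCoxeter n (adj n) where
  sq i hi := by rw [adj_of_lt hi, swap_mul_self]
  braid i hi := by
    rw [adj_of_lt hi, adj_of_lt (show i < n by omega)]
    have h (x y z : Fin (n + 1)) (hxy : x ≠ y) (hxz : x ≠ z) (hyz : y ≠ z) :
        swap x y * swap y z * swap x y = swap y z * swap x y * swap y z := by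
      rw [swap_mul_swap_mul_swap hxy hxz, swap_comm x y, swap_comm y z,
        swap_mul_swap_mul_swap hyz.symm hxz.symm, swap_comm]
    exact h _ _ _ (by simp [Fin.ext_iff]) (by simp [Fin.ext_iff]; omega) (by simp [Fin.ext_iff])
  comm i j hij hj := by
    rw [adj_of_lt hj, adj_of_lt (show i < n by omega)]
    refine (Perm.Disjoint.commute ?_)
    rw [Perm.disjoint_iff_disjoint_support, Perm.support_swap, Perm.support_swap]
    all_goals simp [Fin.ext_iff]
    all_goals omega

theorem cyc_adj_last (n : ℕ) : ∀ m i (h : i + m = n),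
    cyc (Heis.adj n) i m (Fin.last n) = ⟨i, by omega⟩
  | 0, i, h => by subst h; simp [cyc]; rfl
  | m + 1, i, h => by
    rw [cyc, Perm.mul_apply, cyc_adj_last n m (i + 1) (by omega), adj_of_lt (by omega),
      swap_apply_right]

theorem exists_decomp (n : ℕ) (σ : Perm (Fin (n + 2))) :
    ∃ m i, ∃ τ : Perm (Fin (n + 1)), i + m = n + 1 ∧
      σ = cyc (Heis.adj (n + 1)) i m * incl (n + 1) τ := by
  obtain ⟨τ, hτ⟩ := exists_incl (n := n + 1)
    (σ := (cyc (Heis.adj (n + 1)) (σ (Fin.last _)).val (n + 1 - (σ (Fin.last _)).val))⁻¹ * σ) (by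
      rw [Perm.mul_apply, Perm.inv_eq_iff_eq, cyc_adj_last (n + 1) _ _ (by omega)])
  exact ⟨n + 1 - (σ (Fin.last _)).val, (σ (Fin.last _)).val, τ, by omega,
    by rw [hτ, mul_inv_cancel_left]⟩

/-- Elements satisfying the Coxeter relations define a homomorphism from the symmetric group. -/
theorem exists_hom : ∀ (n : ℕ) (s : ℕ → M), IsCoxeter n s →
    ∃ φ : Perm (Fin (n + 1)) →* M, ∀ i < n, φ (Heis.adj n i) = s i
  | 0, _, _ => ⟨1, by simp⟩
  | n + 1, s, h => by
    obtain ⟨φ, hφ⟩ := exists_hom n s h.mono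
    have ht := IsCoxeter.adj (n + 1)
    have uniq : ∀ {m i : ℕ} {τ : Perm (Fin (n + 1))} {m' i' : ℕ} {τ' : Perm (Fin (n + 1))},
        i + m = n + 1 → i' + m' = n + 1 → cyc (Heis.adj (n + 1)) i m * incl (n + 1) τ =
          cyc (Heis.adj (n + 1)) i' m' * incl (n + 1) τ' → m = m' ∧ i = i' ∧ τ = τ' := by
      intro m i τ m' i' τ' h1 h2 he
      have h3 := congrArg (fun f => (f (Fin.last (n + 1))).val) he
      simp only [Perm.mul_apply, incl_last, cyc_adj_last _ _ _ h1, cyc_adj_last _ _ _ h2] at h3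
      obtain rfl := h3
      obtain rfl : m = m' := by omega
      exact ⟨rfl, rfl, incl_injective _ (mul_left_cancel he)⟩
    choose m i τ hmi hdec using exists_decomp n
    let Φ : Perm (Fin (n + 2)) → M := fun σ => cyc s (i σ) (m σ) * φ (τ σ)
    have hΦ : ∀ m i τ, i + m = n + 1 →
        Φ (cyc (Heis.adj (n + 1)) i m * incl (n + 1) τ) = cyc s i m * φ τ := by
      intro m' i' τ' h1
      obtain ⟨h2, h3, h4⟩ := uniq h1 (hmi _) (hdec (cyc (Heis.adj (n + 1)) i' m' * incl (n + 1) τ'))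
      simp only [Φ]
      rw [← h2, ← h3, ← h4]
    have h1 : Φ 1 = 1 := by
      have := hΦ 0 (n + 1) 1 rfl
      simpa [cyc] using this
    have hstep : ∀ j < n + 1, ∀ σ, Φ (Heis.adj (n + 1) j * σ) = s j * Φ σ := by
      intro j hj σ
      obtain ⟨m, i, τ, hm, rfl⟩ := exists_decomp n σ
      rw [hΦ m i τ hm]
      rcases lt_trichotomy j i with hji | rfl | hji
      · rcases Nat.lt_or_ge (j + 1) i with h2 | h2
        · rw [← mul_assoc, ht.comm_cyc j m i h2 (by omega), mul_assoc, ← incl_adj (by omega),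
            ← map_mul, hΦ _ _ _ hm, map_mul, hφ j (by omega), ← mul_assoc,
            ← h.comm_cyc j m i h2 (by omega), mul_assoc]
        · obtain rfl : i = j + 1 := by omega
          have := hΦ (m + 1) j τ (by omega)
          simpa only [cyc, mul_assoc] using this
      · obtain ⟨m, rfl⟩ : ∃ m', m = m' + 1 := ⟨m - 1, by omega⟩
        simp only [cyc]
        rw [← mul_assoc, ← mul_assoc, ht.sq j hj, one_mul, hΦ m (j + 1) τ (by omega), ← mul_assoc,
          ← mul_assoc, h.sq j hj, one_mul]
      · obtain ⟨j, rfl⟩ : ∃ j', j = j' + 1 := ⟨j - 1, by omega⟩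
        rw [← mul_assoc, ht.shift_cyc j m i (by omega) (by omega) (by omega), mul_assoc,
          ← incl_adj (by omega), ← map_mul, hΦ _ _ _ hm, map_mul, hφ j (by omega), ← mul_assoc,
          ← h.shift_cyc j m i (by omega) (by omega) (by omega), mul_assoc]
    have hgen : ∀ j < n + 1, Φ (Heis.adj (n + 1) j) = s j := fun j hj => by
      have := hstep j hj 1
      rwa [mul_one, h1, mul_one] at this
    have hmul : ∀ σ τ, Φ (σ * τ) = Φ σ * Φ τ := by
      intro σ
      have hσ : σ ∈ Submonoid.closure (Set.range fun i : Fin (n + 1) => swap i.castSucc i.succ) := by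
        rw [Perm.mclosure_swap_castSucc_succ]; trivial
      induction hσ using Submonoid.closure_induction with
      | one => intro τ; rw [one_mul, h1, one_mul]
      | mem x hx =>
        obtain ⟨j, rfl⟩ := hx
        intro τ
        have : swap j.castSucc j.succ = Heis.adj (n + 1) j.val := by rw [adj_of_lt j.isLt]; rfl
        simp only [this]
        rw [hstep _ j.isLt, hgen _ j.isLt]
      | mul x y _ _ hx hy => intro τ; rw [_root_.mul_assoc x y τ, hx, hy, hx y, _root_.mul_assoc (Φ x)]
    exact ⟨⟨⟨Φ, h1⟩, hmul⟩, hgen⟩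

end IsCoxeter

noncomputable section

/-- Partitions of `n`. -/
abbrev Part (n : ℕ) : Type := {Y : YoungDiagram // Y.card = n}

theorem card_transpose (Y : YoungDiagram) : Y.transpose.card = Y.card := by
  refine Finset.card_bij (fun c _ => c.swap) ?_ ?_ ?_
  · intro c hc; simpa using hc
  · intro c _ c' _ h; simpa using h
  · intro c hc; exact ⟨c.swap, by simpa using hc, by simp⟩

instance (n : ℕ) : Finite (Part n) := by
  refine Finite.of_injective (β := (Finset.range n ×ˢ Finset.range n).powerset)
    (fun Y => ⟨Y.1.cells, ?_⟩) ?_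
  · rw [Finset.mem_powerset]
    rintro ⟨i, j⟩ hc
    have h1 : Y.1.row i ⊆ Y.1.cells := Finset.filter_subset _ _
    have h2 : Y.1.col j ⊆ Y.1.cells := Finset.filter_subset _ _
    have h3 := Finset.card_le_card h1
    have h4 := Finset.card_le_card h2
    rw [← YoungDiagram.rowLen_eq_card] at h3
    rw [← YoungDiagram.colLen_eq_card] at h4
    have h5 := YoungDiagram.mem_iff_lt_rowLen.1 hc
    have h6 := YoungDiagram.mem_iff_lt_colLen.1 hc
    have h7 := Y.2
    simp only [Finset.mem_product, Finset.mem_range]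
    unfold YoungDiagram.card at h7
    omega
  · intro Y Y' h
    exact Subtype.ext (YoungDiagram.ext (congrArg Subtype.val h))

instance (n : ℕ) : Fintype (Part n) := Fintype.ofFinite _

namespace Part

variable {n : ℕ} (l : Part n)

/-- The conjugate partition. -/
def transpose : Part n := ⟨l.1.transpose, (card_transpose _).trans l.2⟩

/-- The standard filling of the diagram row by row: `l.cell i` is the cell (row, column) with entry `i`. -/
def cell : Fin n ↪ ℕ × ℕ :=
  ((l.1.cells.map toLex.toEmbedding).orderEmbOfFin
    ((Finset.card_map _).trans l.2)).toEmbedding.trans ofLex.toEmbedding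

theorem mem_cells {c : ℕ × ℕ} : c ∈ l.1.cells ↔ ∃ i, l.cell i = c := by
  have := Finset.range_orderEmbOfFin (l.1.cells.map toLex.toEmbedding) ((Finset.card_map _).trans l.2)
  have := Set.ext_iff.1 this (toLex c)
  rw [Set.mem_range, Finset.mem_coe, Finset.mem_map_equiv] at this
  exact this.symm.trans (exists_congr fun i => Iff.rfl)

/-- Permutations that preserve the rows of the filling. -/
def rowPerms : Subgroup (Perm (Fin n)) where
  carrier := {σ | ∀ i, (l.cell (σ i)).1 = (l.cell i).1}
  mul_mem' h h' i := (h _).trans (h' i)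
  one_mem' _ := rfl
  inv_mem' {σ} h i := by simpa using (h (σ⁻¹ i)).symm

/-- Permutations that preserve the columns of the filling. -/
def colPerms : Subgroup (Perm (Fin n)) where
  carrier := {σ | ∀ i, (l.cell (σ i)).2 = (l.cell i).2}
  mul_mem' h h' i := (h _).trans (h' i)
  one_mem' _ := rfl
  inv_mem' {σ} h i := by simpa using (h (σ⁻¹ i)).symm

variable (k : Type u) [Field k]

open Classical in
/-- Sum of the row permutations. -/
def rowSum : MonoidAlgebra k (Perm (Fin n)) := ∑ σ with σ ∈ l.rowPerms, MonoidAlgebra.of k _ σ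

open Classical in
/-- Signed sum of the column permutations. -/
def colSum : MonoidAlgebra k (Perm (Fin n)) :=
  ∑ σ with σ ∈ l.colPerms, ((Perm.sign σ : ℤ) : k) • MonoidAlgebra.of k _ σ

/-- The Young symmetrizer, not normalized: antisymmetrize columns first, then symmetrize rows. -/
def youngSym : MonoidAlgebra k (Perm (Fin n)) := l.rowSum k * l.colSum k

theorem rowSum_mul {p : Perm (Fin n)} (hp : p ∈ l.rowPerms) :
    l.rowSum k * MonoidAlgebra.of k _ p = l.rowSum k := by
  classical
  rw [rowSum, Finset.sum_mul]
  refine Finset.sum_equiv (Equiv.mulRight p) (fun σ => ?_) (fun σ _ => ?_)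
  · simp [Subgroup.mul_mem_cancel_right _ hp]
  · rw [← map_mul]; rfl

theorem mul_colSum {q : Perm (Fin n)} (hq : q ∈ l.colPerms) :
    MonoidAlgebra.of k _ q * l.colSum k = ((Perm.sign q : ℤ) : k) • l.colSum k := by
  classical
  rw [colSum, Finset.mul_sum, Finset.smul_sum]
  refine Finset.sum_equiv (Equiv.mulLeft q) (fun σ => ?_) (fun σ _ => ?_)
  · simp [Subgroup.mul_mem_cancel_left _ hq]
  · rw [mul_smul_comm, ← map_mul, smul_smul, Equiv.coe_mulLeft, Perm.sign_mul]
    congr 1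
    obtain h | h := Int.units_eq_one_or (Perm.sign q) <;> simp [h]

theorem mem_of_inj (σ : Perm (Fin n)) (h : ∀ i j, (l.cell i).1 = (l.cell j).1 →
    (l.cell (σ i)).2 = (l.cell (σ j)).2 → i = j) (i : Fin n) :
    ((l.cell i).1, (l.cell (σ i)).2) ∈ l.1.cells := by
  let f : Fin n → ℕ × ℕ := fun i => ((l.cell i).1, (l.cell (σ i)).2)
  have hf : Function.Injective f := fun i j e => h i j (Prod.ext_iff.1 e).1 (Prod.ext_iff.1 e).2
  let A := Finset.univ.image f
  let w : ℕ × ℕ → ℤ := fun x => (x.2 : ℤ) - l.1.rowLen x.1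
  have hcells : l.1.cells = Finset.univ.image l.cell := by
    ext c; simp [l.mem_cells]
  have hsum : ∑ x ∈ A, w x = ∑ x ∈ l.1.cells, w x := by
    rw [hcells, Finset.sum_image (fun _ _ _ _ e => hf e),
      Finset.sum_image (fun _ _ _ _ e => l.cell.injective e)]
    simp only [w, f, Finset.sum_sub_distrib]
    rw [Equiv.sum_comp σ (fun i => ((l.cell i).2 : ℤ))]
  have hsub : l.1.cells ⊆ A := by
    rw [← Finset.sdiff_eq_empty_iff_subset]
    by_contra hne
    have h1 : ∑ x ∈ l.1.cells \ A, w x < 0 := by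
      refine Finset.sum_neg (fun x hx => ?_) (Finset.nonempty_iff_ne_empty.2 hne)
      have := YoungDiagram.mem_iff_lt_rowLen.1 (Finset.mem_sdiff.1 hx).1
      simp only [w]; omega
    have h2 : 0 ≤ ∑ x ∈ A \ l.1.cells, w x := by
      refine Finset.sum_nonneg (fun x hx => ?_)
      have := mt YoungDiagram.mem_iff_lt_rowLen.2 (Finset.mem_sdiff.1 hx).2
      simp only [w]; omega
    have h3 := Finset.sum_sdiff_sub_sum_sdiff (s₁ := A) (s₂ := l.1.cells) (f := w)
    omega
  have hA : A = l.1.cells := by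
    refine (Finset.eq_of_subset_of_card_le hsub ?_).symm
    rw [Finset.card_image_of_injective _ hf, Finset.card_univ, Fintype.card_fin]
    exact l.2.ge
  rw [← hA]
  exact Finset.mem_image_of_mem f (Finset.mem_univ i)

theorem exists_factor (σ : Perm (Fin n)) (h : ∀ i j, (l.cell i).1 = (l.cell j).1 →
    (l.cell (σ⁻¹ i)).2 = (l.cell (σ⁻¹ j)).2 → i = j) :
    ∃ p ∈ l.rowPerms, ∃ q ∈ l.colPerms, σ = p * q := by
  choose g hg using fun i => l.mem_cells.1 (l.mem_of_inj σ⁻¹ h i)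
  have hginj : Function.Injective g := fun i j e => by
    have := (hg i).symm.trans ((congrArg l.cell e).trans (hg j))
    exact h i j (Prod.ext_iff.1 this).1 (Prod.ext_iff.1 this).2
  let p : Perm (Fin n) := Equiv.ofBijective g (Finite.injective_iff_bijective.1 hginj)
  have hp : p ∈ l.rowPerms := fun i => (Prod.ext_iff.1 (hg i)).1
  refine ⟨p⁻¹, inv_mem hp, p * σ, fun i => ?_, by simp⟩
  have := (Prod.ext_iff.1 (hg (σ i))).2
  rw [← Perm.mul_apply, inv_mul_cancel] at this
  exact this

theorem sandwich [CharZero k] (σ : Perm (Fin n)) : ∃ r : k,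
    l.rowSum k * MonoidAlgebra.of k _ σ * l.colSum k = r • l.youngSym k := by
  by_cases h : ∀ i j, (l.cell i).1 = (l.cell j).1 →
    (l.cell (σ⁻¹ i)).2 = (l.cell (σ⁻¹ j)).2 → i = j
  · obtain ⟨p, hp, q, hq, rfl⟩ := l.exists_factor σ h
    refine ⟨((Perm.sign q : ℤ) : k), ?_⟩
    rw [map_mul, ← mul_assoc, l.rowSum_mul k hp, mul_assoc, l.mul_colSum k hq, mul_smul_comm]
    rfl
  · push Not at h
    obtain ⟨i, j, h1, h2, h3⟩ := h
    refine ⟨0, ?_⟩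
    have ht : swap i j ∈ l.rowPerms := fun x => by
      rw [swap_apply_def]; split_ifs with ha hb <;> simp_all
    have ht' : swap (σ⁻¹ i) (σ⁻¹ j) ∈ l.colPerms := fun x => by
      rw [swap_apply_def]; split_ifs with ha hb <;> simp_all
    have key : l.rowSum k * MonoidAlgebra.of k _ σ * l.colSum k =
        -(l.rowSum k * MonoidAlgebra.of k _ σ * l.colSum k) := by
      conv_lhs => rw [← l.rowSum_mul k ht, mul_assoc (l.rowSum k), ← map_mul,
        show swap i j * σ = σ * swap (σ⁻¹ i) (σ⁻¹ j) by rw [mul_swap_eq_swap_mul]; simp, map_mul,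
        ← mul_assoc, mul_assoc, l.mul_colSum k ht', Perm.sign_swap (by simpa using h3)]
      simp
    rw [zero_smul]
    have h2 : (2 : k) • (l.rowSum k * MonoidAlgebra.of k _ σ * l.colSum k) = 0 := by
      rw [two_smul]; nth_rewrite 1 [key]; exact neg_add_cancel _
    exact (smul_eq_zero.1 h2).resolve_left two_ne_zero

theorem exists_sq [CharZero k] : ∃ r : k, l.youngSym k * l.youngSym k = r • l.youngSym k := by
  have h (x : MonoidAlgebra k (Perm (Fin n))) : ∃ r : k,
      l.rowSum k * x * l.colSum k = r • l.youngSym k := by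
    induction x using MonoidAlgebra.induction_on with
    | of σ => exact l.sandwich k σ
    | add x y hx hy =>
      obtain ⟨r, hr⟩ := hx
      obtain ⟨r', hr'⟩ := hy
      exact ⟨r + r', by rw [mul_add, add_mul, hr, hr', add_smul]⟩
    | smul c x hx =>
      obtain ⟨r, hr⟩ := hx
      exact ⟨c * r, by rw [mul_smul_comm, smul_mul_assoc, hr, smul_smul]⟩
  obtain ⟨r, hr⟩ := h (l.colSum k * l.rowSum k)
  exact ⟨r, by rw [← hr]; simp only [youngSym, mul_assoc]⟩

theorem coeff_youngSym : (l.youngSym k).coeff 1 = 1 := by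
  classical
  have term : ∀ p ∈ l.rowPerms, ∀ q ∈ l.colPerms, (MonoidAlgebra.of k _ p *
      (((Perm.sign q : ℤ) : k) • MonoidAlgebra.of k _ q)).coeff 1 =
        if p = 1 then if q = 1 then 1 else 0 else 0 := by
    intro p hp q hq
    have h1 : (MonoidAlgebra.of k _ p * (((Perm.sign q : ℤ) : k) • MonoidAlgebra.of k _ q)).coeff 1 =
        if p * q = 1 then ((Perm.sign q : ℤ) : k) else 0 := by
      rw [mul_smul_comm, ← map_mul]
      simp [Finsupp.single_apply]
    have h2 : p * q = 1 → p = 1 := fun e => Equiv.ext fun i => l.cell.injective (Prod.ext (hp i) (by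
      have hq' := inv_mem hq
      rw [← eq_inv_of_mul_eq_one_left e] at hq'
      exact hq' i))
    rw [h1]
    by_cases e : p = 1
    · subst e
      by_cases e' : q = 1 <;> simp [e']
    · simp [e, mt h2 e]
  rw [youngSym, rowSum, colSum, Finset.sum_mul_sum]
  simp only [MonoidAlgebra.coeff_sum, Finsupp.finsetSum_apply]
  rw [Finset.sum_congr rfl fun p hp => Finset.sum_congr rfl fun q hq =>
    term p (Finset.mem_filter.1 hp).2 q (Finset.mem_filter.1 hq).2]
  simp [Finset.sum_ite_eq', l.rowPerms.one_mem, l.colPerms.one_mem]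

theorem sq_ne_zero [CharZero k] : l.youngSym k * l.youngSym k ≠ 0 := by
  intro h
  have h1 : IsNilpotent (LinearMap.mulLeft k (l.youngSym k)) :=
    ⟨2, by rw [pow_two, Module.End.mul_eq_comp, ← LinearMap.mulLeft_mul, h, LinearMap.mulLeft_zero_eq_zero]⟩
  have h2 := (LinearMap.isNilpotent_trace_of_isNilpotent h1).eq_zero
  rw [LinearMap.trace_eq_matrix_trace k (Module.Basis.ofRepr (MonoidAlgebra.coeffLinearEquiv k))] at h2
  have h3 (σ : Perm (Fin n)) : (l.youngSym k * MonoidAlgebra.single σ 1).coeff σ = 1 := by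
    rw [MonoidAlgebra.coeff_mul_single_apply, mul_inv_cancel, coeff_youngSym, mul_one]
  have h4 : ∑ _σ : Perm (Fin n), (1 : k) = 0 := by
    rw [← h2, Matrix.trace]
    refine Finset.sum_congr rfl fun σ _ => ?_
    rw [Matrix.diag_apply, LinearMap.toMatrix_apply, ← h3 σ]
    rfl
  rw [Finset.sum_const, Finset.card_univ, nsmul_eq_mul, mul_one] at h4
  exact Fintype.card_ne_zero (Nat.cast_eq_zero.1 h4)

/-- The Young idempotent: the multiple of the Young symmetrizer that is idempotent. -/
def young : MonoidAlgebra k (Perm (Fin n)) :=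
  ((l.youngSym k * l.youngSym k).coeff 1)⁻¹ • l.youngSym k

theorem young_mul_young [CharZero k] : l.young k * l.young k = l.young k := by
  obtain ⟨r, hr⟩ := l.exists_sq k
  have hr' : (l.youngSym k * l.youngSym k).coeff 1 = r := by
    rw [hr]; simp [coeff_youngSym]
  have hr0 : r ≠ 0 := by
    rintro rfl
    exact l.sq_ne_zero k (by rw [hr, zero_smul])
  rw [young, hr', smul_mul_smul_comm, hr, smul_smul, mul_assoc, inv_mul_cancel₀ hr0, mul_one]

end Part

end

noncomputable section

section Powers

variable {C : Type*} [Category C] [MonoidalCategory C] (X : C)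

/-- `X^{⊗ n}`, the `n`-th factor is on the right. -/
def powR : ℕ → C
  | 0 => 𝟙_ C
  | n + 1 => powR n ⊗ X

/-- `X^{⊗ n}`, the `n`-th factor is on the left. -/
def powL : ℕ → C
  | 0 => 𝟙_ C
  | n + 1 => X ⊗ powL n

variable {X} (s : X ⊗ X ⟶ X ⊗ X) (W : C)

/-- The endomorphism `s` of the last two factors of `(W ⊗ X) ⊗ X`. -/
def atR : (W ⊗ X) ⊗ X ⟶ (W ⊗ X) ⊗ X := (α_ W X X).hom ≫ W ◁ s ≫ (α_ W X X).inv

/-- The endomorphism `s` of the first two factors of `X ⊗ (X ⊗ W)`. -/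
def atL : X ⊗ (X ⊗ W) ⟶ X ⊗ (X ⊗ W) := (α_ X X W).inv ≫ s ▷ W ≫ (α_ X X W).hom

/-- The endomorphism `s` of the tensor factors `i`, `i + 1` of `X^{⊗ (n+1)}`, counted from the left
starting at `0`, for `i < n`. -/
def crossR : ∀ n : ℕ, ℕ → (powR X (n + 1) ⟶ powR X (n + 1))
  | 0, _ => 𝟙 _
  | n + 1, i => if i = n then atR s (powR X n) else crossR n i ▷ X

/-- The endomorphism `s` of the tensor factors `i`, `i + 1` of `X^{⊗ (n+1)}`, counted from the right
starting at `0`, for `i < n`. -/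
def crossL : ∀ n : ℕ, ℕ → (powL X (n + 1) ⟶ powL X (n + 1))
  | 0, _ => 𝟙 _
  | n + 1, i => if i = n then atL s (powL X n) else X ◁ crossL n i

theorem atR_comm {W : C} (f : W ⟶ W) : f ▷ X ▷ X ≫ atR s W = atR s W ≫ f ▷ X ▷ X := by
  have h : f ▷ X ▷ X = (α_ W X X).hom ≫ f ▷ (X ⊗ X) ≫ (α_ W X X).inv := by simp
  simp only [h, atR, Category.assoc, Iso.inv_hom_id_assoc, whisker_exchange_assoc]

theorem atL_comm {W : C} (f : W ⟶ W) : X ◁ X ◁ f ≫ atL s W = atL s W ≫ X ◁ X ◁ f := by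
  have h : X ◁ X ◁ f = (α_ X X W).inv ≫ (X ⊗ X) ◁ f ≫ (α_ X X W).hom := by simp
  simp only [h, atL, Category.assoc, Iso.hom_inv_id_assoc, whisker_exchange_assoc]

variable {s}

theorem atR_sq (hs : s ≫ s = 𝟙 _) : atR s W ≫ atR s W = 𝟙 _ := by
  simp [atR, ← MonoidalCategory.whiskerLeft_comp_assoc, hs]

theorem atL_sq (hs : s ≫ s = 𝟙 _) : atL s W ≫ atL s W = 𝟙 _ := by
  simp [atL, ← comp_whiskerRight_assoc, hs]

theorem atR_braid (hb : s ▷ X ≫ atR s X ≫ s ▷ X = atR s X ≫ s ▷ X ≫ atR s X) :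
    atR s W ▷ X ≫ atR s (W ⊗ X) ≫ atR s W ▷ X =
      atR s (W ⊗ X) ≫ atR s W ▷ X ≫ atR s (W ⊗ X) := by
  have h1 : atR s W ▷ X = ((α_ W X X).hom ▷ X ≫ (α_ W (X ⊗ X) X).hom) ≫ W ◁ (s ▷ X) ≫
    ((α_ W (X ⊗ X) X).inv ≫ (α_ W X X).inv ▷ X) := by simp [atR]
  have h2 : atR s (W ⊗ X) = ((α_ W X X).hom ▷ X ≫ (α_ W (X ⊗ X) X).hom) ≫ W ◁ atR s X ≫
    ((α_ W (X ⊗ X) X).inv ≫ (α_ W X X).inv ▷ X) := by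
    simp only [atR]; monoidal
  have h3 := congrArg (W ◁ ·) hb
  simp only [MonoidalCategory.whiskerLeft_comp] at h3
  rw [h1, h2]
  simp [reassoc_of% h3]

theorem atL_braid (hb : s ▷ X ≫ atR s X ≫ s ▷ X = atR s X ≫ s ▷ X ≫ atR s X) :
    X ◁ atL s W ≫ atL s (X ⊗ W) ≫ X ◁ atL s W =
      atL s (X ⊗ W) ≫ X ◁ atL s W ≫ atL s (X ⊗ W) := by
  have h1 : X ◁ atL s W = ((α_ X X (X ⊗ W)).inv ≫ (α_ (X ⊗ X) X W).inv) ≫ atR s X ▷ W ≫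
    ((α_ (X ⊗ X) X W).hom ≫ (α_ X X (X ⊗ W)).hom) := by
    simp only [atL, atR]; monoidal
  have h2 : atL s (X ⊗ W) = ((α_ X X (X ⊗ W)).inv ≫ (α_ (X ⊗ X) X W).inv) ≫ (s ▷ X) ▷ W ≫
    ((α_ (X ⊗ X) X W).hom ≫ (α_ X X (X ⊗ W)).hom) := by
    simp only [atL]; monoidal
  have h3 := congrArg (· ▷ W) hb
  simp only [comp_whiskerRight] at h3
  rw [h1, h2]
  simp only [Category.assoc, Iso.hom_inv_id_assoc]
  rw [reassoc_of% h3]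

theorem crossR_last (n : ℕ) : crossR s (n + 1) n = atR s (powR X n) := if_pos rfl

theorem crossR_of_ne {n i : ℕ} (h : i ≠ n) : crossR s (n + 1) i = crossR s n i ▷ X := if_neg h

theorem crossL_last (n : ℕ) : crossL s (n + 1) n = atL s (powL X n) := if_pos rfl

theorem crossL_of_ne {n i : ℕ} (h : i ≠ n) : crossL s (n + 1) i = X ◁ crossL s n i := if_neg h

theorem isCoxeter_crossR (hs : s ≫ s = 𝟙 _)
    (hb : s ▷ X ≫ atR s X ≫ s ▷ X = atR s X ≫ s ▷ X ≫ atR s X) :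
    ∀ n, IsCoxeter (M := End (powR X (n + 1))) n (crossR s n)
  | 0 => ⟨by simp, by simp, by simp⟩
  | n + 1 => by
    have ih := isCoxeter_crossR hs hb n
    have map_mul (f g : End (powR X (n + 1))) :
        (show End (powR X (n + 2)) from (f * g) ▷ X) = (show End (powR X (n + 2)) from f ▷ X) *
          (show End (powR X (n + 2)) from g ▷ X) := comp_whiskerRight _ _ _
    refine ⟨fun i hi => ?_, fun i hi => ?_, fun i j hij hj => ?_⟩
    · obtain rfl | h := eq_or_ne i n
      · rw [crossR_last]; exact atR_sq _ hs
      · rw [crossR_of_ne h, ← map_mul, ih.sq i (by omega)]; exact id_whiskerRight _ _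
    · obtain rfl | h := eq_or_ne (i + 1) n
      · rw [crossR_last, crossR_of_ne (by omega), crossR_last]; exact atR_braid _ hb
      · rw [crossR_of_ne h, crossR_of_ne (by omega), ← map_mul, ← map_mul, ih.braid i (by omega),
          map_mul, map_mul]
    · rw [crossR_of_ne (by omega : i ≠ n)]
      obtain rfl | h := eq_or_ne j n
      · obtain ⟨n, rfl⟩ : ∃ m, j = m + 1 := ⟨j - 1, by omega⟩
        rw [crossR_last, crossR_of_ne (by omega)]; exact (atR_comm s (crossR s n i)).symm
      · rw [crossR_of_ne h, ← map_mul, ← map_mul, ih.comm i j hij (by omega)]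

theorem isCoxeter_crossL (hs : s ≫ s = 𝟙 _)
    (hb : s ▷ X ≫ atR s X ≫ s ▷ X = atR s X ≫ s ▷ X ≫ atR s X) :
    ∀ n, IsCoxeter (M := End (powL X (n + 1))) n (crossL s n)
  | 0 => ⟨by simp, by simp, by simp⟩
  | n + 1 => by
    have ih := isCoxeter_crossL hs hb n
    have map_mul (f g : End (powL X (n + 1))) :
        (show End (powL X (n + 2)) from X ◁ (f * g)) = (show End (powL X (n + 2)) from X ◁ f) *
          (show End (powL X (n + 2)) from X ◁ g) := MonoidalCategory.whiskerLeft_comp _ _ _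
    refine ⟨fun i hi => ?_, fun i hi => ?_, fun i j hij hj => ?_⟩
    · obtain rfl | h := eq_or_ne i n
      · rw [crossL_last]; exact atL_sq _ hs
      · rw [crossL_of_ne h, ← map_mul, ih.sq i (by omega)]; exact MonoidalCategory.whiskerLeft_id _ _
    · obtain rfl | h := eq_or_ne (i + 1) n
      · rw [crossL_last, crossL_of_ne (by omega), crossL_last]; exact atL_braid _ hb
      · rw [crossL_of_ne h, crossL_of_ne (by omega), ← map_mul, ← map_mul, ih.braid i (by omega),
          map_mul, map_mul]
    · rw [crossL_of_ne (by omega : i ≠ n)]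
      obtain rfl | h := eq_or_ne j n
      · obtain ⟨n, rfl⟩ : ∃ m, j = m + 1 := ⟨j - 1, by omega⟩
        rw [crossL_last, crossL_of_ne (by omega)]; exact (atL_comm s (crossL s n i)).symm
      · rw [crossL_of_ne h, ← map_mul, ← map_mul, ih.comm i j hij (by omega)]

end Powers

variable {k : Type u} [Field k]

namespace HeisPre

/-- An upward strand. -/
def P : HeisPre k := ⟨.P⟩
/-- A downward strand. -/
def Q : HeisPre k := ⟨.Q⟩
/-- The crossing of two upward strands. -/
def sPP : (P ⊗ P : HeisPre k) ⟶ P ⊗ P := diag .s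
/-- The crossing of two downward strands. -/
def tQQ : (Q ⊗ Q : HeisPre k) ⟶ Q ⊗ Q := diag .t
/-- The cup `1 → PQ`. -/
def cup : 𝟙_ (HeisPre k) ⟶ P ⊗ Q := diag .cupPQ
/-- The cap `PQ → 1`. -/
def cap : (P ⊗ Q : HeisPre k) ⟶ 𝟙_ (HeisPre k) := diag .capPQ

/-- The action of `S_n` on `n` upward strands, numbered from the left: the homomorphism that sends the
adjacent transposition `adj i` to the crossing of the strands `i` and `i + 1`. It is unique. -/
def permP : ∀ n : ℕ, Perm (Fin n) →* End (powR (P (k := k)) n)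
  | 0 => 1
  | n + 1 => (IsCoxeter.exists_hom (M := End (powR (P (k := k)) (n + 1))) n (crossR sPP n)
      (isCoxeter_crossR (diag_eq .s_s) (diag_eq .braid_s) n)).choose

/-- The action of `S_n` on `n` downward strands, numbered from the right: the homomorphism that sends the
adjacent transposition `adj i` to the crossing of the strands `i` and `i + 1`. It is unique. -/
def permQ : ∀ n : ℕ, Perm (Fin n) →* End (powL (Q (k := k)) n)
  | 0 => 1
  | n + 1 => (IsCoxeter.exists_hom (M := End (powL (Q (k := k)) (n + 1))) n (crossL tQQ n)
      (isCoxeter_crossL (diag_eq .t_t) (diag_eq .braid_t) n)).choose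

/-- The linear extension of `permP` to the group algebra. -/
def algP (n : ℕ) : MonoidAlgebra k (Perm (Fin n)) →ₐ[k] End (powR (P (k := k)) n) :=
  MonoidAlgebra.lift k _ _ (permP n)

/-- The linear extension of `permQ` to the group algebra. -/
def algQ (n : ℕ) : MonoidAlgebra k (Perm (Fin n)) →ₐ[k] End (powL (Q (k := k)) n) :=
  MonoidAlgebra.lift k _ _ (permQ n)

end HeisPre

end

noncomputable section

variable (k : Type u) [Field k] (K : Type) [Group K]

/-- `S_m × K`. For `K = S_n^op` its representations are the `(k[S_m], k[S_n])`-bimodules. -/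
abbrev Sym (m : ℕ) : Type := Perm (Fin m) × K

/-- The inclusion `S_m × K → S_{m+1} × K`. -/
def up (m : ℕ) : Sym K m →* Sym K (m + 1) := (incl m).prodMap (MonoidHom.id K)

/-- The transposition of the last two points of `m + 2` points. -/
def sw (m : ℕ) : Sym K (m + 2) := (adj (m + 1) m, 1)

/-- The category of families of representations of `S_m × K`, `m ∈ ℕ`. -/
abbrev Tower := ∀ m : ℕ, Rep.{u} k (Sym K m)

instance (M N : Tower k K) : AddCommGroup (M ⟶ N) := Pi.addCommGroup (f := fun m => M m ⟶ N m)

instance : Preadditive (Tower k K) where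
  add_comp _ _ _ f f' g := funext fun m => Preadditive.add_comp _ _ _ (f m) (f' m) (g m)
  comp_add _ _ _ f g g' := funext fun m => Preadditive.comp_add _ _ _ (f m) (g m) (g' m)

instance : Linear k (Tower k K) where
  homModule M N := Pi.module _ (fun m => M m ⟶ N m) k
  smul_comp _ _ _ c f g := funext fun m => Linear.smul_comp _ _ _ c (f m) (g m)
  comp_smul _ _ _ f c g := funext fun m => Linear.comp_smul _ _ _ (f m) c (g m)

/-- Restriction, the action of `Q`: `(Q M)_m` is the restriction of `M_{m+1}`. -/
def resF : Tower k K ⥤ Tower k K where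
  obj M m := Rep.res (up K m) (M (m + 1))
  map f m := Rep.resMap (up K m) (f (m + 1))

/-- Induction, the action of `P`: `(P M)_0 = 0`, and `(P M)_{m+1}` is induced from `M_m`, in the model of
equivariant functions on `S_{m+1} × K` (induction and coinduction agree for finite index). -/
def indObj (M : Tower k K) : Tower k K
  | 0 => Rep.trivial k _ PUnit
  | m + 1 => Rep.coind (up K m) (M m)

/-- Induction on morphisms. -/
def indMap {M N : Tower k K} (f : M ⟶ N) : ∀ m, indObj k K M m ⟶ indObj k K N m
  | 0 => 𝟙 _
  | m + 1 => Rep.coindMap (up K m) (f m)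

instance (M : Tower k K) : Subsingleton (indObj k K M 0) := inferInstanceAs (Subsingleton PUnit)

/-- Induction as a functor. -/
def indF : Tower k K ⥤ Tower k K where
  obj M := indObj k K M
  map f := indMap k K f
  map_id M := by
    funext m
    cases m
    · rfl
    · rfl
  map_comp f g := by
    funext m
    cases m
    · rfl
    · rfl

instance : (resF k K).Additive where
instance : (indF k K).Additive where
  map_add {M N f g} := by
    funext m
    cases m
    · apply Rep.hom_ext; ext x; exact Subsingleton.elim (α := PUnit) _ _
    · rfl
instance : (resF k K).Linear k where
instance : (indF k K).Linear k where
  map_smul f c := by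
    funext m
    cases m
    · apply Rep.hom_ext; ext x; exact Subsingleton.elim (α := PUnit) _ _
    · rfl

variable {k K}

theorem up_injective (m : ℕ) : Function.Injective (up K m) :=
  (incl_injective m).prodMap Function.injective_id

theorem exists_up_iff {m : ℕ} {g : Sym K (m + 1)} :
    (∃ g', up K m g' = g) ↔ g.1 (Fin.last m) = Fin.last m := by
  refine ⟨?_, fun h => ?_⟩
  · rintro ⟨g', rfl⟩; exact incl_last _
  · obtain ⟨τ, hτ⟩ := exists_incl h
    exact ⟨(τ, g.2), Prod.ext hτ rfl⟩

theorem sw_sw (m : ℕ) : sw K m * sw K m = 1 :=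
  Prod.ext ((IsCoxeter.adj (m + 1)).sq m (by omega)) (one_mul 1)

theorem sw_comm {m : ℕ} (g : Sym K m) :
    sw K m * up K (m + 1) (up K m g) = up K (m + 1) (up K m g) * sw K m := by
  refine Prod.ext ?_ (by simp [sw])
  change adj (m + 1) m * incl (m + 1) (incl m g.1) = incl (m + 1) (incl m g.1) * adj (m + 1) m
  have h1 : (⟨m, by omega⟩ : Fin (m + 2)) = (Fin.last m).castSucc := rfl
  have h2 : (⟨m + 1, by omega⟩ : Fin (m + 2)) = Fin.last (m + 1) := rfl
  rw [adj_of_lt (by omega), mul_swap_eq_swap_mul, h1, h2, incl_castSucc, incl_last, incl_last]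

theorem sw_comm' {m : ℕ} (g : Sym K m) (h : Sym K (m + 2)) :
    sw K m * (up K (m + 1) (up K m g) * h) = up K (m + 1) (up K m g) * (sw K m * h) := by
  rw [← mul_assoc, sw_comm, mul_assoc]

theorem sw_braid (m : ℕ) :
    up K (m + 2) (sw K m) * sw K (m + 1) * up K (m + 2) (sw K m) =
      sw K (m + 1) * up K (m + 2) (sw K m) * sw K (m + 1) := by
  refine Prod.ext ?_ (by simp [sw, up])
  have := (IsCoxeter.adj (m + 2)).braid m (by omega)
  rwa [← incl_adj (show m < m + 1 by omega)] at this

/-- An equivariant linear map as a morphism of representations. -/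
def mkHom {G : Type} [Group G] {A B : Rep.{u} k G} (f : A →ₗ[k] B)
    (h : ∀ g x, f (A.ρ g x) = B.ρ g (f x)) : A ⟶ B :=
  Rep.ofHom (X := A) (Y := B) (ρ := A.ρ) (σ := B.ρ) ⟨f, fun g => LinearMap.ext (h g)⟩

@[simp] theorem mkHom_apply {G : Type} [Group G] {A B : Rep.{u} k G} (f : A →ₗ[k] B)
    (h : ∀ g x, f (A.ρ g x) = B.ρ g (f x)) (x : A) : (mkHom f h).hom x = f x := rfl

theorem coind_apply {m : ℕ} (A : Rep.{u} k (Sym K m)) (f : Rep.coind (up K m) A)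
    (g y : Sym K (m + 1)) : ((Rep.coind (up K m) A).ρ g f).1 y = f.1 (y * g) := rfl

theorem coind_up {m : ℕ} (A : Rep.{u} k (Sym K m)) (f : Rep.coind (up K m) A)
    (g : Sym K m) : f.1 (up K m g) = A.ρ g (f.1 1) := by simpa using f.2 g 1

theorem coind_ext {m : ℕ} {A : Rep.{u} k (Sym K m)} {f g : Rep.coind (up K m) A}
    (h : ∀ y, f.1 y = g.1 y) : f = g := Subtype.ext (funext h)

theorem tower_ext {M N : Tower k K} {f g : M ⟶ N} (h : ∀ m x, (f m).hom x = (g m).hom x) :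
    f = g := by
  funext m
  apply Rep.hom_ext
  ext x
  exact h m x

/-- The action of the cup `1 → PQ`: the unit `x ↦ (g ↦ g x)`. -/
def unitIR : 𝟭 (Tower k K) ⟶ resF k K ⋙ indF k K where
  app M
    | 0 => 0
    | m + 1 => mkHom (A := M (m + 1)) (B := Rep.coind (up K m) (Rep.res (up K m) (M (m + 1))))
        { toFun x := ⟨fun g => (M (m + 1)).ρ g x, fun g h => by simp⟩
          map_add' x y := coind_ext fun _ => map_add _ _ _
          map_smul' c x := coind_ext fun _ => map_smul _ _ _ }
        (fun g x => coind_ext fun y => by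
          rw [coind_apply]; simp)
  naturality M N f := by
    refine tower_ext fun m x => ?_
    cases m
    · exact Subsingleton.elim (α := PUnit) _ _
    · exact coind_ext fun g => (Rep.hom_comm_apply (f _) g x).symm

/-- The action of the cap `QP → 1`: evaluation at `1`. -/
def counitRI : indF k K ⋙ resF k K ⟶ 𝟭 (Tower k K) where
  app M m := mkHom (A := Rep.res (up K m) (Rep.coind (up K m) (M m)))
    { toFun f := f.1 1
      map_add' x y := rfl
      map_smul' c x := rfl }
    (fun g f => (congrArg f.1 (one_mul _)).trans (coind_up _ f g))
  naturality M N f := tower_ext fun m x => rfl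

/-- The equivariant function supported on the subgroup with value `x` at `1`. -/
def ext0 {m : ℕ} (A : Rep.{u} k (Sym K m)) (x : A) : Sym K (m + 1) → A :=
  Function.extend (up K m) (fun h => A.ρ h x) 0

theorem ext0_up {m : ℕ} (A : Rep.{u} k (Sym K m)) (x : A) (h : Sym K m) :
    ext0 A x (up K m h) = A.ρ h x := (up_injective m).extend_apply ..

theorem ext0_of_ne {m : ℕ} (A : Rep.{u} k (Sym K m)) (x : A) {h : Sym K (m + 1)}
    (hh : h.1 (Fin.last m) ≠ Fin.last m) : ext0 A x h = 0 :=
  Function.extend_apply' _ _ _ (mt exists_up_iff.1 hh)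

theorem ext0_map {m : ℕ} {A B : Rep.{u} k (Sym K m)} (f : A →ₗ[k] B) (x : A) (y : B) (g : Sym K m)
    (hf : ∀ h, f (A.ρ h x) = B.ρ (h * g) y) (h : Sym K (m + 1)) :
    f (ext0 A x h) = ext0 B y (h * up K m g) := by
  by_cases hh : h.1 (Fin.last m) = Fin.last m
  · obtain ⟨h, rfl⟩ := exists_up_iff.2 hh
    rw [← map_mul, ext0_up, ext0_up, hf]
  · rw [ext0_of_ne _ _ hh, ext0_of_ne, map_zero]
    have : (up K m g).1 (Fin.last m) = Fin.last m := incl_last _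
    rwa [Prod.fst_mul, Perm.mul_apply, this]

/-- The action of the cup `1 → QP`: the inclusion of `M` in the restriction of its induction. -/
def unitRI : 𝟭 (Tower k K) ⟶ indF k K ⋙ resF k K where
  app M m := mkHom (B := Rep.res (up K m) (Rep.coind (up K m) (M m)))
    { toFun x := ⟨ext0 (M m) x, fun g h => by
        by_cases hh : h.1 (Fin.last m) = Fin.last m
        · obtain ⟨h, rfl⟩ := exists_up_iff.2 hh
          rw [← map_mul, ext0_up, ext0_up, map_mul]; rfl
        · rw [ext0_of_ne _ _ hh, ext0_of_ne, map_zero]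
          rw [Prod.fst_mul, Perm.mul_apply]
          have : (up K m g).1 (Fin.last m) = Fin.last m := incl_last _
          exact fun e => hh ((up K m g).1.injective (e.trans this.symm))⟩
      map_add' x y := coind_ext fun h => by
        change ext0 (M m) (x + y) h = ext0 (M m) x h + ext0 (M m) y h
        by_cases hh : h.1 (Fin.last m) = Fin.last m
        · obtain ⟨h, rfl⟩ := exists_up_iff.2 hh
          simp only [ext0_up, map_add]
        · simp only [ext0_of_ne _ _ hh, add_zero]
      map_smul' c x := coind_ext fun h => by
        refine ((ext0_map (A := M m) (B := M m) (c • LinearMap.id) x (c • x) 1 (by simp) h).trans ?_).symm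
        simp }
    (fun g x => coind_ext (A := M m) fun h => by
      exact ext0_map (A := M m) (B := M m) LinearMap.id _ x g (by simp) h)
  naturality M N f := by
    refine tower_ext fun m x => coind_ext fun h => ?_
    refine ((ext0_map (f m).hom.toLinearMap x ((f m).hom x) 1 ?_ h).trans ?_).symm
    · intro h
      rw [mul_one]
      exact Rep.hom_comm_apply (f m) h x
    · rw [map_one, mul_one]; rfl

/-- The action of the cap `PQ → 1`: the multiplication `g ⊗ x ↦ g x` from the induction of the restriction,
in terms of functions `f` the sum of `y⁻¹ f(y)` over cosets. -/
def counitIR [Fintype K] : resF k K ⋙ indF k K ⟶ 𝟭 (Tower k K) where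
  app M
    | 0 => 0
    | m + 1 => mkHom (A := Rep.coind (up K m) (Rep.res (up K m) (M (m + 1))))
        { toFun f := (Fintype.card (Sym K m) : k)⁻¹ • ∑ y, (M (m + 1)).ρ y⁻¹ (f.1 y)
          map_add' x y := by simp [Finset.sum_add_distrib]
          map_smul' c x := by simp [← Finset.smul_sum, smul_comm c] }
        (fun g f => by
          change (Fintype.card (Sym K m) : k)⁻¹ • ∑ y : Sym K (m + 1), _ =
            (M (m + 1)).ρ g ((Fintype.card (Sym K m) : k)⁻¹ • ∑ y : Sym K (m + 1), _)
          rw [map_smul, map_sum]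
          congr 1
          refine Fintype.sum_equiv (Equiv.mulRight g) _ _ fun y => ?_
          rw [coind_apply, Equiv.coe_mulRight, ← Module.End.mul_apply, ← map_mul]
          simp)
  naturality M N f := by
    refine tower_ext fun m x => ?_
    obtain _ | m := m
    · exact (map_zero (f 0).hom).symm
    · change (Fintype.card (Sym K m) : k)⁻¹ • ∑ y : Sym K (m + 1), _ =
        (f _).hom ((Fintype.card (Sym K m) : k)⁻¹ • ∑ y : Sym K (m + 1), _)
      rw [map_smul, map_sum]
      congr 1
      exact Finset.sum_congr rfl fun y _ => (Rep.hom_comm_apply (f _) y⁻¹ _).symm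

/-- The action of the upward crossing on the double induction. -/
def braidI : indF k K ⋙ indF k K ⟶ indF k K ⋙ indF k K where
  app M
    | 0 => 0
    | 1 => 0
    | m + 2 => mkHom (A := Rep.coind (up K (m + 1)) (Rep.coind (up K m) (M m)))
        (B := Rep.coind (up K (m + 1)) (Rep.coind (up K m) (M m)))
        { toFun F := ⟨fun y => ⟨fun y' => (F.1 (sw K m * up K (m + 1) y' * y)).1 1, fun g h => by
              change (F.1 _).1 1 = (M m).ρ g ((F.1 _).1 1)
              rw [map_mul, mul_assoc, mul_assoc, sw_comm', F.2, coind_apply, one_mul, coind_up,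
                mul_assoc]⟩, fun g h => by
              refine coind_ext fun y' => ?_
              change (F.1 _).1 1 = (F.1 _).1 1
              rw [map_mul, mul_assoc, mul_assoc, mul_assoc]⟩
          map_add' x y := rfl
          map_smul' c x := rfl }
        (fun g F => coind_ext fun y => coind_ext fun y' => by
          change ((F.1 _).1 1) = ((F.1 _).1 1)
          simp only [mul_assoc])
  naturality M N f := by
    refine tower_ext fun m x => ?_
    match m with
    | 0 => exact Subsingleton.elim (α := PUnit) _ _
    | 1 => exact coind_ext fun _ => Subsingleton.elim (α := PUnit) _ _
    | m + 2 => rfl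

/-- The action of the downward crossing on the double restriction. -/
def braidR : resF k K ⋙ resF k K ⟶ resF k K ⋙ resF k K where
  app M m := mkHom (A := Rep.res (up K m) (Rep.res (up K (m + 1)) (M (m + 2))))
    (B := Rep.res (up K m) (Rep.res (up K (m + 1)) (M (m + 2))))
    ((M (m + 2)).ρ (sw K m)) (fun g x => by
      simp [← Module.End.mul_apply, ← map_mul, sw_comm])
  naturality M N f := tower_ext fun m x => (Rep.hom_comm_apply (f (m + 2)) (sw K m) x).symm

end

noncomputable section

variable {k : Type u} [Field k] {K : Type} [Group K]

theorem fst_sw (m : ℕ) : (sw K m).1 = swap (Fin.last m).castSucc (Fin.last (m + 1)) :=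
  adj_of_lt (show m < m + 1 by omega)

theorem up_castSucc {m : ℕ} (g : Sym K m) (i : Fin m) :
    (up K m g).1 i.castSucc = (g.1 i).castSucc := incl_castSucc _ _

theorem sw_of_ne {m : ℕ} {i : Fin (m + 1)} (hi : i ≠ Fin.last m) :
    (sw K m).1 i.castSucc = i.castSucc := by
  rw [fst_sw, swap_apply_of_ne_of_ne (by simpa using hi) (Fin.castSucc_ne_last _)]

theorem sw_up_ne {m : ℕ} (y : Sym K (m + 1)) (h : Sym K (m + 2))
    (hh : h.1 (Fin.last _) = Fin.last _) :
    (sw K m * up K (m + 1) y * h).1 (Fin.last _) ≠ Fin.last _ := by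
  have : (up K (m + 1) y).1 (Fin.last _) = Fin.last _ := incl_last _
  rw [Prod.fst_mul, Prod.fst_mul, Perm.mul_apply, Perm.mul_apply, hh, this, fst_sw,
    swap_apply_right]
  exact Fin.castSucc_ne_last _

theorem ρ_inv_self {G : Type} [Group G] (A : Rep.{u} k G) (g : G) (x : A) :
    A.ρ g⁻¹ (A.ρ g x) = x := by
  rw [← Module.End.mul_apply, ← map_mul, inv_mul_cancel, map_one]; rfl

theorem coind_res_apply {m : ℕ} (A : Rep.{u} k (Sym K (m + 1))) (f : Rep.coind (up K m) (Rep.res (up K m) A))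
    (h : Sym K m) (g : Sym K (m + 1)) : f.1 (up K m h * g) = A.ρ (up K m h) (f.1 g) := f.2 h g

theorem el_s_s {m : ℕ} (A : Rep.{u} k (Sym K m))
    (x : Rep.coind (up K (m + 1)) (Rep.coind (up K m) A)) (y y') :
    (x.1 (sw K m * up K (m + 1) 1 * (sw K m * up K (m + 1) y' * y))).1 1 = (x.1 y).1 y' := by
  rw [map_one, mul_one, mul_assoc, ← mul_assoc, sw_sw, one_mul, x.2, coind_apply, one_mul]

theorem el_t_t {m : ℕ} (A : Rep.{u} k (Sym K (m + 2))) (x : A) :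
    A.ρ (sw K m) (A.ρ (sw K m) x) = x := by
  rw [← Module.End.mul_apply, ← map_mul, sw_sw, map_one]; rfl

theorem el_braid_t {m : ℕ} (A : Rep.{u} k (Sym K (m + 3))) (x : A) :
    A.ρ (up K _ (sw K m)) (A.ρ (sw K (m + 1)) (A.ρ (up K _ (sw K m)) x)) =
      A.ρ (sw K (m + 1)) (A.ρ (up K _ (sw K m)) (A.ρ (sw K (m + 1)) x)) := by
  simp only [← Module.End.mul_apply, ← map_mul, ← mul_assoc, sw_braid]

theorem el_braid_s {m : ℕ} (A : Rep.{u} k (Sym K m))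
    (x : Rep.coind (up K (m + 2)) (Rep.coind (up K (m + 1)) (Rep.coind (up K m) A))) (y y' y'') :
    ((x.1 (sw K (m + 1) * up K _ (sw K m * up K _ y'' * 1) *
      (sw K (m + 1) * up K _ y' * y))).1 1).1 1 =
    ((x.1 (sw K (m + 1) * up K _ (sw K m * up K _ y'' * y') * y)).1 (sw K m * up K _ 1 * 1)).1 1 := by
  have key (g z) : (x.1 z).1 g = (x.1 (up K _ g * z)).1 1 := by
    rw [x.2, coind_apply, one_mul]
  rw [key (sw K m * up K _ 1 * 1)]
  simp only [map_mul, map_one, mul_one, mul_assoc]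
  rw [← sw_comm', ← mul_assoc, ← mul_assoc, ← mul_assoc, ← mul_assoc, ← mul_assoc, ← sw_braid]
  simp only [mul_assoc]

theorem el_rot_right {m : ℕ} (A : Rep.{u} k (Sym K (m + 2))) (x : A) :
    A.ρ (up K (m + 1) 1) (A.ρ (sw K m * up K (m + 1) 1 * 1) x) = A.ρ (sw K m) x := by
  simp

theorem el_curl {m : ℕ} (A : Rep.{u} k (Sym K m)) (x : Rep.coind (up K m) A) (g : Sym K (m + 1)) :
    (ext0 (Rep.coind (up K m) A) x (sw K m * up K (m + 1) g * 1)).1 1 = 0 := by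
  rw [ext0_of_ne _ _ (sw_up_ne g 1 rfl)]; rfl

theorem el_zero (A : Rep.{u} k (Sym K 0)) (x : Rep.coind (up K 0) A) (g : Sym K 1) :
    ext0 A (x.1 1) g = x.1 g := by
  obtain ⟨g, rfl⟩ := exists_up_iff.2 (Subsingleton.elim (g.1 (Fin.last 0)) (Fin.last 0))
  rw [ext0_up, coind_up]

theorem el_bubble {m : ℕ} (A : Rep.{u} k (Sym K m)) (x : A) : ext0 A x 1 = x := by
  rw [← map_one (up K m), ext0_up, map_one]; rfl

section

variable [Fintype K]

theorem sum_up {m : ℕ} {B : Type*} [AddCommGroup B] (T : Sym K (m + 1) → B)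
    (e : Sym K (m + 1) ≃ Sym K (m + 1))
    (h0 : ∀ y, (e y).1 (Fin.last m) ≠ Fin.last m → T y = 0) :
    ∑ y, T y = ∑ h, T (e.symm (up K m h)) := by
  refine (Fintype.sum_of_injective (fun h => e.symm (up K m h))
    (e.symm.injective.comp (up_injective m)) _ _ (fun y hy => ?_) (fun _ => rfl)).symm
  refine h0 y (mt exists_up_iff.2 ?_)
  rintro ⟨h, e'⟩
  exact hy ⟨h, by simp [e']⟩

theorem smul_sum_const [CharZero k] {m : ℕ} {B : Type*} [AddCommGroup B] [Module k B] (v : B) :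
    (Fintype.card (Sym K m) : k)⁻¹ • ∑ _y : Sym K m, v = v := by
  rw [Finset.sum_const, Finset.card_univ, ← Nat.cast_smul_eq_nsmul k, smul_smul, inv_mul_cancel₀,
    one_smul]
  exact Nat.cast_ne_zero.2 Fintype.card_ne_zero

theorem avg_eq [CharZero k] {m : ℕ} {B : Type*} [AddCommGroup B] [Module k B]
    (T : Sym K (m + 1) → B) (e : Sym K (m + 1) ≃ Sym K (m + 1)) (v : B)
    (h0 : ∀ y, (e y).1 (Fin.last m) ≠ Fin.last m → T y = 0)
    (h1 : ∀ y h, e y = up K m h → T y = v) :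
    (Fintype.card (Sym K m) : k)⁻¹ • ∑ y, T y = v := by
  rw [sum_up T e h0, Finset.sum_congr rfl fun h _ => h1 _ h (e.apply_symm_apply _), smul_sum_const]

variable [CharZero k]

theorem el_zigzag₁ {m : ℕ} (A : Rep.{u} k (Sym K m)) (x : Rep.coind (up K m) A) (g : Sym K (m + 1))
    (F : Sym K (m + 1) → Rep.coind (up K m) A) (hF : ∀ y, (F y).1 = ext0 A (x.1 y)) :
    ((Fintype.card (Sym K m) : k)⁻¹ • ∑ y, (Rep.coind (up K m) A).ρ y⁻¹ (F y)).1 g = x.1 g := by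
  have : ((Fintype.card (Sym K m) : k)⁻¹ • ∑ y, (Rep.coind (up K m) A).ρ y⁻¹ (F y)).1 g =
      (Fintype.card (Sym K m) : k)⁻¹ • ∑ y, ext0 A (x.1 y) (g * y⁻¹) := by
    rw [Submodule.coe_smul, Pi.smul_apply, Submodule.coe_sum, Finset.sum_apply]
    congr 1
    refine Finset.sum_congr rfl fun y _ => ?_
    rw [coind_apply, hF]
  rw [this]
  refine avg_eq _ ((Equiv.inv _).trans (Equiv.mulLeft g)) _ (fun y hy => ext0_of_ne _ _ hy) ?_
  intro y h e
  change g * y⁻¹ = up K m h at e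
  rw [e, ext0_up, ← x.2, ← e, inv_mul_cancel_right]

theorem el_zigzag₂ {m : ℕ} (A : Rep.{u} k (Sym K (m + 1))) (x : A) :
    (Fintype.card (Sym K m) : k)⁻¹ • ∑ y, A.ρ y⁻¹ (ext0 (Rep.res (up K m) A) x y) = x := by
  refine avg_eq _ (Equiv.refl _) _ (fun y hy => ?_) ?_
  · exact (congrArg _ (ext0_of_ne _ _ hy)).trans (map_zero _)
  · rintro y h rfl
    exact (congrArg _ (ext0_up _ _ h)).trans (ρ_inv_self A _ x)

theorem el_up_down {m : ℕ} (A : Rep.{u} k (Sym K (m + 1)))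
    (x : Rep.coind (up K m) (Rep.res (up K m) A)) (g : Sym K (m + 1)) :
    A.ρ 1 ((Fintype.card (Sym K m) : k)⁻¹ • ∑ y : Sym K (m + 1), A.ρ y⁻¹
      ((ext0 (Rep.coind (up K m) (Rep.res (up K m) A)) x
        (sw K m * up K _ y * (sw K m * up K _ g * 1))).1 1)) = x.1 g := by
  rw [map_one, Module.End.one_apply]
  refine avg_eq _ (Equiv.refl _) _ (fun y hy => ?_) ?_
  · rw [ext0_of_ne]
    · exact map_zero _
    · have h2 : (up K (m + 1) g).1 (Fin.last _) = Fin.last _ := incl_last _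
      simp only [Prod.fst_mul, Perm.mul_apply, Prod.fst_one, Perm.one_apply, h2]
      rw [fst_sw, swap_apply_right, ← fst_sw (K := K), up_castSucc, sw_of_ne (by exact hy)]
      exact Fin.castSucc_ne_last _
  · rintro y h rfl
    have : sw K m * up K _ (up K m h) * (sw K m * up K _ g * 1) = up K _ (up K m h * g) := by
      rw [sw_comm, mul_assoc, ← mul_assoc (sw K m), ← mul_assoc (sw K m), sw_sw, one_mul, mul_one,
        map_mul]
    change A.ρ (up K m h)⁻¹ _ = _
    rw [this, ext0_up, coind_apply, one_mul, coind_res_apply, ρ_inv_self]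

theorem el_down_up {m : ℕ} (A : Rep.{u} k (Sym K (m + 1))) (x : Rep.coind (up K (m + 1)) A)
    (x' : Rep.coind (up K m) (Rep.res (up K m) A)) (hx' : ∀ y, x'.1 y = A.ρ 1 (x.1 (sw K m * up K _ y * 1)))
    (g : Sym K (m + 2)) :
    (Fintype.card (Sym K m) : k)⁻¹ • ∑ y : Sym K (m + 1), A.ρ y⁻¹
      ((ext0 (Rep.coind (up K m) (Rep.res (up K m) A)) x' (sw K m * up K _ y * g)).1 1) +
      ext0 A (x.1 1) g = x.1 g := by
  by_cases hg : g.1 (Fin.last _) = Fin.last _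
  · rw [Finset.sum_eq_zero, smul_zero, zero_add]
    · obtain ⟨g, rfl⟩ := exists_up_iff.2 hg
      rw [ext0_up, coind_up]
    · intro y _
      rw [ext0_of_ne _ _ (sw_up_ne y g hg)]
      exact map_zero _
  · rw [ext0_of_ne _ _ hg, add_zero]
    obtain ⟨j, hj⟩ := Fin.exists_castSucc_eq.2 hg
    refine avg_eq _ (Equiv.mulRight (swap j (Fin.last _), 1)) _ (fun y hy => ?_) ?_
    · have hy : y.1 j ≠ Fin.last m := by
        simpa only [Equiv.coe_mulRight, Prod.fst_mul, Perm.mul_apply, swap_apply_right] using hy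
      rw [ext0_of_ne]
      · exact map_zero _
      · rw [Prod.fst_mul, Prod.fst_mul, Perm.mul_apply, Perm.mul_apply, ← hj, up_castSucc, sw_of_ne hy]
        exact Fin.castSucc_ne_last _
    · intro y h e
      have hy : y.1 j = Fin.last m := by
        have : (up K m h).1 (Fin.last m) = Fin.last m := incl_last _
        rwa [← e, Equiv.coe_mulRight, Prod.fst_mul, Perm.mul_apply, swap_apply_right] at this
      have : ∃ h', up K _ h' = sw K m * up K _ y * g := by
        rw [exists_up_iff, Prod.fst_mul, Prod.fst_mul, Perm.mul_apply, Perm.mul_apply, ← hj,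
          up_castSucc, hy, fst_sw, swap_apply_left]
      obtain ⟨h', e'⟩ := this
      rw [← e', ext0_up, coind_apply, one_mul, hx', e', map_one, Module.End.one_apply, mul_one, mul_assoc, ← mul_assoc, sw_sw,
        one_mul, x.2, ρ_inv_self]

theorem el_rot_left {m : ℕ} (A : Rep.{u} k (Sym K (m + 2))) (x : A)
    (f : Rep.coind (up K m) (Rep.res (up K m) (Rep.res (up K (m + 1)) A)))
    (hf : f.1 = ext0 (Rep.res (up K m) (Rep.res (up K (m + 1)) A)) x) :
    (Fintype.card (Sym K (m + 1)) : k)⁻¹ • ∑ y : Sym K (m + 2), A.ρ y⁻¹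
      ((Fintype.card (Sym K m) : k)⁻¹ • ∑ y' : Sym K (m + 1), A.ρ (up K (m + 1) y'⁻¹)
        ((ext0 (Rep.coind (up K m) (Rep.res (up K m) (Rep.res (up K (m + 1)) A))) f
          (sw K m * up K (m + 1) y' * y)).1 1)) = A.ρ (sw K m) x := by
  have key : ∀ (y : Sym K (m + 2)) (y' : Sym K (m + 1)) (h : Sym K (m + 1)),
      sw K m * up K (m + 1) y' * y = up K (m + 1) h →
      A.ρ y⁻¹ (A.ρ (up K (m + 1) y'⁻¹)
        ((ext0 (Rep.coind (up K m) (Rep.res (up K m) (Rep.res (up K (m + 1)) A))) f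
          (sw K m * up K (m + 1) y' * y)).1 1)) =
      A.ρ ((up K (m + 1) h)⁻¹ * sw K m) (ext0 (Rep.res (up K m) (Rep.res (up K (m + 1)) A)) x h) := by
    intro y y' h e
    rw [e, ext0_up, coind_apply, one_mul, hf, ← Module.End.mul_apply, ← map_mul, ← e]
    congr 2
    rw [map_inv, ← inv_eq_of_mul_eq_one_left (sw_sw (K := K) m)]
    group
  have h1 : ∀ y' : Sym K (m + 1), ∑ y : Sym K (m + 2), A.ρ y⁻¹ (A.ρ (up K (m + 1) y'⁻¹)
        ((ext0 (Rep.coind (up K m) (Rep.res (up K m) (Rep.res (up K (m + 1)) A))) f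
          (sw K m * up K (m + 1) y' * y)).1 1)) = ∑ h : Sym K (m + 1),
      A.ρ ((up K (m + 1) h)⁻¹ * sw K m) (ext0 (Rep.res (up K m) (Rep.res (up K (m + 1)) A)) x h) := by
    intro y'
    rw [sum_up _ (Equiv.mulLeft (sw K m * up K (m + 1) y'))]
    · refine Finset.sum_congr rfl fun h _ => key _ _ _ ?_
      exact Equiv.apply_symm_apply (Equiv.mulLeft (sw K m * up K (m + 1) y')) _
    · intro y hy
      rw [Equiv.coe_mulLeft] at hy
      rw [ext0_of_ne _ _ hy]
      exact (congrArg _ (map_zero _)).trans (map_zero _)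
  simp only [map_smul, map_sum]
  rw [← Finset.smul_sum, Finset.sum_comm, Finset.sum_congr rfl fun y' _ => h1 y', smul_comm,
    smul_sum_const]
  refine avg_eq _ (Equiv.refl _) _ (fun y hy => ?_) ?_
  · exact (congrArg _ (ext0_of_ne _ _ hy)).trans (map_zero _)
  · rintro y h rfl
    refine (congrArg _ (ext0_up _ _ h)).trans ?_
    change A.ρ ((up K _ (up K _ h))⁻¹ * sw K m) (A.ρ (up K _ (up K _ h)) x) = _
    rw [← Module.End.mul_apply, ← map_mul, mul_assoc, sw_comm, inv_mul_cancel_left]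

end

variable (k K) in
/-- Tensor words act as compositions of induction and restriction, the rightmost factor first. -/
def evO : Ob → Tower k K ⥤ Tower k K
  | .one => 𝟭 _
  | .P => indF k K
  | .Q => resF k K
  | .tensor X Y => evO Y ⋙ evO X

instance evO_additive : ∀ X, (evO k K X).Additive
  | .one => inferInstanceAs (𝟭 _ : Tower k K ⥤ Tower k K).Additive
  | .P => inferInstanceAs (indF k K).Additive
  | .Q => inferInstanceAs (resF k K).Additive
  | .tensor X Y =>
    have := evO_additive X
    have := evO_additive Y
    inferInstanceAs (evO k K Y ⋙ evO k K X).Additive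

instance evO_linear : ∀ X, (evO k K X).Linear k
  | .one => inferInstanceAs ((𝟭 _ : Tower k K ⥤ Tower k K).Linear k)
  | .P => inferInstanceAs ((indF k K).Linear k)
  | .Q => inferInstanceAs ((resF k K).Linear k)
  | .tensor X Y =>
    have := evO_linear X
    have := evO_linear Y
    inferInstanceAs ((evO k K Y ⋙ evO k K X).Linear k)

variable [Fintype K]

variable (K) in
/-- Diagrams act as natural transformations. -/
def evT : ∀ {X Y : Ob}, Term k X Y → (evO k K X ⟶ evO k K Y)
  | _, _, .id X => 𝟙 _
  | _, _, .comp f g => evT f ≫ evT g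
  | _, _, .wl X f => Functor.whiskerRight (evT f) (evO k K X)
  | _, _, .wr f Z => Functor.whiskerLeft (evO k K Z) (evT f)
  | _, _, .α X Y Z => (Functor.associator (evO k K Z) (evO k K Y) (evO k K X)).inv
  | _, _, .αi X Y Z => (Functor.associator (evO k K Z) (evO k K Y) (evO k K X)).hom
  | _, _, .l X => (Functor.rightUnitor (evO k K X)).hom
  | _, _, .li X => (Functor.rightUnitor (evO k K X)).inv
  | _, _, .r X => (Functor.leftUnitor (evO k K X)).hom
  | _, _, .ri X => (Functor.leftUnitor (evO k K X)).inv
  | _, _, .zero X Y => 0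
  | _, _, .add f g => evT f + evT g
  | _, _, .smul c f => c • evT f
  | _, _, .s => braidI
  | _, _, .t => braidR
  | _, _, .cupQP => unitRI
  | _, _, .capQP => counitRI
  | _, _, .cupPQ => unitIR
  | _, _, .capPQ => counitIR

open Term

local infixr:80 "≫ₜ" => Term.comp

theorem evT_ext {X Y : Ob} {f g : Term k X Y}
    (h : ∀ M m x, ((evT K f).app M m).hom x = ((evT K g).app M m).hom x) : evT K f = evT K g :=
  NatTrans.ext (funext fun M => tower_ext (h M))

/-- The action respects the relations of the Heisenberg category. -/
theorem evT_sound [CharZero k] {X Y : Ob} {f g : Term k X Y} (h : Term.Rel f g) : evT K f = evT K g := by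
  induction h with
  | refl f => rfl
  | symm _ h => exact h.symm
  | trans _ _ h h' => exact h.trans h'
  | comp _ _ h h' => simp only [evT, h, h']
  | wl X _ h => simp only [evT]; rw [h]
  | wr Z _ h => simp only [evT]; rw [h]
  | add _ _ h h' => simp only [evT, h, h']
  | smul c _ h => simp only [evT, h]
  | zigzag₁ =>
    refine evT_ext fun M m x => ?_
    obtain _ | m := m
    · exact Subsingleton.elim (α := PUnit) _ _
    · exact coind_ext fun g => el_zigzag₁ (M m) x g _ fun y => rfl
  | zigzag₂ => exact evT_ext fun M m x => el_zigzag₂ (M (m + 1)) x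
  | zigzag₃ =>
    refine evT_ext fun M m x => ?_
    exact congrArg (fun f => f x) (map_one (M (m + 1)).ρ)
  | zigzag₄ =>
    refine evT_ext fun M m x => ?_
    obtain _ | m := m
    · exact Subsingleton.elim (α := PUnit) _ _
    · refine coind_ext fun g => ?_
      exact congrArg x.1 (one_mul g)
  | rot_left => exact evT_ext fun M m x => el_rot_left (M (m + 2)) x _ rfl
  | rot_right =>
    refine evT_ext fun M m x => ?_
    exact el_rot_right (M (m + 2)) x
  | s_s =>
    refine evT_ext fun M m x => ?_
    match m with
    | 0 => exact Subsingleton.elim (α := PUnit) _ _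
    | 1 => exact coind_ext fun _ => Subsingleton.elim (α := PUnit) _ _
    | m + 2 =>
      exact coind_ext fun y => coind_ext fun y' => el_s_s (M m) x y y'
  | t_t =>
    refine evT_ext fun M m x => ?_
    exact el_t_t (M (m + 2)) x
  | braid_s =>
    refine evT_ext fun M m x => ?_
    match m with
    | 0 => exact Subsingleton.elim (α := PUnit) _ _
    | 1 => exact coind_ext fun _ => Subsingleton.elim (α := PUnit) _ _
    | 2 => exact coind_ext fun _ => coind_ext fun _ => Subsingleton.elim (α := PUnit) _ _
    | m + 3 =>
      exact coind_ext fun y => coind_ext fun y' => coind_ext fun y'' => el_braid_s (M m) x y y' y''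
  | braid_t =>
    refine evT_ext fun M m x => ?_
    exact el_braid_t (M (m + 3)) x
  | down_up =>
    refine evT_ext fun M m x => coind_ext fun g => ?_
    obtain _ | m := m
    · have h1 : ((evT K (crossQP (k := k))).app M 0).hom x = 0 := Subsingleton.elim (α := PUnit) _ _
      have h2 : ((evT K (crossQP (k := k) ≫ₜ crossPQ)).app M 0).hom x = 0 :=
        (congrArg _ h1).trans (map_zero ((evT K (crossPQ (k := k))).app M 0).hom)
      have h3 : (ext0 (M 0) (x.1 1)) g = x.1 g := el_zero (M 0) x g
      refine Eq.trans ?_ h3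
      refine (congrArg (fun f => f.1 g + (ext0 (M 0) (x.1 1)) g) h2).trans ?_
      exact zero_add _
    · exact el_down_up (M (m + 1)) x _ (fun y => rfl) g
  | up_down =>
    refine evT_ext fun M m x => ?_
    obtain _ | m := m
    · exact Subsingleton.elim (α := PUnit) _ _
    · exact coind_ext fun g => el_up_down (M (m + 1)) x g
  | bubble =>
    refine evT_ext fun M m x => ?_
    exact el_bubble (M m) x
  | curl =>
    refine evT_ext fun M m x => ?_
    obtain _ | m := m
    · exact Subsingleton.elim (α := PUnit) _ _
    · exact coind_ext fun g => el_curl (M m) x g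
  | l_nat f => ext M; simp [evT, evO]
  | add_comm f g => exact add_comm (evT K f) (evT K g)
  | add_assoc f g h => exact add_assoc (evT K f) (evT K g) (evT K h)
  | mul_smul c d f => exact mul_smul c d (evT K f)
  | exchange f g => exact NatTrans.ext (funext fun M => (evT K f).naturality ((evT K g).app M))
  | wl_add X f g => refine NatTrans.ext (funext fun M => ?_); simp [evT, evO]; rfl
  | wl_smul X c f => refine NatTrans.ext (funext fun M => ?_); simp [evT, evO]; rfl
  | add_wr f g Z => rfl
  | smul_wr c f Z => rfl
  | _ => ext M; simp [evT, add_smul, evO]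

end

noncomputable section

variable {k : Type u} [Field k] {K : Type} [Group K]

instance (G : Type) [Group G] : HasFiniteBiproducts (Rep.{u} k G) := Abelian.hasFiniteBiproducts

instance : HasFiniteBiproducts (Tower k K) := ⟨fun n => ⟨fun F => HasBiproduct.mk
  { bicone :=
    { pt := fun m => ⨁ fun j => F j m
      π := fun j m => biproduct.π (fun j => F j m) j
      ι := fun j m => biproduct.ι (fun j => F j m) j
      ι_π := fun j j' => by
        funext m
        refine (biproduct.ι_π (fun j => F j m) j j').trans ?_
        split_ifs with h
        · subst h; rfl
        · rfl }
    isBilimit := isBilimitOfTotal _ (by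
        funext m
        refine Eq.trans ?_ (biproduct.total (f := fun j => F j m))
        exact Finset.sum_apply m _ _) }⟩⟩

instance : IsIdempotentComplete (Tower k K) := ⟨fun X p hp => by
  choose Y i e h₁ h₂ using fun m =>
    IsIdempotentComplete.idempotents_split (X m) (p m) (congrFun hp m)
  exact ⟨Y, i, e, funext h₁, funext h₂⟩⟩

variable [Fintype K] [CharZero k]

/-- The functor `X ↦ X T` from the diagram category for a fixed family `T`. -/
def evAt (T : Tower k K) : HeisPre k ⥤ Tower k K where
  obj X := (evO k K X.ob).obj T
  map {X Y} f := Quotient.lift (s := homSetoid k X.ob Y.ob) (fun f => (evT K f).app T)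
    (fun _ _ h => by rw [evT_sound h]) f
  map_id _ := rfl
  map_comp := by rintro X Y Z ⟨f⟩ ⟨g⟩; rfl

instance (T : Tower k K) : (evAt T).Additive where
  map_add := by rintro X Y ⟨f⟩ ⟨g⟩; rfl

variable (k) in
/-- The Heisenberg category: the idempotent completion of the additive completion of the category of
diagrams. -/
abbrev Heisenberg : Type _ := Karoubi (Mat_ (HeisPre k))

instance : HasFiniteBiproducts (Heisenberg k) := Karoubi.karoubi_hasFiniteBiproducts

/-- The functor `X ↦ X T` on the Heisenberg category. -/
def act (T : Tower k K) : Heisenberg k ⥤ Tower k K :=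
  (functorExtension (Mat_ (HeisPre k)) (Tower k K)).obj (Mat_.lift (evAt T))

instance (T : Tower k K) : (act T).Additive :=
  have : ((functorExtension₂ (Mat_ (HeisPre k)) (Tower k K)).obj (Mat_.lift (evAt T))).Additive :=
    ⟨by intros; apply Karoubi.hom_ext; exact (Mat_.lift (evAt T)).map_add⟩
  inferInstanceAs ((functorExtension₂ (Mat_ (HeisPre k)) (Tower k K)).obj (Mat_.lift (evAt T)) ⋙
    (toKaroubiEquivalence (Tower k K)).inverse).Additive

/-- `S_m` and `S_n` act on bijections by composition on either side. -/
instance (m n : ℕ) : MulAction (Perm (Fin m) × (Perm (Fin n))ᵐᵒᵖ) (Fin n ≃ Fin m) where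
  smul g f := (g.2.unop.trans f).trans g.1
  one_smul f := rfl
  mul_smul g h f := rfl

instance (n : ℕ) : Fintype (Perm (Fin n))ᵐᵒᵖ := Fintype.ofEquiv _ MulOpposite.opEquiv

variable (k) in
/-- The category `H_n` of families, indexed by `m`, of `(k[S_m], k[S_n])`-bimodules. -/
abbrev HeisMod (n : ℕ) : Type _ := Tower k (Perm (Fin n))ᵐᵒᵖ

variable (k) in
/-- The regular bimodule `k[S_n]`, placed in degree `n` and zero in all other degrees: in degree `m` it is
spanned by the bijections between `n` and `m` points. -/
def regular (n : ℕ) : HeisMod k n := fun m => Rep.ofMulAction k _ (Fin n ≃ Fin m)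

variable (k) in
/-- The functor from the Heisenberg category to `H_n`, `X ↦ X k[S_n]`. -/
def toHn (n : ℕ) : Heisenberg k ⥤ HeisMod k n := act (regular k n)

instance (n : ℕ) : (toHn k n).Additive := inferInstanceAs (act (regular k n)).Additive

end

noncomputable section

namespace Part

variable (k : Type u) [Field k] {n : ℕ}

/-- The permutation that moves the point `p` to the last position and keeps the order of the others. -/
def toLast (p : Fin (n + 1)) : Perm (Fin (n + 1)) :=
  (finSuccEquiv' p).trans (finSuccEquiv' (Fin.last n)).symm

open Classical in
/-- If the diagram of `m` arises from that of `l` by removing the last box of a row, the permutation that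
moves the entry of this box to the last position, otherwise `0`. -/
def split (l : Part (n + 1)) (m : Part n) : MonoidAlgebra k (Perm (Fin (n + 1))) :=
  ∑ p with l.1.cells.erase (l.cell p) = m.1.cells, MonoidAlgebra.of k _ (toLast p)

open Classical in
/-- The inverse permutation of `split`, or `0`. -/
def merge (l : Part (n + 1)) (m : Part n) : MonoidAlgebra k (Perm (Fin (n + 1))) :=
  ∑ p with l.1.cells.erase (l.cell p) = m.1.cells, MonoidAlgebra.of k _ (toLast p)⁻¹

end Part

open HeisPre

variable {k : Type u} [Field k]

instance : HasZeroObject (Heisenberg k) := hasZeroObject_of_hasFiniteBiproducts _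

variable (k) in
/-- `P^{⊗ n} Q^{⊗ n}` -/
def strands (n : ℕ) : HeisPre k := powR P n ⊗ powL Q n

/-- The action of a pair of group algebra elements on `P^{⊗ n} Q^{⊗ n}`. -/
def onStrands {n : ℕ} (x y : MonoidAlgebra k (Perm (Fin n))) : strands k n ⟶ strands k n :=
  MonoidalCategory.tensorHom (algP n x) (algQ n y)

theorem onStrands_comp {n : ℕ} (x y x' y' : MonoidAlgebra k (Perm (Fin n))) :
    onStrands x y ≫ onStrands x' y' = onStrands (x' * x) (y' * y) := by
  rw [onStrands, onStrands, onStrands, map_mul, map_mul]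
  exact tensorHom_comp_tensorHom _ _ _ _

/-- The map `P^{⊗ n} P Q Q^{⊗ n} → P^{⊗ n} Q^{⊗ n}` given by the cap `PQ → 1` in the middle. -/
def capMid (n : ℕ) : strands k (n + 1) ⟶ strands k n :=
  (α_ (powR P n) P (Q ⊗ powL Q n)).hom ≫
    powR P n ◁ ((α_ P Q (powL Q n)).inv ≫ cap ▷ powL Q n ≫ (λ_ (powL Q n)).hom)

/-- The map `P^{⊗ n} Q^{⊗ n} → P^{⊗ n} P Q Q^{⊗ n}` given by the cup `1 → PQ` in the middle. -/
def cupMid (n : ℕ) : strands k n ⟶ strands k (n + 1) :=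
  powR P n ◁ ((λ_ (powL Q n)).inv ≫ cup ▷ powL Q n ≫ (α_ P Q (powL Q n)).hom) ≫
    (α_ (powR P n) P (Q ⊗ powL Q n)).inv

variable [CharZero k]

variable (k) in
/-- The object `P^l Q^{l^t}`, the image in `P^{⊗ n} Q^{⊗ n}` of the Young idempotents of `l` and of the
conjugate `l^t`. -/
def PQ {n : ℕ} (l : Part n) : Heisenberg k where
  X := (Mat_.embedding _).obj (strands k n)
  p := (Mat_.embedding _).map (onStrands (l.young k) (l.transpose.young k))
  idem := by rw [← Functor.map_comp, onStrands_comp, Part.young_mul_young, Part.young_mul_young]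

/-- The morphism `P^l Q^{l^t} → P^{l'} Q^{l'^t}` induced by `f`: include, apply `f`, project. -/
def between {n m : ℕ} (l : Part n) (l' : Part m) (f : strands k n ⟶ strands k m) :
    PQ k l ⟶ PQ k l' :=
  (PQ k l).decompId_i ≫ (toKaroubi _).map ((Mat_.embedding _).map f) ≫ (PQ k l').decompId_p

variable (k) in
/-- The sum of `P^l Q^{l^t}` over the partitions `l` of `n`. -/
def Sigma (n : ℕ) : Heisenberg k := ⨁ fun l : Part n => PQ k l

/-- The differential `d^-`. For `l = m + □` the component at `l`, `m` is the scalar `a l m` times the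
composite `P^l Q^{l^t} → P^m P Q Q^{m^t} → P^m Q^{m^t}` of the branching maps and the cap `PQ → 1`. All other
components are `0`. -/
def dMinus (a : YoungDiagram → YoungDiagram → k) (n : ℕ) : Sigma k (n + 1) ⟶ Sigma k n :=
  biproduct.matrix fun l m => between l m (a l.1 m.1 •
    (onStrands (l.split k m) (l.transpose.split k m.transpose) ≫ capMid n))

/-- The differential `d^+`. For `l = m + □` the component at `m`, `l` is the scalar `b l m` times the
composite `P^m Q^{m^t} → P^m P Q Q^{m^t} → P^l Q^{l^t}` of the cup `1 → PQ` and the branching maps. All other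
components are `0`. -/
def dPlus (b : YoungDiagram → YoungDiagram → k) (n : ℕ) : Sigma k n ⟶ Sigma k (n + 1) :=
  biproduct.matrix fun m l => between m l (b l.1 m.1 •
    (cupMid n ≫ onStrands (l.merge k m) (l.transpose.merge k m.transpose)))

/-- The complex `Σ^-`: the sum over the partitions of `n` is in homological degree `n`, that is in
cohomological degree `-n`. -/
def sigmaMinus (a : YoungDiagram → YoungDiagram → k)
    (ha : ∀ n, dMinus a (n + 1) ≫ dMinus a n = 0) : CochainComplex (Heisenberg k) ℤ :=
  (ChainComplex.of (Sigma k) (dMinus a) ha).extend ComplexShape.embeddingDownNat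

/-- The complex `Σ^+`: the sum over the partitions of `n` is in cohomological degree `n`. -/
def sigmaPlus (b : YoungDiagram → YoungDiagram → k)
    (hb : ∀ n, dPlus b n ≫ dPlus b (n + 1) = 0) : CochainComplex (Heisenberg k) ℤ :=
  (CochainComplex.of (Sigma k) (dPlus b) hb).extend ComplexShape.embeddingUpNat

end

end Heis

set_option linter.unusedSimpArgs false

namespace Heis

noncomputable section

/-- The group algebra of the symmetric group. -/
abbrev GA (k : Type u) [Field k] (n : ℕ) : Type u := MonoidAlgebra k (Perm (Fin n))

variable {k : Type u} [Field k] {n : ℕ}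

/-- A permutation as an element of the group algebra. -/
def ofP (g : Perm (Fin n)) : GA k n := MonoidAlgebra.of k _ g

@[simp] theorem ofP_one : ofP (k := k) (1 : Perm (Fin n)) = 1 := map_one _

theorem ofP_mul (g h : Perm (Fin n)) : ofP (k := k) (g * h) = ofP g * ofP h := map_mul _ _ _

theorem ofP_mul_inv (g : Perm (Fin n)) : ofP (k := k) g * ofP g⁻¹ = 1 := by
  rw [← ofP_mul, mul_inv_cancel, ofP_one]

theorem ofP_inv_mul (g : Perm (Fin n)) : ofP (k := k) g⁻¹ * ofP g = 1 := by
  rw [← ofP_mul, inv_mul_cancel, ofP_one]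

theorem coeff_ofP (g h : Perm (Fin n)) : (ofP (k := k) g).coeff h = if g = h then 1 else 0 := by
  simp [ofP, Finsupp.single_apply]

theorem ga_induction {p : GA k n → Prop} (x : GA k n) (of : ∀ g, p (ofP g))
    (add : ∀ x y, p x → p y → p (x + y)) (smul : ∀ (c : k) x, p x → p (c • x)) : p x :=
  MonoidAlgebra.induction_on x of add smul

variable (k n) in
/-- The inclusion of group algebras. -/
def inclA : GA k n →ₐ[k] GA k (n + 1) := MonoidAlgebra.mapDomainAlgHom k k (incl n)

theorem inclA_ofP (g : Perm (Fin n)) : inclA k n (ofP g) = ofP (incl n g) := by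
  simp [inclA, ofP]

/-- The coefficient at the identity. -/
def tr : GA k n →ₗ[k] k := Finsupp.lapply 1 ∘ₗ (MonoidAlgebra.coeffLinearEquiv k).toLinearMap

theorem tr_apply (x : GA k n) : tr x = x.coeff 1 := rfl

theorem tr_ofP (g : Perm (Fin n)) : tr (ofP (k := k) g) = if g = 1 then 1 else 0 := coeff_ofP _ _

theorem tr_one : tr (1 : GA k n) = 1 := by rw [← ofP_one, tr_ofP, if_pos rfl]

theorem tr_mul_comm (x y : GA k n) : tr (x * y) = tr (y * x) := by
  induction x using ga_induction with
  | of g =>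
    induction y using ga_induction with
    | of h =>
      rw [← ofP_mul, ← ofP_mul, tr_ofP, tr_ofP]
      exact if_congr mul_eq_one_comm rfl rfl
    | add x y hx hy => simp only [mul_add, add_mul, map_add, hx, hy]
    | smul c x hx => simp only [mul_smul_comm, smul_mul_assoc, map_smul, hx]
  | add x y hx hy => simp only [mul_add, add_mul, map_add, hx, hy]
  | smul c x hx => simp only [mul_smul_comm, smul_mul_assoc, map_smul, hx]

/-- The projection of the group algebra of `S_{n+1}` to that of `S_n` that forgets all other
permutations. -/
def condE : GA k (n + 1) →ₗ[k] GA k n :=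
  (MonoidAlgebra.coeffLinearEquiv k).symm.toLinearMap ∘ₗ
    Finsupp.lcomapDomain _ (incl_injective n) ∘ₗ (MonoidAlgebra.coeffLinearEquiv k).toLinearMap

theorem coeff_condE (x : GA k (n + 1)) (g : Perm (Fin n)) :
    (condE x).coeff g = x.coeff (incl n g) := rfl

theorem ga_ext {x y : GA k n} (h : ∀ g, x.coeff g = y.coeff g) : x = y :=
  MonoidAlgebra.ext (Finsupp.ext h)

theorem condE_ofP_incl (g : Perm (Fin n)) : condE (ofP (k := k) (incl n g)) = ofP g :=
  ga_ext fun h => by simp only [coeff_condE, coeff_ofP, (incl_injective n).eq_iff]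

theorem condE_ofP_of_ne {g : Perm (Fin (n + 1))} (hg : g (Fin.last n) ≠ Fin.last n) :
    condE (ofP (k := k) g) = 0 :=
  ga_ext fun h => by
    rw [coeff_condE, coeff_ofP, if_neg]
    · rfl
    · rintro rfl; exact hg (incl_last h)

theorem condE_inclA (x : GA k n) : condE (inclA k n x) = x := by
  induction x using ga_induction with
  | of g => rw [inclA_ofP, condE_ofP_incl]
  | add x y hx hy => rw [map_add, map_add, hx, hy]
  | smul c x hx => rw [map_smul, map_smul, hx]

theorem condE_incl_mul (a : GA k n) (x : GA k (n + 1)) :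
    condE (inclA k n a * x) = a * condE x := by
  induction a using ga_induction with
  | of g =>
    induction x using ga_induction with
    | of h =>
      rw [inclA_ofP, ← ofP_mul]
      by_cases hh : h (Fin.last n) = Fin.last n
      · obtain ⟨h, rfl⟩ := exists_incl hh
        rw [← map_mul, condE_ofP_incl, condE_ofP_incl, ofP_mul]
      · rw [condE_ofP_of_ne hh, condE_ofP_of_ne, mul_zero]
        rw [Perm.mul_apply]
        exact fun e => hh ((incl n g).injective (e.trans (incl_last g).symm))
    | add x y hx hy => simp only [mul_add, add_mul, map_add, hx, hy]
    | smul c x hx => simp only [mul_smul_comm, smul_mul_assoc, map_smul, hx]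
  | add x y hx hy => simp only [mul_add, add_mul, map_add, hx, hy]
  | smul c x hx => simp only [mul_smul_comm, smul_mul_assoc, map_smul, hx]

theorem condE_mul_incl (a : GA k n) (x : GA k (n + 1)) :
    condE (x * inclA k n a) = condE x * a := by
  induction a using ga_induction with
  | of g =>
    induction x using ga_induction with
    | of h =>
      rw [inclA_ofP, ← ofP_mul]
      by_cases hh : h (Fin.last n) = Fin.last n
      · obtain ⟨h, rfl⟩ := exists_incl hh
        rw [← map_mul, condE_ofP_incl, condE_ofP_incl, ofP_mul]
      · rw [condE_ofP_of_ne hh, condE_ofP_of_ne, zero_mul]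
        rwa [Perm.mul_apply, incl_last]
    | add x y hx hy => simp only [mul_add, add_mul, map_add, hx, hy]
    | smul c x hx => simp only [mul_smul_comm, smul_mul_assoc, map_smul, hx]
  | add x y hx hy => simp only [mul_add, add_mul, map_add, hx, hy]
  | smul c x hx => simp only [mul_smul_comm, smul_mul_assoc, map_smul, hx]

theorem tr_condE (x : GA k (n + 1)) : tr (condE x) = tr x := by
  rw [tr_apply, coeff_condE, map_one]; rfl

theorem tr_inclA (x : GA k n) : tr (inclA k n x) = tr x := by rw [← tr_condE, condE_inclA]

variable (k n) in
/-- The transposition of the last two of `n + 2` points. -/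
def swA : GA k (n + 2) := ofP (adj (n + 1) n)

theorem swA_mul_swA : swA k n * swA k n = 1 := by
  rw [swA, ← ofP_mul, (IsCoxeter.adj (n + 1)).sq n (by omega), ofP_one]

theorem adj_last (n : ℕ) : adj (n + 1) n = swap (Fin.last n).castSucc (Fin.last (n + 1)) :=
  adj_of_lt (show n < n + 1 by omega)

theorem adj_comm_incl (g : Perm (Fin n)) :
    adj (n + 1) n * incl (n + 1) (incl n g) = incl (n + 1) (incl n g) * adj (n + 1) n := by
  rw [adj_last, mul_swap_eq_swap_mul, incl_castSucc, incl_last, incl_last]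

theorem swA_comm (x : GA k n) : swA k n * inclA k (n + 1) (inclA k n x) =
    inclA k (n + 1) (inclA k n x) * swA k n := by
  induction x using ga_induction with
  | of g => rw [inclA_ofP, inclA_ofP, swA, ← ofP_mul, ← ofP_mul, adj_comm_incl]
  | add x y hx hy => simp only [mul_add, add_mul, map_add, hx, hy]
  | smul c x hx => simp only [mul_smul_comm, smul_mul_assoc, map_smul, hx]

theorem tr_swap (y z : GA k (n + 1)) : tr (swA k n * inclA k _ y * swA k n * inclA k _ z) =
    tr (condE y * condE z) := by
  rw [← condE_mul_incl]
  induction y using ga_induction with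
  | of g =>
    by_cases hg : g (Fin.last n) = Fin.last n
    · obtain ⟨g, rfl⟩ := exists_incl hg
      rw [condE_mul_incl, condE_ofP_incl, ← inclA_ofP, swA_comm, mul_assoc (inclA _ _ _), swA_mul_swA,
        mul_one, ← map_mul, tr_inclA, ← condE_incl_mul, tr_condE]
    · rw [condE_mul_incl, condE_ofP_of_ne hg, zero_mul, map_zero]
      induction z using ga_induction with
      | of h =>
        rw [inclA_ofP, inclA_ofP, swA, ← ofP_mul, ← ofP_mul, ← ofP_mul, tr_ofP, if_neg]
        intro e
        have h1 := congrArg (fun f => f (Fin.last (n + 1))) e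
        obtain ⟨j, hj⟩ := Fin.exists_castSucc_eq.2 hg
        simp only [Perm.mul_apply, incl_last, adj_last, swap_apply_right, incl_castSucc,
          Perm.one_apply, ← hj] at h1
        rw [swap_apply_of_ne_of_ne] at h1
        · exact Fin.castSucc_ne_last _ h1
        · rw [hj]; exact fun e => hg (Fin.castSucc_injective _ e)
        · exact Fin.castSucc_ne_last _
      | add x y hx hy => simp only [mul_add, add_mul, map_add, hx, hy, add_zero]
      | smul c x hx => simp only [mul_smul_comm, smul_mul_assoc, map_smul, hx, smul_zero]
  | add x y hx hy => simp only [mul_add, add_mul, map_add, hx, hy]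
  | smul c x hx => simp only [mul_smul_comm, smul_mul_assoc, map_smul, hx]

theorem double_coset (g : Perm (Fin (n + 2))) : (∃ h, g = incl (n + 1) h) ∨
    ∃ a b, g = incl (n + 1) a * adj (n + 1) n * incl (n + 1) b := by
  by_cases hg : g (Fin.last _) = Fin.last _
  · obtain ⟨h, rfl⟩ := exists_incl hg; exact .inl ⟨h, rfl⟩
  · obtain ⟨j, hj⟩ := Fin.exists_castSucc_eq.2 hg
    refine .inr ⟨swap j (Fin.last n), ?_⟩
    obtain ⟨b, hb⟩ := exists_incl (σ := (incl (n + 1) (swap j (Fin.last n)) * adj (n + 1) n)⁻¹ * g) (by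
      rw [Perm.mul_apply, Perm.inv_eq_iff_eq, Perm.mul_apply, adj_last, swap_apply_right,
        incl_castSucc, swap_apply_right, hj])
    exact ⟨b, by rw [hb, mul_inv_cancel_left]⟩

end

end Heis

namespace Heis

noncomputable section

variable {k : Type u} [Field k] {n : ℕ}

namespace Part

theorem cell_mem (l : Part n) (i : Fin n) : l.cell i ∈ l.1.cells := l.mem_cells.2 ⟨i, rfl⟩

theorem cell_unique (l : Part n) (f : Fin n → ℕ × ℕ) (hf : ∀ i, f i ∈ l.1.cells)
    (hm : StrictMono fun i => toLex (f i)) (i : Fin n) : l.cell i = f i := by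
  have h := Finset.orderEmbOfFin_unique (s := l.1.cells.map toLex.toEmbedding)
    ((Finset.card_map _).trans l.2) (f := fun i => toLex (f i))
    (fun i => Finset.mem_map_of_mem _ (hf i)) hm
  exact (congrArg ofLex (congrFun h i)).symm

theorem cell_strictMono (l : Part n) : StrictMono fun i => toLex (l.cell i) :=
  ((l.1.cells.map toLex.toEmbedding).orderEmbOfFin ((Finset.card_map _).trans l.2)).strictMono

/-- The diagram of `m` arises from that of `l` by removing the box with entry `p`. -/
def IsBox (l : Part (n + 1)) (m : Part n) (p : Fin (n + 1)) : Prop :=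
  l.1.cells.erase (l.cell p) = m.1.cells

variable {l : Part (n + 1)} {m : Part n} {p : Fin (n + 1)}

theorem IsBox.unique (h : IsBox l m p) {q : Fin (n + 1)} (h' : IsBox l m q) : q = p := by
  by_contra hne
  have h1 : l.cell q ∈ l.1.cells.erase (l.cell p) :=
    Finset.mem_erase.2 ⟨fun e => hne (l.cell.injective e), l.cell_mem q⟩
  rw [show l.1.cells.erase (l.cell p) = l.1.cells.erase (l.cell q) from Eq.trans h (Eq.symm h')] at h1
  exact Finset.notMem_erase _ _ h1

theorem IsBox.split (h : IsBox l m p) : l.split k m = ofP (toLast p) := by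
  classical
  rw [Part.split]
  refine Finset.sum_eq_single_of_mem p (Finset.mem_filter.2 ⟨Finset.mem_univ _, h⟩) fun q hq hne => ?_
  exact absurd (h.unique (Finset.mem_filter.1 hq).2) hne

theorem IsBox.merge (h : IsBox l m p) : l.merge k m = ofP (toLast p)⁻¹ := by
  classical
  rw [Part.merge]
  refine Finset.sum_eq_single_of_mem p (Finset.mem_filter.2 ⟨Finset.mem_univ _, h⟩) fun q hq hne => ?_
  exact absurd (h.unique (Finset.mem_filter.1 hq).2) hne

theorem split_eq_zero (h : ∀ p, ¬ IsBox l m p) : l.split k m = 0 := by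
  rw [Part.split]
  refine Finset.sum_eq_zero fun q hq => absurd (Finset.mem_filter.1 hq).2 (h q)

theorem merge_eq_zero (h : ∀ p, ¬ IsBox l m p) : l.merge k m = 0 := by
  rw [Part.merge]
  refine Finset.sum_eq_zero fun q hq => absurd (Finset.mem_filter.1 hq).2 (h q)

theorem toLast_self (p : Fin (n + 1)) : toLast p p = Fin.last n := by
  simp [toLast]

theorem toLast_succAbove (p : Fin (n + 1)) (i : Fin n) : toLast p (p.succAbove i) = i.castSucc := by
  simp [toLast]

theorem IsBox.cell_succAbove (h : IsBox l m p) (i : Fin n) : l.cell (p.succAbove i) = m.cell i := by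
  refine (m.cell_unique (fun i => l.cell (p.succAbove i)) (fun i => ?_) ?_ i).symm
  · rw [← show l.1.cells.erase (l.cell p) = m.1.cells from h]
    exact Finset.mem_erase.2 ⟨fun e => p.succAbove_ne i (l.cell.injective e), l.cell_mem _⟩
  · exact l.cell_strictMono.comp p.strictMono_succAbove

theorem toLast_inv_last (p : Fin (n + 1)) : (toLast p)⁻¹ (Fin.last n) = p := by
  rw [Perm.inv_eq_iff_eq, toLast_self]

theorem toLast_inv_castSucc (p : Fin (n + 1)) (i : Fin n) :
    (toLast p)⁻¹ i.castSucc = p.succAbove i := by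
  rw [Perm.inv_eq_iff_eq, toLast_succAbove]

theorem IsBox.cell_inv (h : IsBox l m p) (i : Fin n) :
    l.cell ((toLast p)⁻¹ i.castSucc) = m.cell i := by
  rw [toLast_inv_castSucc, h.cell_succAbove]

/-- The permutation of the entries of `l` that corresponds to a permutation of those of `m`. -/
def liftBox (p : Fin (n + 1)) (g : Perm (Fin n)) : Perm (Fin (n + 1)) :=
  (toLast p)⁻¹ * incl n g * toLast p

theorem liftBox_self (p : Fin (n + 1)) (g : Perm (Fin n)) : liftBox p g p = p := by
  simp only [liftBox, Perm.mul_apply, toLast_self, incl_last, toLast_inv_last]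

theorem liftBox_succAbove (p : Fin (n + 1)) (g : Perm (Fin n)) (i : Fin n) :
    liftBox p g (p.succAbove i) = p.succAbove (g i) := by
  simp only [liftBox, Perm.mul_apply, toLast_succAbove, incl_castSucc, toLast_inv_castSucc]

theorem liftBox_injective (p : Fin (n + 1)) : Function.Injective (liftBox p) := fun g h e =>
  incl_injective n (mul_left_cancel (mul_right_cancel e))

theorem exists_liftBox {g : Perm (Fin (n + 1))} (hg : g p = p) : ∃ g', liftBox p g' = g := by
  obtain ⟨g', h⟩ := exists_incl (σ := toLast p * g * (toLast p)⁻¹) (by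
    rw [Perm.mul_apply, Perm.mul_apply, toLast_inv_last, hg, toLast_self])
  exact ⟨g', by rw [liftBox, h]; group⟩

theorem sign_incl (g : Perm (Fin n)) : Perm.sign (incl n g) = Perm.sign g := by
  simp [incl, Perm.sign_trans, Equiv.optionCongr_sign, Perm.sign_symm_trans_trans, Perm.sign_trans_trans_symm]

theorem sign_liftBox (p : Fin (n + 1)) (g : Perm (Fin n)) :
    Perm.sign (liftBox p g) = Perm.sign g := by
  rw [liftBox, Perm.sign_mul, Perm.sign_mul, Perm.sign_inv, sign_incl]
  rw [mul_comm, ← mul_assoc, Int.units_mul_self, one_mul]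

theorem IsBox.liftBox_mem_row (h : IsBox l m p) (g : Perm (Fin n)) :
    liftBox p g ∈ l.rowPerms ↔ g ∈ m.rowPerms := by
  refine ⟨fun H i => ?_, fun H i => ?_⟩
  · have := H (p.succAbove i)
    rwa [liftBox_succAbove, h.cell_succAbove, h.cell_succAbove] at this
  · obtain rfl | ⟨i, rfl⟩ := p.eq_self_or_eq_succAbove i
    · rw [liftBox_self]
    · rw [liftBox_succAbove, h.cell_succAbove, h.cell_succAbove]; exact H i

theorem IsBox.liftBox_mem_col (h : IsBox l m p) (g : Perm (Fin n)) :
    liftBox p g ∈ l.colPerms ↔ g ∈ m.colPerms := by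
  refine ⟨fun H i => ?_, fun H i => ?_⟩
  · have := H (p.succAbove i)
    rwa [liftBox_succAbove, h.cell_succAbove, h.cell_succAbove] at this
  · obtain rfl | ⟨i, rfl⟩ := p.eq_self_or_eq_succAbove i
    · rw [liftBox_self]
    · rw [liftBox_succAbove, h.cell_succAbove, h.cell_succAbove]; exact H i

theorem liftBox_mul (p : Fin (n + 1)) (g g' : Perm (Fin n)) :
    liftBox p (g * g') = liftBox p g * liftBox p g' := by
  rw [liftBox, map_mul, liftBox, liftBox]; group

theorem youngSym_eq_sum (l : Part n) : l.youngSym k =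
    open Classical in ∑ x : Perm (Fin n) × Perm (Fin n) with x.1 ∈ l.rowPerms ∧ x.2 ∈ l.colPerms,
      ((Perm.sign x.2 : ℤ) : k) • ofP (x.1 * x.2) := by
  classical
  rw [youngSym, rowSum, colSum, Finset.sum_mul_sum, ← Finset.sum_product']
  refine Finset.sum_congr ?_ fun x _ => ?_
  · ext x; simp
  · rw [mul_smul_comm, ofP_mul]; rfl

theorem IsBox.condE_youngSym (h : IsBox l m p) :
    condE (ofP (toLast p) * l.youngSym k * ofP (toLast p)⁻¹) = m.youngSym k := by
  classical
  rw [youngSym_eq_sum, youngSym_eq_sum, Finset.mul_sum, Finset.sum_mul, map_sum]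
  symm
  refine Finset.sum_of_injOn (fun x => (liftBox p x.1, liftBox p x.2)) ?_ ?_ ?_ ?_
  · intro x _ y _ e
    exact Prod.ext (liftBox_injective p (Prod.ext_iff.1 e).1) (liftBox_injective p (Prod.ext_iff.1 e).2)
  · intro x hx
    simp only [Finset.coe_filter, Finset.mem_univ, true_and, Set.mem_ofPred_eq] at hx ⊢
    exact ⟨(h.liftBox_mem_row _).2 hx.1, (h.liftBox_mem_col _).2 hx.2⟩
  · rintro ⟨r, c⟩ hx hx'
    simp only [Finset.mem_filter, Finset.mem_univ, true_and] at hx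
    rw [mul_smul_comm, smul_mul_assoc, ← ofP_mul, ← ofP_mul, map_smul, condE_ofP_of_ne, smul_zero]
    intro e
    rw [Perm.mul_apply, Perm.mul_apply, toLast_inv_last, ← Perm.eq_inv_iff_eq, toLast_inv_last,
      Perm.mul_apply] at e
    have hc : c p = p := l.cell.injective (Prod.ext (by rw [← hx.1 (c p), e]) (hx.2 p))
    have hr : r p = p := by rwa [hc] at e
    obtain ⟨r', rfl⟩ := exists_liftBox hr
    obtain ⟨c', rfl⟩ := exists_liftBox hc
    refine hx' ⟨(r', c'), ?_, rfl⟩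
    simp only [Finset.coe_filter, Finset.mem_univ, true_and, Set.mem_ofPred_eq]
    exact ⟨(h.liftBox_mem_row _).1 hx.1, (h.liftBox_mem_col _).1 hx.2⟩
  · rintro ⟨r, c⟩ hx
    rw [mul_smul_comm, smul_mul_assoc, ← ofP_mul, ← ofP_mul, map_smul, sign_liftBox, ← liftBox_mul,
      liftBox, ← condE_ofP_incl]
    congr 3
    group

variable (k) in
/-- The factor in `youngSym * youngSym = hook • youngSym`. -/
def hook (l : Part n) : k := tr (l.youngSym k * l.youngSym k)

variable [CharZero k]

theorem youngSym_mul_youngSym (l : Part n) : l.youngSym k * l.youngSym k = l.hook k • l.youngSym k := by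
  obtain ⟨r, hr⟩ := l.exists_sq k
  have hr' : l.hook k = r := by
    rw [hook, tr_apply, hr]; simp [coeff_youngSym]
  rw [hr', hr]

theorem hook_ne_zero (l : Part n) : l.hook k ≠ 0 := by
  intro h
  exact l.sq_ne_zero k (by rw [youngSym_mul_youngSym, h, zero_smul])

omit [CharZero k] in
theorem young_eq (l : Part n) : l.young k = (l.hook k)⁻¹ • l.youngSym k := rfl

theorem youngSym_eq (l : Part n) : l.youngSym k = l.hook k • l.young k := by
  rw [young_eq, smul_smul, mul_inv_cancel₀ l.hook_ne_zero, one_smul]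

omit [CharZero k] in
theorem tr_young (l : Part n) : tr (l.young k) = (l.hook k)⁻¹ := by
  rw [young_eq, map_smul, tr_apply, coeff_youngSym, smul_eq_mul, mul_one]

theorem young_ne_zero (l : Part n) : l.young k ≠ 0 := fun h => by
  have := l.tr_young (k := k)
  rw [h, map_zero] at this
  exact inv_ne_zero l.hook_ne_zero this.symm

theorem row_mul_col (l : Part n) (x : GA k n) : ∃ r : k,
    l.rowSum k * x * l.colSum k = r • l.young k := by
  induction x using ga_induction with
  | of σ =>
    obtain ⟨r, hr⟩ := l.sandwich k σ
    exact ⟨r * l.hook k, by rw [mul_smul, ← youngSym_eq]; exact hr⟩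
  | add x y hx hy =>
    obtain ⟨r, hr⟩ := hx
    obtain ⟨r', hr'⟩ := hy
    exact ⟨r + r', by rw [mul_add, add_mul, hr, hr', add_smul]⟩
  | smul c x hx =>
    obtain ⟨r, hr⟩ := hx
    exact ⟨c * r, by rw [mul_smul_comm, smul_mul_assoc, hr, smul_smul]⟩

theorem young_mul_mul_young (l : Part n) (x : GA k n) : ∃ c : k,
    l.young k * x * l.young k = c • l.young k := by
  obtain ⟨r, hr⟩ := l.row_mul_col (l.colSum k * x * l.rowSum k)
  refine ⟨(l.hook k)⁻¹ * (l.hook k)⁻¹ * r, ?_⟩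
  rw [mul_smul, ← hr, young_eq, youngSym]
  simp only [smul_mul_assoc, mul_smul_comm, smul_smul, mul_assoc]

end Part

end

end Heis

namespace Heis

noncomputable section

variable {k : Type u} [Field k] {n : ℕ}

namespace Part

theorem sum_col_le (l l' : Part n) (σ : Perm (Fin n)) (h : ∀ i j, (l.cell i).1 = (l.cell j).1 →
    (l'.cell (σ i)).2 = (l'.cell (σ j)).2 → i = j) :
    ∑ i, ((l.cell i).2 : ℤ) ≤ ∑ i, ((l'.cell i).2 : ℤ) ∧
      (∑ i, ((l.cell i).2 : ℤ) = ∑ i, ((l'.cell i).2 : ℤ) → l = l') := by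
  let f : Fin n → ℕ × ℕ := fun i => ((l.cell i).1, (l'.cell (σ i)).2)
  have hf : Function.Injective f := fun i j e => h i j (Prod.ext_iff.1 e).1 (Prod.ext_iff.1 e).2
  let A := Finset.univ.image f
  let w : ℕ × ℕ → ℤ := fun x => (x.2 : ℤ) - l.1.rowLen x.1
  have hcells (l : Part n) : l.1.cells = Finset.univ.image l.cell := by
    ext c; simp [l.mem_cells]
  have hsum : ∑ x ∈ A, w x - ∑ x ∈ l.1.cells, w x =
      ∑ i, ((l'.cell i).2 : ℤ) - ∑ i, ((l.cell i).2 : ℤ) := by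
    rw [hcells l, Finset.sum_image (fun _ _ _ _ e => hf e),
      Finset.sum_image (fun _ _ _ _ e => l.cell.injective e)]
    simp only [w, f, Finset.sum_sub_distrib]
    rw [Equiv.sum_comp σ (fun i => ((l'.cell i).2 : ℤ))]
    ring
  have h1 : (l.1.cells \ A).Nonempty → ∑ x ∈ l.1.cells \ A, w x < 0 := fun hne => by
    refine Finset.sum_neg (fun x hx => ?_) hne
    have := YoungDiagram.mem_iff_lt_rowLen.1 (Finset.mem_sdiff.1 hx).1
    simp only [w]; omega
  have h2 : 0 ≤ ∑ x ∈ A \ l.1.cells, w x := by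
    refine Finset.sum_nonneg (fun x hx => ?_)
    have := mt YoungDiagram.mem_iff_lt_rowLen.2 (Finset.mem_sdiff.1 hx).2
    simp only [w]; omega
  have h3 := Finset.sum_sdiff_sub_sum_sdiff (s₁ := A) (s₂ := l.1.cells) (f := w)
  have h4 : ∑ x ∈ l.1.cells \ A, w x ≤ 0 := by
    obtain h | h := (l.1.cells \ A).eq_empty_or_nonempty
    · rw [h, Finset.sum_empty]
    · exact (h1 h).le
  refine ⟨by omega, fun he => ?_⟩
  have hsub : l.1.cells ⊆ A := by
    rw [← Finset.sdiff_eq_empty_iff_subset]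
    by_contra hne
    have := h1 (Finset.nonempty_iff_ne_empty.2 hne)
    omega
  have hA : l.1.cells = A := by
    refine Finset.eq_of_subset_of_card_le hsub ?_
    rw [Finset.card_image_of_injective _ hf, Finset.card_univ, Fintype.card_fin]
    exact l.2.ge
  have hcol : ∀ c, l.1.colLen c = l'.1.colLen c := fun c => by
    rw [YoungDiagram.colLen_eq_card, YoungDiagram.colLen_eq_card]
    simp only [YoungDiagram.col]
    rw [hA, hcells l', Finset.filter_image, Finset.filter_image,
      Finset.card_image_of_injective _ hf, Finset.card_image_of_injective _ l'.cell.injective]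
    refine Finset.card_equiv σ fun i => ?_
    simp [f]
  refine Subtype.ext (YoungDiagram.ext (Finset.ext ?_))
  rintro ⟨i, j⟩
  exact (YoungDiagram.mem_iff_lt_colLen (μ := l.1)).trans
    (by rw [hcol]; exact YoungDiagram.mem_iff_lt_colLen.symm)

theorem swap_mem_row (l : Part n) {i j : Fin n} (h : (l.cell i).1 = (l.cell j).1) :
    swap i j ∈ l.rowPerms := fun x => by
  rw [swap_apply_def]; split_ifs with ha hb <;> simp_all

theorem swap_mem_col (l : Part n) {i j : Fin n} (h : (l.cell i).2 = (l.cell j).2) :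
    swap i j ∈ l.colPerms := fun x => by
  rw [swap_apply_def]; split_ifs with ha hb <;> simp_all

theorem mul_rowSum (l : Part n) {p : Perm (Fin n)} (hp : p ∈ l.rowPerms) :
    ofP p * l.rowSum k = l.rowSum k := by
  classical
  rw [rowSum, Finset.mul_sum]
  refine Finset.sum_equiv (Equiv.mulLeft p) (fun σ => ?_) (fun σ _ => ?_)
  · simp [Subgroup.mul_mem_cancel_left _ hp]
  · exact (ofP_mul _ _).symm

theorem colSum_mul (l : Part n) {q : Perm (Fin n)} (hq : q ∈ l.colPerms) :
    l.colSum k * ofP q = ((Perm.sign q : ℤ) : k) • l.colSum k := by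
  classical
  rw [colSum, Finset.sum_mul, Finset.smul_sum]
  refine Finset.sum_equiv (Equiv.mulRight q) (fun σ => ?_) (fun σ _ => ?_)
  · simp [Subgroup.mul_mem_cancel_right _ hq]
  · rw [smul_mul_assoc, ofP, ← map_mul, smul_smul, Equiv.coe_mulRight, Perm.sign_mul]
    congr 1
    obtain h | h := Int.units_eq_one_or (Perm.sign q) <;> simp [h]

theorem ofP_swap (σ : Perm (Fin n)) (i j : Fin n) :
    ofP (k := k) (swap (σ i) (σ j)) * ofP σ = ofP σ * ofP (swap i j) := by
  rw [← ofP_mul, ← ofP_mul, mul_swap_eq_swap_mul]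

variable [CharZero k]

theorem eq_zero_of_eq_neg {x : GA k n} (h : x = -x) : x = 0 := by
  have h2 : (2 : k) • x = 0 := by
    rw [two_smul]; nth_rewrite 1 [h]; exact neg_add_cancel _
  exact (smul_eq_zero.1 h2).resolve_left two_ne_zero

theorem rowSum_mul_mul_colSum (l l' : Part n) (hne : l ≠ l')
    (hs : ∑ i, ((l'.cell i).2 : ℤ) ≤ ∑ i, ((l.cell i).2 : ℤ)) (x : GA k n) :
    l.rowSum k * x * l'.colSum k = 0 := by
  induction x using ga_induction with
  | of σ =>
    have h : ¬ ∀ i j, (l.cell i).1 = (l.cell j).1 →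
        (l'.cell (σ⁻¹ i)).2 = (l'.cell (σ⁻¹ j)).2 → i = j := fun h => by
      obtain ⟨h1, h2⟩ := sum_col_le l l' σ⁻¹ h
      exact hne (h2 (le_antisymm h1 hs))
    push Not at h
    obtain ⟨i, j, h1, h2, h3⟩ := h
    have h4 := l.rowSum_mul k (l.swap_mem_row h1)
    have h5 := l'.mul_colSum k (l'.swap_mem_col h2)
    rw [Perm.sign_swap (by simpa using h3)] at h5
    have h6 := ofP_swap (k := k) σ (σ⁻¹ i) (σ⁻¹ j)
    rw [show σ (σ⁻¹ i) = i by simp, show σ (σ⁻¹ j) = j by simp] at h6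
    refine eq_zero_of_eq_neg ?_
    conv_lhs => rw [← h4]
    change l.rowSum k * ofP (swap i j) * ofP σ * l'.colSum k = _
    rw [mul_assoc (l.rowSum k), h6, ← mul_assoc, mul_assoc _ _ (l'.colSum k)]
    change _ * (MonoidAlgebra.of k _ _ * _) = _
    rw [h5]
    simp
  | add x y hx hy => rw [mul_add, add_mul, hx, hy, add_zero]
  | smul c x hx => rw [mul_smul_comm, smul_mul_assoc, hx, smul_zero]

theorem colSum_mul_mul_rowSum (l l' : Part n)
    (hs : ∑ i, ((l.cell i).2 : ℤ) < ∑ i, ((l'.cell i).2 : ℤ)) (x : GA k n) :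
    l.colSum k * x * l'.rowSum k = 0 := by
  induction x using ga_induction with
  | of σ =>
    have h : ¬ ∀ i j, (l'.cell i).1 = (l'.cell j).1 →
        (l.cell (σ i)).2 = (l.cell (σ j)).2 → i = j := fun h =>
      absurd (sum_col_le l' l σ h).1 (not_le.2 hs)
    push Not at h
    obtain ⟨i, j, h1, h2, h3⟩ := h
    have h4 := l'.mul_rowSum (k := k) (l'.swap_mem_row h1)
    have h5 := l.colSum_mul (k := k) (l.swap_mem_col h2)
    rw [Perm.sign_swap (by simpa using h3)] at h5
    refine eq_zero_of_eq_neg ?_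
    conv_lhs => rw [← h4]
    rw [← mul_assoc, mul_assoc _ (ofP σ), ← ofP_swap, ← mul_assoc, h5]
    simp
  | add x y hx hy => rw [mul_add, add_mul, hx, hy, add_zero]
  | smul c x hx => rw [mul_smul_comm, smul_mul_assoc, hx, smul_zero]

theorem young_mul_mul_young_of_ne {l l' : Part n} (hne : l ≠ l') (x : GA k n) :
    l.young k * x * l'.young k = 0 := by
  have h : l.youngSym k * x * l'.youngSym k = 0 := by
    rw [youngSym, youngSym]
    obtain hs | hs := le_or_gt (∑ i, ((l'.cell i).2 : ℤ)) (∑ i, ((l.cell i).2 : ℤ))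
    · have := rowSum_mul_mul_colSum l l' hne hs (l.colSum k * x * l'.rowSum k)
      simpa only [mul_assoc] using this
    · have := colSum_mul_mul_rowSum l l' hs x
      rw [← mul_assoc, mul_assoc (l.rowSum k), mul_assoc (l.rowSum k), this, mul_zero, zero_mul]
  rw [young_eq, young_eq, smul_mul_assoc, smul_mul_assoc, mul_smul_comm, h, smul_zero, smul_zero]

theorem young_mul_self_assoc (l : Part n) (x : GA k n) : l.young k * (l.young k * x) = l.young k * x := by
  rw [← mul_assoc, young_mul_young]

/-- The branching element in `e_m k[S_{n+1}] e_l`. -/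
def br (l : Part (n + 1)) (m : Part n) : GA k (n + 1) :=
  inclA k n (m.young k) * l.split k m * l.young k

/-- The branching element in `e_l k[S_{n+1}] e_m`. -/
def br' (l : Part (n + 1)) (m : Part n) : GA k (n + 1) :=
  l.young k * l.merge k m * inclA k n (m.young k)

variable {l l' : Part (n + 1)} {m m' : Part n} {p : Fin (n + 1)}

theorem young_mul_br' : l.young k * l.br' m = l.br' m := by
  simp only [br', ← mul_assoc, young_mul_young]

theorem br_mul_young : l.br m * l.young k = l.br m := by
  simp only [br, mul_assoc, young_mul_young]

theorem br'_mul_young : l.br' m * inclA k n (m.young k) = l.br' m := by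
  simp only [br', mul_assoc, ← map_mul, young_mul_young]

theorem young_mul_br : inclA k n (m.young k) * l.br m = l.br m := by
  simp only [br, ← mul_assoc, ← map_mul, young_mul_young]

omit [CharZero k] in
theorem br_eq_zero (h : ∀ p, ¬ IsBox l m p) : l.br (k := k) m = 0 := by
  rw [br, split_eq_zero h, mul_zero, zero_mul]

omit [CharZero k] in
theorem br'_eq_zero (h : ∀ p, ¬ IsBox l m p) : l.br' (k := k) m = 0 := by
  rw [br', merge_eq_zero h, mul_zero, zero_mul]

theorem br_mul_br'_of_ne (h : l ≠ l') : l.br (k := k) m * l'.br' m' = 0 := by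
  rw [← br_mul_young, ← young_mul_br', ← mul_assoc, mul_assoc (l.br m)]
  have := young_mul_mul_young_of_ne h (1 : GA k (n + 1))
  rw [mul_one] at this
  rw [this, mul_zero, zero_mul]

theorem br_mul_br' : l.br (k := k) m * l.br' m' =
    inclA k n (m.young k) * (l.split k m * l.young k * l.merge k m') * inclA k n (m'.young k) := by
  simp only [br, br', mul_assoc, young_mul_self_assoc]

theorem IsBox.condE_br_mul_br' (h : IsBox l m p) :
    condE (l.br (k := k) m * l.br' m) = (m.hook k / l.hook k) • m.young k := by
  rw [br_mul_br', condE_mul_incl, condE_incl_mul, h.split, h.merge, l.young_eq, mul_smul_comm,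
    smul_mul_assoc, map_smul, h.condE_youngSym, youngSym_eq, mul_smul_comm, mul_smul_comm,
    smul_mul_assoc, smul_mul_assoc, young_mul_young, young_mul_young, smul_smul, div_eq_inv_mul]

theorem condE_br_mul_br'_of_ne (h : m ≠ m') : condE (l.br (k := k) m * l.br' m') = 0 := by
  rw [br_mul_br', condE_mul_incl, condE_incl_mul, young_mul_mul_young_of_ne h]

theorem IsBox.tr_br_mul_br' (h : IsBox l m p) : tr (l.br (k := k) m * l.br' m) = (l.hook k)⁻¹ := by
  rw [← tr_condE, h.condE_br_mul_br', map_smul, tr_young, smul_eq_mul]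
  field_simp [m.hook_ne_zero (k := k)]

theorem IsBox.br'_mul_br (h : IsBox l m p) : l.br' (k := k) m * l.br m = l.young k := by
  obtain ⟨c, hc⟩ := l.young_mul_mul_young (l.merge k m * inclA k n (m.young k) * l.split k m)
  have h1 : l.br' (k := k) m * l.br m = c • l.young k := by
    rw [← hc]
    simp only [br', br, mul_assoc]
    rw [← mul_assoc (inclA k n (m.young k)) (inclA k n (m.young k)), ← map_mul, young_mul_young]
  have h2 := h.tr_br_mul_br' (k := k)
  rw [tr_mul_comm, h1, map_smul, tr_young, smul_eq_mul] at h2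
  rw [h1, mul_right_cancel₀ (inv_ne_zero l.hook_ne_zero) (h2.trans (one_mul _).symm), one_smul]

end Part

end

end Heis

namespace Heis

noncomputable section

variable {k : Type u} [Field k] {n : ℕ}

namespace Part

/-- `l` arises from `m` by adding a box. -/
def Adj (l : Part (n + 1)) (m : Part n) : Prop := ∃ p, IsBox l m p

theorem adj_iff {l : Part (n + 1)} {m : Part n} : Adj l m ↔ m.1.cells ⊆ l.1.cells := by
  refine ⟨?_, fun h => ?_⟩
  · rintro ⟨p, hp⟩
    rw [← show l.1.cells.erase (l.cell p) = m.1.cells from hp]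
    exact Finset.erase_subset _ _
  · have hc : (l.1.cells \ m.1.cells).card = 1 := by
      have h1 := l.2
      have h2 := m.2
      unfold YoungDiagram.card at h1 h2
      rw [Finset.card_sdiff_of_subset h, h1, h2]
      omega
    obtain ⟨c, hc⟩ := Finset.card_eq_one.1 hc
    have hcl : c ∈ l.1.cells \ m.1.cells := hc ▸ Finset.mem_singleton_self c
    obtain ⟨p, rfl⟩ := l.mem_cells.1 (Finset.mem_sdiff.1 hcl).1
    refine ⟨p, ?_⟩
    rw [IsBox, ← Finset.sdiff_singleton_eq_erase, ← hc, Finset.sdiff_sdiff_eq_self h]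

theorem exists_insert (m : Part n) (i : ℕ) (h : i = 0 ∨ m.1.rowLen i < m.1.rowLen (i - 1)) :
    ∃ l : Part (n + 1), l.1.cells = insert (i, m.1.rowLen i) m.1.cells := by
  have hni : (i, m.1.rowLen i) ∉ m.1.cells := fun h =>
    lt_irrefl _ (YoungDiagram.mem_iff_lt_rowLen.1 h)
  refine ⟨⟨⟨insert (i, m.1.rowLen i) m.1.cells, ?_⟩, ?_⟩, rfl⟩
  · rintro ⟨a, b⟩ ⟨c, d⟩ hcd hab
    rw [Finset.mem_coe, Finset.mem_insert] at hab ⊢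
    obtain ⟨h1, h2⟩ : c ≤ a ∧ d ≤ b := hcd
    obtain hab | hab := hab
    · obtain ⟨rfl, rfl⟩ := Prod.mk.inj hab
      rw [or_iff_not_imp_left]
      intro hne
      refine YoungDiagram.mem_iff_lt_rowLen.2 ?_
      obtain rfl | h1 := h1.eq_or_lt
      · exact lt_of_le_of_ne h2 fun e => hne (by rw [e])
      · obtain h | h := h
        · omega
        · exact (h2.trans_lt h).trans_le (m.1.rowLen_anti c (a - 1) (by omega))
    · exact .inr (m.1.isLowerSet (show (c, d) ≤ (a, b) from ⟨h1, h2⟩) hab)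
  · rw [YoungDiagram.card, Finset.card_insert_of_notMem hni]
    exact congrArg (· + 1) m.2

theorem exists_corner {l : Part (n + 1)} {m : Part n} (h : Adj l m) : ∃ i,
    l.1.rowLen (i + 1) < l.1.rowLen i ∧ m.1.cells = l.1.cells.erase (i, l.1.rowLen i - 1) := by
  obtain ⟨p, hp⟩ := h
  have hm : (l.cell p) ∉ m.1.cells := by
    rw [← show l.1.cells.erase (l.cell p) = m.1.cells from hp]; exact Finset.notMem_erase _ _
  have key : ∀ c ∈ l.1.cells, l.cell p ≤ c → c = l.cell p := fun c hc hle => by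
    by_contra hne
    have : c ∈ m.1.cells := by
      rw [← show l.1.cells.erase (l.cell p) = m.1.cells from hp]
      exact Finset.mem_erase.2 ⟨hne, hc⟩
    exact hm (m.1.isLowerSet hle this)
  have hmem := l.cell_mem p
  obtain ⟨⟨i, j⟩, hcell⟩ : ∃ c, l.cell p = c := ⟨_, rfl⟩
  rw [hcell] at key hmem
  have hj := YoungDiagram.mem_iff_lt_rowLen.1 hmem
  have hj' : j = l.1.rowLen i - 1 := by
    by_contra hne
    have := key (i, j + 1) (YoungDiagram.mem_iff_lt_rowLen.2 (by omega)) ⟨le_rfl, Nat.le_succ j⟩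
    simp at this
  refine ⟨i, ?_, ?_⟩
  · by_contra hlt
    have := key (i + 1, j) (YoungDiagram.mem_iff_lt_rowLen.2 (by omega)) ⟨Nat.le_succ i, le_rfl⟩
    simp at this
  · rw [← hj', ← hcell]; exact hp.symm

theorem exists_adj (m : Part n) : ∃ l : Part (n + 1), Adj l m := by
  obtain ⟨l, hl⟩ := m.exists_insert 0 (.inl rfl)
  exact ⟨l, adj_iff.2 (hl ▸ Finset.subset_insert _ _)⟩

/-- There are more boxes that can be added to a diagram than boxes that can be removed. -/
theorem card_adj (l : Part (n + 1)) :
    Nat.card (Option {m : Part n // Adj l m}) ≤ Nat.card {q : Part (n + 2) // Adj q l} := by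
  choose i hi hm using fun m : {m : Part n // Adj l m} => exists_corner m.2
  choose f hf using fun m => l.exists_insert (i m + 1) (.inr (hi m))
  obtain ⟨q, hq⟩ := l.exists_insert 0 (.inl rfl)
  have hni : ∀ j, (j, l.1.rowLen j) ∉ l.1.cells := fun j h =>
    lt_irrefl _ (YoungDiagram.mem_iff_lt_rowLen.1 h)
  have hins : ∀ {j j'}, insert (j, l.1.rowLen j) l.1.cells = insert (j', l.1.rowLen j') l.1.cells →
      j = j' := fun {j j'} e => by
    have h1 : (j, l.1.rowLen j) ∈ insert (j', l.1.rowLen j') l.1.cells :=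
      e ▸ Finset.mem_insert_self _ _
    exact (Prod.mk.inj ((Finset.mem_insert.1 h1).resolve_right (hni j))).1
  refine Nat.card_le_card_of_injective (fun o : Option {m : Part n // Adj l m} =>
    match o with
    | none => (⟨q, adj_iff.2 (hq ▸ Finset.subset_insert _ _)⟩ : {q : Part (n + 2) // Adj q l})
    | some m => ⟨f m, adj_iff.2 (hf m ▸ Finset.subset_insert _ _)⟩) ?_
  rintro (_ | m) (_ | m') e
  · rfl
  · have := congrArg (fun x => x.1.1.cells) e
    simp only [hq, hf] at this
    exact absurd (hins this) (by omega)
  · have := congrArg (fun x => x.1.1.cells) e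
    simp only [hq, hf] at this
    exact absurd (hins this) (by omega)
  · have := congrArg (fun x => x.1.1.cells) e
    simp only [hf] at this
    have h2 : i m = i m' := by have := hins this; omega
    congr 1
    refine Subtype.ext (Subtype.ext (YoungDiagram.ext ?_))
    rw [hm, hm, h2]

variable [CharZero k]

/-- A spanning family of `e_m k[S_{n+1}] e_m` with at most as many members as there are diagrams
`m + □` forces the branching idempotents to sum up to `e_m`. -/
theorem sum_br_mul_br'_of_span {m : Part n} (W : Submodule k (GA k (n + 1)))
    (hW : ∀ x, inclA k n (m.young k) * x * inclA k n (m.young k) ∈ W)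
    (hc : Module.finrank k W ≤ Nat.card {l : Part (n + 1) // Adj l m}) [FiniteDimensional k W] :
    ∑ l : Part (n + 1), l.br m * l.br' m = inclA k n (m.young k) := by
  classical
  let u : {l : Part (n + 1) // Adj l m} → GA k (n + 1) := fun l => l.1.br m * l.1.br' m
  have huW : ∀ l, u l ∈ W := fun l => by
    have := hW (u l)
    rwa [← mul_assoc, young_mul_br, mul_assoc, br'_mul_young] at this
  have hu1 : ∀ l, u l * u l = u l := fun l => by
    obtain ⟨p, hp⟩ := l.2
    simp only [u]
    rw [mul_assoc, ← mul_assoc (l.1.br' m), hp.br'_mul_br, young_mul_br']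
  have hu2 : ∀ l l', l ≠ l' → u l * u l' = 0 := fun l l' h => by
    simp only [u]
    rw [← br_mul_young (k := k) (l := l'.1), mul_assoc, ← mul_assoc (l.1.br' m), ← mul_assoc (l.1.br' m)]
    have h1 := young_mul_mul_young_of_ne (l := l.1) (l' := l'.1) (fun e => h (Subtype.ext e))
      (l.1.br' (k := k) m * l'.1.br m)
    rw [← mul_assoc, young_mul_br'] at h1
    rw [h1, zero_mul, mul_zero]
  have hu0 : ∀ l, u l ≠ 0 := fun l h => by
    obtain ⟨p, hp⟩ := l.2
    have := hp.tr_br_mul_br' (k := k)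
    rw [show l.1.br m * l.1.br' m = 0 from h, map_zero] at this
    exact inv_ne_zero l.1.hook_ne_zero this.symm
  have hmul : ∀ (g : _ → k) j, (∑ i, g i • u i) * u j = g j • u j := fun g j => by
    rw [Finset.sum_mul, Finset.sum_eq_single j]
    · rw [smul_mul_assoc, hu1]
    · intro i _ hi
      rw [smul_mul_assoc, hu2 i j hi, smul_zero]
    · exact fun h => absurd (Finset.mem_univ j) h
  have hli : LinearIndependent k u := by
    rw [Fintype.linearIndependent_iff]
    intro g hg j
    have := hmul g j
    rw [hg, zero_mul] at this
    exact (smul_eq_zero.1 this.symm).resolve_right (hu0 j)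
  have hspan : Submodule.span k (Set.range u) = W := by
    refine Submodule.eq_of_le_of_finrank_le (Submodule.span_le.2 ?_) ?_
    · rintro _ ⟨l, rfl⟩; exact huW l
    · rw [finrank_span_eq_card hli, ← Nat.card_eq_fintype_card]; exact hc
  have hem : inclA k n (m.young k) ∈ Submodule.span k (Set.range u) := by
    have := hW 1
    rwa [mul_one, ← map_mul, young_mul_young, ← hspan] at this
  obtain ⟨c, hc⟩ := (Submodule.mem_span_range_iff_exists_fun k).1 hem
  have hc1 : ∀ j, c j = 1 := fun j => by
    have h1 := hmul c j
    rw [hc, show inclA k n (m.young k) * u j = u j by rw [← mul_assoc, young_mul_br]] at h1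
    have h2 : (c j - 1) • u j = 0 := by rw [sub_smul, ← h1, one_smul, sub_self]
    exact sub_eq_zero.1 ((smul_eq_zero.1 h2).resolve_right (hu0 j))
  simp only [hc1, one_smul] at hc
  rw [← hc]
  refine Eq.trans ?_ (Finset.sum_subtype (Finset.univ.filter fun l => Adj l m) (by simp)
    (fun l : Part (n + 1) => l.br m * l.br' m))
  symm
  refine Finset.sum_filter_of_ne fun l _ hl => ?_
  by_contra h
  exact hl (by rw [br_eq_zero (not_exists.1 h), zero_mul])

variable (k n) in
/-- The Young idempotents generate the unit ideal. -/
def YoungComplete : Prop :=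
  (1 : GA k n) ∈ Submodule.span k {x | ∃ (l : Part n) (a b : GA k n), x = a * l.young k * b}

variable (k n) in
/-- The branching rule. -/
def Branching : Prop :=
  ∀ m : Part n, ∑ l : Part (n + 1), l.br m * l.br' m = inclA k n (m.young k)

theorem Branching.br_smul (H : Branching k n) (l : Part (n + 1)) (m : Part n) (x : GA k (n + 1)) :
    ∃ c : k, inclA k n (m.young k) * x * l.young k = c • l.br m := by
  obtain ⟨c, hc⟩ := l.young_mul_mul_young (l.br' m * x)
  refine ⟨c, ?_⟩
  rw [← H m, mul_assoc, Finset.sum_mul, Finset.sum_eq_single l]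
  · rw [← young_mul_br', mul_assoc, ← mul_assoc (l.young k * _), mul_assoc (l.young k), hc,
      mul_smul_comm, br_mul_young]
  · intro l' _ hne
    rw [← young_mul_br', mul_assoc, ← mul_assoc (l'.young k * _), mul_assoc (l'.young k),
      young_mul_mul_young_of_ne hne, mul_zero]
  · exact fun h => absurd (Finset.mem_univ l) h

theorem Branching.br'_smul (H : Branching k n) (l : Part (n + 1)) (m : Part n) (x : GA k (n + 1)) :
    ∃ c : k, l.young k * x * inclA k n (m.young k) = c • l.br' m := by
  obtain ⟨c, hc⟩ := l.young_mul_mul_young (x * l.br m)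
  refine ⟨c, ?_⟩
  rw [← H m, Finset.mul_sum, Finset.sum_eq_single l]
  · rw [← br_mul_young, ← mul_assoc, ← mul_assoc, mul_assoc (l.young k), hc, smul_mul_assoc,
      young_mul_br']
  · intro l' _ hne
    rw [← br_mul_young, ← mul_assoc, ← mul_assoc, mul_assoc (l.young k),
      young_mul_mul_young_of_ne hne.symm, zero_mul]
  · exact fun h => absurd (Finset.mem_univ l) h

open Classical in
/-- A spanning family of `e_{l'} k[S_{n+2}] e_l`. -/
def mackey (l' l : Part (n + 1)) : Option (Part n) → GA k (n + 2)
  | none => if l' = l then inclA k _ (l.young k) else 0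
  | some m => inclA k _ (l'.br' m) * swA k n * inclA k _ (l.br m)

theorem mem_span_mackey (H : Branching k n) (hC : YoungComplete k n) (l' l : Part (n + 1))
    (x : GA k (n + 2)) : inclA k _ (l'.young k) * x * inclA k _ (l.young k) ∈
      Submodule.span k (Set.range (mackey (k := k) l' l)) := by
  induction x using ga_induction with
  | of g =>
    obtain ⟨h, rfl⟩ | ⟨a, b, rfl⟩ := double_coset g
    · rw [← inclA_ofP, ← map_mul, ← map_mul]
      by_cases e : l' = l
      · subst e
        obtain ⟨c, hc⟩ := l'.young_mul_mul_young (ofP (k := k) h)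
        rw [hc, map_smul]
        exact Submodule.smul_mem _ _ (Submodule.subset_span ⟨none, by simp [mackey]⟩)
      · rw [young_mul_mul_young_of_ne e, map_zero]
        exact Submodule.zero_mem _
    · suffices ∀ y ∈ Submodule.span k {x | ∃ (m : Part n) (a b : GA k n), x = a * m.young k * b},
          inclA k _ (l'.young k) * (ofP (incl _ a) * (swA k n * inclA k _ (inclA k _ y)) *
            ofP (incl _ b)) * inclA k _ (l.young k) ∈
              Submodule.span k (Set.range (mackey (k := k) l' l)) by
        have := this 1 hC
        rwa [map_one, map_one, mul_one, swA, ← ofP_mul, ← ofP_mul] at this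
      intro y hy
      induction hy using Submodule.span_induction with
      | mem y hy =>
        obtain ⟨m, c, d, rfl⟩ := hy
        obtain ⟨r, hr⟩ := H.br'_smul l' m (ofP a * inclA k _ c)
        obtain ⟨r', hr'⟩ := H.br_smul l m (inclA k _ d * ofP b)
        have h1 : inclA k _ (l'.young k) * (ofP (incl _ a) * (swA k n * inclA k _ (inclA k _
            (c * m.young k * d))) * ofP (incl _ b)) * inclA k _ (l.young k) =
            inclA k _ (l'.young k * (ofP a * inclA k _ c) * inclA k _ (m.young k)) * swA k n *
            inclA k _ (inclA k _ (m.young k) * (inclA k _ d * ofP b) * l.young k) := by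
          have h2 : c * m.young k * d = (c * m.young k) * (m.young k * d) := by
            rw [mul_assoc c, mul_assoc c, young_mul_self_assoc]
          rw [h2, map_mul, map_mul, ← mul_assoc (swA k n), swA_comm]
          simp only [map_mul, inclA_ofP, mul_assoc]
        rw [h1, hr, hr', map_smul, map_smul, smul_mul_assoc, smul_mul_assoc, mul_smul_comm]
        exact Submodule.smul_mem _ _ (Submodule.smul_mem _ _ (Submodule.subset_span ⟨some m, rfl⟩))
      | zero => simp
      | add y z _ _ hy hz =>
        simp only [map_add, mul_add, add_mul]; exact Submodule.add_mem _ hy hz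
      | smul r y _ hy =>
        simp only [map_smul, mul_smul_comm, smul_mul_assoc]; exact Submodule.smul_mem _ _ hy
  | add x y hx hy => rw [mul_add, add_mul]; exact Submodule.add_mem _ hx hy
  | smul c x hx => rw [mul_smul_comm, smul_mul_assoc]; exact Submodule.smul_mem _ _ hx

theorem YoungComplete.succ (H : Branching k n) (hC : YoungComplete k n) : YoungComplete k (n + 1) := by
  suffices ∀ y ∈ Submodule.span k {x | ∃ (m : Part n) (a b : GA k n), x = a * m.young k * b},
      inclA k _ y ∈ Submodule.span k
        {x | ∃ (l : Part (n + 1)) (a b : GA k (n + 1)), x = a * l.young k * b} by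
    have := this 1 hC
    rwa [map_one] at this
  intro y hy
  induction hy using Submodule.span_induction with
  | mem y hy =>
    obtain ⟨m, c, d, rfl⟩ := hy
    rw [map_mul, map_mul, ← H m, Finset.mul_sum, Finset.sum_mul]
    refine Submodule.sum_mem _ fun l _ => Submodule.subset_span
      ⟨l, inclA k _ c * l.br m, l.br' m * inclA k _ d, ?_⟩
    rw [mul_assoc (inclA k _ c) (l.br m), br_mul_young]
    simp only [mul_assoc]
  | zero => rw [map_zero]; exact Submodule.zero_mem _
  | add y z _ _ hy hz => rw [map_add]; exact Submodule.add_mem _ hy hz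
  | smul r y _ hy => rw [map_smul]; exact Submodule.smul_mem _ _ hy

theorem Branching.succ (H : Branching k n) (hC : YoungComplete k n) : Branching k (n + 1) := by
  classical
  intro m
  let w : Option {ν : Part n // Adj m ν} → GA k (n + 2) := fun o => mackey m m (o.map Subtype.val)
  have hle : Submodule.span k (Set.range (mackey (k := k) m m)) ≤ Submodule.span k (Set.range w) := by
    refine Submodule.span_le.2 ?_
    rintro _ ⟨_ | ν, rfl⟩
    · exact Submodule.subset_span ⟨none, rfl⟩
    · by_cases h : Adj m ν
      · exact Submodule.subset_span ⟨some ⟨ν, h⟩, rfl⟩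
      · simp only [mackey]
        rw [br_eq_zero (not_exists.1 h), map_zero, mul_zero]
        exact Submodule.zero_mem _
  have : Fintype {ν : Part n // Adj m ν} := Fintype.ofFinite _
  refine sum_br_mul_br'_of_span (Submodule.span k (Set.range w))
    (fun x => hle (mem_span_mackey H hC m m x)) (le_trans ?_ (card_adj m))
  rw [Nat.card_eq_fintype_card]
  exact finrank_range_le_card w

omit [CharZero k] in
theorem ga_zero (x : GA k 0) : x = tr x • 1 := ga_ext fun g => by
  obtain rfl := Subsingleton.elim g 1
  rw [tr_apply, MonoidAlgebra.coeff_smul_apply, ← tr_apply 1, tr_one, smul_eq_mul, mul_one]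

omit [CharZero k] in
theorem ga_one (x : GA k 1) : x = tr x • 1 := ga_ext fun g => by
  obtain rfl := Subsingleton.elim g 1
  rw [tr_apply, MonoidAlgebra.coeff_smul_apply, ← tr_apply 1, tr_one, smul_eq_mul, mul_one]

instance : Nonempty (Part 0) := ⟨⟨⊥, rfl⟩⟩

theorem youngComplete_zero : YoungComplete k 0 := by
  obtain ⟨l⟩ := (inferInstance : Nonempty (Part 0))
  refine Submodule.subset_span ⟨l, l.hook k • 1, 1, ?_⟩
  rw [ga_zero (l.young k), tr_young, smul_mul_smul_comm, mul_inv_cancel₀ l.hook_ne_zero, one_smul,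
    one_mul, one_mul]

theorem branching_zero : Branching k 0 := by
  intro m
  refine sum_br_mul_br'_of_span (Submodule.span k {(1 : GA k 1)}) (fun x => ?_) ?_
  · rw [ga_one (_ * _)]
    exact Submodule.smul_mem _ _ (Submodule.mem_span_singleton_self _)
  · refine (finrank_span_le_card ({1} : Set (GA k 1))).trans ?_
    rw [Set.toFinset_singleton, Finset.card_singleton, Nat.succ_le_iff, Nat.card_pos_iff]
    obtain ⟨l, hl⟩ := m.exists_adj
    exact ⟨⟨⟨l, hl⟩⟩, inferInstance⟩

theorem branching_and_youngComplete : ∀ n, Branching k n ∧ YoungComplete k n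
  | 0 => ⟨branching_zero, youngComplete_zero⟩
  | n + 1 =>
    have h := branching_and_youngComplete n
    ⟨h.1.succ h.2, YoungComplete.succ h.1 h.2⟩

theorem branching (n : ℕ) : Branching k n := (branching_and_youngComplete n).1

theorem youngComplete (n : ℕ) : YoungComplete k n := (branching_and_youngComplete n).2

end Part

end

end Heis

namespace Heis

noncomputable section

variable {k : Type u} [Field k] {n : ℕ}

namespace Part

instance : Subsingleton (Part 0) := ⟨fun l m => Subtype.ext (YoungDiagram.ext (by
  rw [Finset.card_eq_zero.1 l.2, Finset.card_eq_zero.1 m.2]))⟩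

theorem exists_removal (l : Part (n + 1)) : ∃ m : Part n, Adj l m := by
  have hmem := l.cell_mem (Fin.last n)
  refine ⟨⟨⟨l.1.cells.erase (l.cell (Fin.last n)), ?_⟩, ?_⟩, Fin.last n, rfl⟩
  · intro c d hdc hc
    rw [Finset.mem_coe, Finset.mem_erase] at hc ⊢
    refine ⟨?_, l.1.isLowerSet hdc hc.2⟩
    rintro rfl
    obtain ⟨j, rfl⟩ := l.mem_cells.1 hc.2
    have h1 : toLex (l.cell (Fin.last n)) ≤ toLex (l.cell j) := Prod.Lex.toLex_mono hdc
    have h2 := (l.cell_strictMono.le_iff_le).1 h1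
    exact hc.1 (congrArg l.cell (Fin.last_le_iff.1 h2))
  · rw [YoungDiagram.card, Finset.card_erase_of_mem hmem]
    exact Nat.sub_eq_of_eq_add l.2

variable [CharZero k]

theorem eq_sum_br (l l' : Part n) (x : GA k (n + 1))
    (hx : inclA k n (l'.young k) * x * inclA k n (l.young k) = x) :
    x = ∑ q : Part (n + 1), (q.hook k * tr (x * (q.br l * q.br' l'))) • (q.br l' * q.br' l) := by
  classical
  have h1 : ∀ q q' : Part (n + 1), q.br l' * q.br' l' * x * (q'.br l * q'.br' l) =
      if q = q' then (q.hook k * tr (x * (q.br l * q.br' l'))) • (q.br l' * q.br' l) else 0 := by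
    intro q q'
    have h2 : q.br l' * q.br' l' * x * (q'.br l * q'.br' l) =
        q.br l' * (q.young k * (q.br' l' * x * q'.br l) * q'.young k) * q'.br' l := by
      rw [← mul_assoc (q.young k), ← mul_assoc (q.young k), young_mul_br', mul_assoc _ (q'.br l),
        br_mul_young]
      simp only [mul_assoc]
    split_ifs with h
    · subst h
      obtain ⟨c, hc⟩ := q.young_mul_mul_young (q.br' l' * x * q.br l)
      have h3 : tr (x * (q.br l * q.br' l')) = c * (q.hook k)⁻¹ := by
        rw [← tr_young, ← smul_eq_mul c, ← map_smul, ← hc, ← mul_assoc (q.young k),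
          ← mul_assoc (q.young k), young_mul_br', mul_assoc _ (q.br l), br_mul_young, ← mul_assoc,
          tr_mul_comm, mul_assoc]
      rw [h2, hc, h3, mul_comm c, ← mul_assoc, mul_inv_cancel₀ q.hook_ne_zero, one_mul,
        mul_smul_comm, smul_mul_assoc, br_mul_young]
    · rw [h2, young_mul_mul_young_of_ne h, mul_zero, zero_mul]
  conv_lhs => rw [← hx, ← branching n l', ← branching n l, Finset.sum_mul, Finset.sum_mul_sum]
  simp only [h1, Finset.sum_ite_eq, Finset.mem_univ, if_true]

/-- The Casimir element of the pairing between `e_{l'} k[S_{n+1}] e_l` and `e_l k[S_{n+1}] e_{l'}`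
does not depend on the choice of dual bases. -/
theorem casimir_eq {V : Type*} [AddCommGroup V] [Module k V]
    (B : GA k (n + 1) →ₗ[k] GA k (n + 1) →ₗ[k] V) (l l' : Part n) {ι : Type*} [Fintype ι]
    (w w' : ι → GA k (n + 1)) (c : ι → k)
    (hw : ∀ i, inclA k n (l'.young k) * w i * inclA k n (l.young k) = w i)
    (hw' : ∀ y, inclA k n (l.young k) * y * inclA k n (l'.young k) = y →
      y = ∑ i, (c i * tr (w i * y)) • w' i) :
    ∑ q : Part (n + 1), q.hook k • B (q.br l' * q.br' l) (q.br l * q.br' l') =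
      ∑ i, c i • B (w i) (w' i) := by
  have h1 : ∀ q : Part (n + 1), q.hook k • B (q.br l' * q.br' l) (q.br l * q.br' l') =
      ∑ i, c i • B ((q.hook k * tr (w i * (q.br l * q.br' l'))) • (q.br l' * q.br' l)) (w' i) := by
    intro q
    have h2 := hw' (q.br l * q.br' l') (by
      rw [← mul_assoc, young_mul_br, mul_assoc, br'_mul_young])
    conv_lhs => rw [h2, map_sum, Finset.smul_sum]
    refine Finset.sum_congr rfl fun i _ => ?_
    rw [map_smul, map_smul, LinearMap.smul_apply, smul_smul, smul_smul]
    congr 1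
    ring
  rw [Finset.sum_congr rfl fun q _ => h1 q, Finset.sum_comm]
  refine Finset.sum_congr rfl fun i _ => ?_
  rw [← Finset.smul_sum, ← LinearMap.sum_apply, ← map_sum, ← eq_sum_br l l' (w i) (hw i)]

omit [CharZero k] in
theorem tr_incl_mul_sw (x : GA k (n + 1)) : tr (inclA k _ x * swA k n) = 0 := by
  rw [← tr_condE, condE_incl_mul, swA, condE_ofP_of_ne, mul_zero, map_zero]
  rw [adj_last, swap_apply_right]
  exact Fin.castSucc_ne_last _

/-- The weights of the dual bases `mackey l' l` and `mackey l l'`. -/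
def mackeyWeight (l' l : Part (n + 1)) : Option (Part n) → k
  | none => l.hook k
  | some m => l.hook k * l'.hook k / m.hook k

open Classical in
theorem tr_mackey (l l' : Part (n + 1)) (i j : Option (Part n)) :
    (mackeyWeight l' l i * tr (mackey (k := k) l' l i * mackey l l' j)) • mackey (k := k) l l' i =
      if i = j then mackey l l' j else 0 := by
  have hcyc : ∀ m : Part n, tr (inclA k _ (l.br' m) * swA k n * inclA k _ (l.br m)) = 0 := fun m => by
    rw [tr_mul_comm, ← mul_assoc, ← map_mul, tr_incl_mul_sw]
  obtain _ | m := i <;> obtain _ | m' := j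
  · simp only [mackey, mackeyWeight, if_true]
    by_cases h : l' = l
    · subst h
      rw [if_pos rfl, ← map_mul, young_mul_young, tr_inclA, tr_young, mul_inv_cancel₀ l'.hook_ne_zero,
        one_smul]
    · rw [if_neg h, if_neg (Ne.symm h), smul_zero]
  · rw [if_neg (by simp)]
    simp only [mackey]
    by_cases h : l' = l
    · subst h
      rw [if_pos rfl, ← mul_assoc, ← mul_assoc, ← map_mul, young_mul_br', hcyc, mul_zero, zero_smul]
    · rw [if_neg h, zero_mul, map_zero, mul_zero, zero_smul]
  · rw [if_neg (by simp)]
    simp only [mackey]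
    by_cases h : l = l'
    · subst h
      rw [if_pos rfl, mul_assoc, ← map_mul, br_mul_young, hcyc, mul_zero, zero_smul]
    · rw [if_neg h, mul_zero, map_zero, mul_zero, zero_smul]
  · have h1 : tr (mackey (k := k) l' l (some m) * mackey l l' (some m')) =
        tr (condE (l.br m * l.br' m') * condE (l'.br (k := k) m' * l'.br' m)) := by
      rw [← tr_swap]
      simp only [mackey, map_mul]
      rw [mul_assoc (inclA k _ (l'.br' m)), mul_assoc (inclA k _ (l'.br' m)), tr_mul_comm]
      simp only [mul_assoc]
    by_cases h : m = m'
    · subst h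
      rw [if_pos rfl]
      by_cases hl : Adj l m
      · by_cases hl' : Adj l' m
        · obtain ⟨p, hp⟩ := hl
          obtain ⟨p', hp'⟩ := hl'
          rw [h1, hp.condE_br_mul_br', hp'.condE_br_mul_br', smul_mul_smul_comm, young_mul_young,
            map_smul, tr_young, smul_eq_mul, mackeyWeight]
          have ha := l.hook_ne_zero (k := k)
          have hb := l'.hook_ne_zero (k := k)
          have hc := m.hook_ne_zero (k := k)
          convert one_smul k _ using 2
          field_simp
        · simp only [mackey, br_eq_zero (not_exists.1 hl'), map_zero, mul_zero, smul_zero]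
      · simp only [mackey, br'_eq_zero (not_exists.1 hl), map_zero, zero_mul, smul_zero]
    · rw [h1, condE_br_mul_br'_of_ne h, zero_mul, map_zero, mul_zero, zero_smul,
        if_neg (by simpa using h)]

theorem young_mul_mackey (l l' : Part (n + 1)) (i : Option (Part n)) :
    inclA k _ (l'.young k) * mackey l' l i * inclA k _ (l.young k) = mackey l' l i := by
  obtain _ | m := i
  · simp only [mackey]
    by_cases h : l' = l
    · subst h
      rw [if_pos rfl, ← map_mul, young_mul_young, ← map_mul, young_mul_young]
    · rw [if_neg h, mul_zero, zero_mul]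
  · simp only [mackey]
    rw [← mul_assoc, ← mul_assoc, ← map_mul, young_mul_br', mul_assoc, ← map_mul, br_mul_young]

theorem casimir_succ {V : Type*} [AddCommGroup V] [Module k V]
    (B : GA k (n + 2) →ₗ[k] GA k (n + 2) →ₗ[k] V) (l l' : Part (n + 1)) :
    ∑ q : Part (n + 2), q.hook k • B (q.br l' * q.br' l) (q.br l * q.br' l') =
      ∑ i, mackeyWeight (k := k) l' l i • B (mackey l' l i) (mackey l l' i) := by
  refine casimir_eq B l l' _ _ _ (young_mul_mackey l l') fun y hy => ?_
  have h := mem_span_mackey (branching n) (youngComplete n) l l' y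
  rw [hy] at h
  clear hy
  induction h using Submodule.span_induction with
  | mem y hy =>
    obtain ⟨j, rfl⟩ := hy
    simp only [tr_mackey, Finset.sum_ite_eq', Finset.mem_univ, if_true]
  | zero => simp
  | add y z _ _ hy hz =>
    conv_lhs => rw [hy, hz]
    simp only [mul_add, map_add, add_smul, Finset.sum_add_distrib]
  | smul r y _ hy =>
    conv_lhs => rw [hy, Finset.smul_sum]
    refine Finset.sum_congr rfl fun i _ => ?_
    rw [smul_smul, mul_smul_comm, map_smul, smul_eq_mul]
    congr 1
    ring

theorem young_zero (l : Part 0) : l.young k = 1 := by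
  have h := l.young_mul_young k
  rw [ga_zero (l.young k), tr_young, smul_mul_smul_comm, one_mul] at h
  have h2 := congrArg tr h
  rw [map_smul, map_smul, tr_one, smul_eq_mul, smul_eq_mul, mul_one, mul_one] at h2
  have h3 : (l.hook k)⁻¹ = 1 :=
    mul_right_cancel₀ (inv_ne_zero l.hook_ne_zero) (h2.trans (one_mul _).symm)
  rw [ga_zero (l.young k), tr_young, h3, one_smul]

theorem hook_zero (l : Part 0) : l.hook k = 1 := by
  have := l.tr_young (k := k)
  rw [young_zero, tr_one] at this
  exact inv_eq_one.1 this.symm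

theorem casimir_zero {V : Type*} [AddCommGroup V] [Module k V]
    (B : GA k 1 →ₗ[k] GA k 1 →ₗ[k] V) (l l' : Part 0) :
    ∑ q : Part 1, q.hook k • B (q.br l' * q.br' l) (q.br l * q.br' l') = B 1 1 := by
  have := casimir_eq B l l' (ι := Unit) (fun _ => 1) (fun _ => 1) (fun _ => 1) (fun _ => by
    rw [young_zero, young_zero, map_one, mul_one, mul_one]) (fun y _ => by
      simpa using ga_one y)
  simpa using this

open Classical in
theorem sum_hook_step {l : Part n} {c : k} (q : Part (n + 1)) (hq : Adj q l)
    (h : ∑ l' : Part n, (l'.hook k)⁻¹ • ∑ q : Part (n + 1),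
      q.hook k • ((q.br l * q.br' l') * (q.br l' * q.br' l)) = c • inclA k n (l.young k)) :
    ∑ m : Part n with Adj q m, q.hook k / m.hook k = c := by
  obtain ⟨p, hp⟩ := hq
  have h1 : ∀ (q' : Part (n + 1)) (l' : Part n), q'.hook k • ((q'.br (k := k) l * q'.br' l') * (q'.br l' * q'.br' l)) =
      (if Adj q' l' then q'.hook k else 0) • (q'.br l * q'.br' l) := by
    intro q' l'
    split_ifs with ha
    · obtain ⟨p', hp'⟩ := ha
      rw [mul_assoc, ← mul_assoc (q'.br' l'), hp'.br'_mul_br, young_mul_br']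
    · rw [br_eq_zero (not_exists.1 ha), zero_mul, mul_zero, smul_zero, zero_smul]
  have h2 : ∑ l' : Part n, (l'.hook k)⁻¹ • ∑ q : Part (n + 1),
      q.hook k • ((q.br (k := k) l * q.br' l') * (q.br l' * q.br' l)) =
      ∑ q : Part (n + 1), (∑ m : Part n with Adj q m, q.hook k / m.hook k) • (q.br (k := k) l * q.br' l) := by
    simp only [h1, Finset.smul_sum, smul_smul, Finset.sum_smul]
    rw [Finset.sum_comm]
    refine Finset.sum_congr rfl fun q' _ => ?_
    rw [Finset.sum_filter]
    refine Finset.sum_congr rfl fun m _ => ?_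
    split_ifs
    · rw [div_eq_inv_mul]
    · rw [mul_zero, zero_smul]
  rw [h2, ← branching n l, Finset.smul_sum] at h
  have h3 : ∀ f : Part (n + 1) → k, q.br' l * (∑ q : Part (n + 1), f q • (q.br l * q.br' l)) * q.br l =
      f q • q.young k := fun f => by
    rw [Finset.mul_sum, Finset.sum_mul, Finset.sum_eq_single q]
    · rw [mul_smul_comm, smul_mul_assoc, ← mul_assoc, hp.br'_mul_br, young_mul_br', hp.br'_mul_br]
    · intro q' _ hne
      have := br_mul_br'_of_ne (k := k) (l := q) (l' := q') hne.symm (m := l) (m' := l)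
      rw [← young_mul_br', mul_smul_comm, smul_mul_assoc, mul_assoc, mul_assoc, mul_assoc]
      have h4 := young_mul_mul_young_of_ne (k := k) (Ne.symm hne) (q.br' l * q'.br l)
      rw [← mul_assoc, young_mul_br', mul_assoc, br_mul_young] at h4
      rw [← mul_assoc (q.br' l), h4, zero_mul, mul_zero, smul_zero]
    · exact fun h => absurd (Finset.mem_univ q) h
  have h5 := h3 (fun q => ∑ m : Part n with Adj q m, q.hook k / m.hook k)
  rw [h, h3 fun _ => c] at h5
  exact (smul_left_injective k q.young_ne_zero h5).symm

open Classical in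
theorem casimir_mul (l l' : Part (n + 1)) : (l'.hook k)⁻¹ • ∑ q : Part (n + 2),
    q.hook k • ((q.br (k := k) l * q.br' l') * (q.br l' * q.br' l)) =
    (if l' = l then inclA k _ (l.young k) else 0) + ∑ m : Part n, (l.hook k / m.hook k) •
      (inclA k _ (l.br' m) * swA k n * inclA k _ (l'.br m * l'.br' m) * swA k n * inclA k _ (l.br m)) := by
  have h := casimir_succ (LinearMap.mul k (GA k (n + 2))).flip l l'
  simp only [LinearMap.flip_apply, LinearMap.mul_apply'] at h
  have ha := l'.hook_ne_zero (k := k)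
  rw [h, Fintype.sum_option, smul_add, Finset.smul_sum]
  refine congrArg₂ (· + ·) ?_ (Finset.sum_congr rfl fun m _ => ?_)
  · simp only [mackey, mackeyWeight]
    by_cases e : l' = l
    · subst e
      rw [if_pos rfl, ← map_mul, young_mul_young, smul_smul, inv_mul_cancel₀ ha, one_smul]
    · rw [if_neg e, if_neg (Ne.symm e), zero_mul, smul_zero, smul_zero]
  · rw [smul_smul]
    refine congrArg₂ (· • ·) ?_ ?_
    · rw [mackeyWeight]; field_simp
    · simp only [mackey, map_mul, mul_assoc]

open Classical in
/-- The number of standard tableaux is the sum of the numbers for the diagrams with one box less. -/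
theorem sum_hook : ∀ {n : ℕ} (q : Part (n + 1)),
    ∑ m : Part n with Adj q m, q.hook k / m.hook k = n + 1
  | 0, q => by
    obtain ⟨l, hl⟩ := q.exists_removal
    refine sum_hook_step q hl ?_
    have : Unique (Part 0) := ⟨⟨l⟩, fun _ => Subsingleton.elim _ _⟩
    have h := casimir_zero (LinearMap.mul k (GA k 1)).flip l l
    simp only [LinearMap.flip_apply, LinearMap.mul_apply'] at h
    rw [Fintype.sum_eq_single l (fun l' h => absurd (Subsingleton.elim _ _) h), h, hook_zero,
      young_zero]
    simp
  | n + 1, q => by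
    obtain ⟨l, hl⟩ := q.exists_removal
    refine sum_hook_step q hl ?_
    rw [Finset.sum_congr rfl fun l' _ => casimir_mul l l', Finset.sum_add_distrib, Finset.sum_ite_eq',
      if_pos (Finset.mem_univ _), Finset.sum_comm]
    have h2 : ∀ m : Part n, ∑ l' : Part (n + 1), (l.hook k / m.hook k) •
          (inclA k _ (l.br' m) * swA k n * inclA k _ (l'.br m * l'.br' m) * swA k n * inclA k _ (l.br m)) =
        (if Adj l m then l.hook k / m.hook k else 0) • inclA k _ (l.young k) := by
      intro m
      rw [← Finset.smul_sum, ← Finset.sum_mul, ← Finset.sum_mul, ← Finset.mul_sum, ← map_sum,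
        branching n m, mul_assoc (inclA k _ (l.br' m)), swA_comm, ← mul_assoc (inclA k _ (l.br' m)),
        ← map_mul, br'_mul_young, mul_assoc _ (swA k n) (swA k n), swA_mul_swA, mul_one, ← map_mul]
      split_ifs with ha
      · obtain ⟨p, hp⟩ := ha
        rw [hp.br'_mul_br]
      · rw [br_eq_zero (not_exists.1 ha), mul_zero, map_zero, smul_zero, zero_smul]
    rw [Finset.sum_congr rfl fun m _ => h2 m, ← Finset.sum_smul, ← Finset.sum_filter, sum_hook l]
    rw [show ((n + 1 : ℕ) : k) + 1 = 1 + ((n : k) + 1) by push_cast; ring, add_smul 1, one_smul]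

end Part

end

end Heis

namespace Heis

noncomputable section

variable {k : Type u} [Field k] {n : ℕ}

/-- The sign of a permutation as a scalar. -/
def sgn (g : Perm (Fin n)) : k := ((Perm.sign g : ℤ) : k)

theorem sgn_mul (g h : Perm (Fin n)) : sgn (k := k) (g * h) = sgn g * sgn h := by
  simp [sgn]

theorem sgn_mul_self (g : Perm (Fin n)) : sgn (k := k) g * sgn g = 1 := by
  obtain h | h := Int.units_eq_one_or (Perm.sign g) <;> simp [sgn, h]

theorem sgn_inv (g : Perm (Fin n)) : sgn (k := k) g⁻¹ = sgn g := by simp [sgn]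

/-- The anti-automorphism of the group algebra that sends `g` to `sgn g • g⁻¹`. -/
def tw : GA k n →ₗ[k] GA k n :=
  Finsupp.linearCombination k (fun g => sgn (k := k) g • ofP g⁻¹) ∘ₗ
    (MonoidAlgebra.coeffLinearEquiv k).toLinearMap

theorem tw_ofP (g : Perm (Fin n)) : tw (ofP (k := k) g) = sgn (k := k) g • ofP g⁻¹ := by
  simp [tw, ofP]

theorem tw_mul (x y : GA k n) : tw (x * y) = tw y * tw x := by
  induction x using ga_induction with
  | of g =>
    induction y using ga_induction with
    | of h =>
      rw [← ofP_mul, tw_ofP, tw_ofP, tw_ofP, mul_inv_rev, ofP_mul, smul_mul_smul_comm, sgn_mul,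
        mul_comm]
    | add x y hx hy => simp only [mul_add, add_mul, map_add, hx, hy]
    | smul c x hx => simp only [mul_smul_comm, smul_mul_assoc, map_smul, hx]
  | add x y hx hy => simp only [mul_add, add_mul, map_add, hx, hy]
  | smul c x hx => simp only [mul_smul_comm, smul_mul_assoc, map_smul, hx]

theorem tr_tw (x : GA k n) : tr (tw x) = tr x := by
  induction x using ga_induction with
  | of g =>
    rw [tw_ofP, map_smul, tr_ofP, tr_ofP]
    by_cases h : g = 1
    · simp [h, sgn]
    · simp [h]
  | add x y hx hy => simp only [map_add, hx, hy]
  | smul c x hx => simp only [map_smul, hx]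

theorem tw_inclA (x : GA k n) : tw (inclA k n x) = inclA k n (tw x) := by
  induction x using ga_induction with
  | of g =>
    rw [inclA_ofP, tw_ofP, tw_ofP, map_smul, inclA_ofP, map_inv, sgn, Part.sign_incl]; rfl
  | add x y hx hy => simp only [map_add, hx, hy]
  | smul c x hx => simp only [map_smul, hx]

theorem tw_swA : tw (swA k n) = - swA k n := by
  have h1 : (adj (n + 1) n)⁻¹ = adj (n + 1) n := by rw [adj_last, swap_inv]
  have h2 : sgn (k := k) (adj (n + 1) n) = -1 := by
    rw [sgn, adj_last, Perm.sign_swap (Fin.castSucc_ne_last _)]; simp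
  rw [swA, tw_ofP, h1, h2, neg_smul, one_smul]

namespace Part

theorem exists_tau (l : Part n) :
    ∃ t : Perm (Fin n), ∀ i, l.transpose.cell (t i) = (l.cell i).swap := by
  have h : ∀ i, (l.cell i).swap ∈ l.transpose.1.cells := fun i =>
    YoungDiagram.mem_transpose.2 (by rw [Prod.swap_swap]; exact l.cell_mem i)
  choose t ht using fun i => l.transpose.mem_cells.1 (h i)
  have hinj : Function.Injective t := fun i j e => l.cell.injective (Prod.swap_injective (by
    rw [← ht, ← ht, e]))
  exact ⟨Equiv.ofBijective t (Finite.injective_iff_bijective.1 hinj), ht⟩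

/-- The permutation from the filling of `l` to the transposed filling of the conjugate of `l`. -/
def tau (l : Part n) : Perm (Fin n) := l.exists_tau.choose

theorem cell_tau (l : Part n) (i : Fin n) : l.transpose.cell (l.tau i) = (l.cell i).swap :=
  l.exists_tau.choose_spec i

theorem cell_transpose (l : Part n) (i : Fin n) :
    l.transpose.cell i = (l.cell (l.tau⁻¹ i)).swap := by
  rw [← cell_tau, ← Perm.mul_apply, mul_inv_cancel, Perm.one_apply]

theorem conj_mem_row (l : Part n) (g : Perm (Fin n)) :
    l.tau * g * l.tau⁻¹ ∈ l.transpose.rowPerms ↔ g ∈ l.colPerms := by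
  refine ⟨fun h i => ?_, fun h i => ?_⟩
  · have := h (l.tau i)
    simpa [cell_transpose] using this
  · simpa [cell_transpose] using h (l.tau⁻¹ i)

theorem conj_mem_col (l : Part n) (g : Perm (Fin n)) :
    l.tau * g * l.tau⁻¹ ∈ l.transpose.colPerms ↔ g ∈ l.rowPerms := by
  refine ⟨fun h i => ?_, fun h i => ?_⟩
  · have := h (l.tau i)
    simpa [cell_transpose] using this
  · simpa [cell_transpose] using h (l.tau⁻¹ i)

theorem tw_youngSym (l : Part n) :
    ofP l.tau * tw (l.youngSym k) * ofP l.tau⁻¹ = l.transpose.youngSym k := by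
  classical
  rw [youngSym_eq_sum, youngSym_eq_sum, map_sum, Finset.mul_sum, Finset.sum_mul]
  refine Finset.sum_equiv ((Equiv.prodComm _ _).trans
    (((Equiv.inv _).trans (MulAut.conj l.tau).toEquiv).prodCongr
      ((Equiv.inv _).trans (MulAut.conj l.tau).toEquiv))) ?_ ?_
  · rintro ⟨r, c⟩
    simp only [Finset.mem_filter, Finset.mem_univ, true_and]
    change _ ↔ l.tau * c⁻¹ * l.tau⁻¹ ∈ _ ∧ l.tau * r⁻¹ * l.tau⁻¹ ∈ _
    rw [conj_mem_row, conj_mem_col, inv_mem_iff, inv_mem_iff, and_comm]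
  · rintro ⟨r, c⟩ _
    change _ = ((Perm.sign (l.tau * r⁻¹ * l.tau⁻¹) : ℤ) : k) • ofP ((l.tau * c⁻¹ * l.tau⁻¹) *
      (l.tau * r⁻¹ * l.tau⁻¹))
    change _ * tw (sgn c • _) * _ = sgn (l.tau * r⁻¹ * l.tau⁻¹) • _
    rw [map_smul, tw_ofP, smul_smul, mul_smul_comm, smul_mul_assoc, ← ofP_mul, ← ofP_mul]
    congr 1
    · simp only [sgn_mul, sgn_inv]
      rw [mul_comm (sgn r), ← mul_assoc, sgn_mul_self, mul_comm (sgn l.tau), mul_assoc, sgn_mul_self,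
        one_mul, mul_one]
    · congr 1; group

theorem conj_mul_conj (t : Perm (Fin n)) (x y : GA k n) :
    (ofP t * x * ofP t⁻¹) * (ofP t * y * ofP t⁻¹) = ofP t * (x * y) * ofP t⁻¹ := by
  simp only [mul_assoc]
  rw [← mul_assoc (ofP t⁻¹), ofP_inv_mul, one_mul]

theorem tr_conj (t : Perm (Fin n)) (x : GA k n) : tr (ofP t * x * ofP t⁻¹) = tr x := by
  rw [tr_mul_comm, ← mul_assoc, ofP_inv_mul, one_mul]

theorem hook_transpose (l : Part n) : l.transpose.hook k = l.hook k := by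
  rw [hook, ← tw_youngSym, conj_mul_conj, tr_conj, ← tw_mul, tr_tw]; rfl

theorem young_transpose (l : Part n) :
    l.transpose.young k = ofP l.tau * tw (l.young k) * ofP l.tau⁻¹ := by
  rw [young_eq, hook_transpose, ← tw_youngSym, young_eq, map_smul, mul_smul_comm, smul_mul_assoc]

theorem IsBox.transpose {l : Part (n + 1)} {m : Part n} {p : Fin (n + 1)} (h : IsBox l m p) :
    IsBox l.transpose m.transpose (l.tau p) := by
  refine Finset.ext fun c => ?_
  have h1 : c ∈ m.transpose.1.cells ↔ c.swap ∈ m.1.cells := YoungDiagram.mem_transpose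
  have h2 : c ∈ l.transpose.1.cells ↔ c.swap ∈ l.1.cells := YoungDiagram.mem_transpose
  rw [Finset.mem_erase, cell_tau, h1, h2, ← show l.1.cells.erase (l.cell p) = m.1.cells from h,
    Finset.mem_erase]
  refine and_congr (not_congr ?_) Iff.rfl
  exact ⟨fun e => by rw [e, Prod.swap_swap], fun e => by rw [← e, Prod.swap_swap]⟩

theorem IsBox.toLast_tau {l : Part (n + 1)} {m : Part n} {p : Fin (n + 1)} (h : IsBox l m p) :
    toLast (l.tau p) * l.tau = incl n m.tau * toLast p := by
  have key : (toLast (l.tau p))⁻¹ * incl n m.tau * toLast p = l.tau := by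
    ext1 i
    refine l.transpose.cell.injective ?_
    rw [cell_tau, Perm.mul_apply, Perm.mul_apply]
    obtain rfl | ⟨i, rfl⟩ := p.eq_self_or_eq_succAbove i
    · rw [toLast_self, incl_last, toLast_inv_last, cell_tau]
    · rw [toLast_succAbove, incl_castSucc, h.transpose.cell_inv, cell_tau, h.cell_succAbove]
  nth_rewrite 2 [← key]
  simp only [← mul_assoc, mul_inv_cancel, one_mul]

variable [CharZero k] {l : Part (n + 1)} {m : Part n} {p : Fin (n + 1)}

omit [CharZero k] in
theorem IsBox.br_transpose (h : IsBox l m p) : l.transpose.br (k := k) m.transpose =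
    sgn (k := k) (toLast p) • (ofP (incl n m.tau) * tw (l.br' m) * ofP l.tau⁻¹) := by
  have h1 : ofP (k := k) (toLast (l.tau p)) * ofP l.tau = ofP (incl n m.tau) * ofP (toLast p) := by
    rw [← ofP_mul, ← ofP_mul, h.toLast_tau]
  rw [br, h.transpose.split, young_transpose, young_transpose, br', h.merge, tw_mul, tw_mul, tw_ofP,
    tw_inclA, inv_inv, sgn_inv, map_mul, map_mul, inclA_ofP, inclA_ofP]
  have h2 : ofP (k := k) (incl n m.tau⁻¹) * ofP (toLast (l.tau p)) * ofP l.tau = ofP (toLast p) := by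
    rw [mul_assoc, h1, ← mul_assoc, map_inv, ofP_inv_mul, one_mul]
  simp only [smul_mul_assoc, mul_smul_comm]
  rw [smul_smul, sgn_mul_self, one_smul, ← h2]
  simp only [mul_assoc]

omit [CharZero k] in
theorem IsBox.br'_transpose (h : IsBox l m p) : l.transpose.br' (k := k) m.transpose =
    sgn (k := k) (toLast p) • (ofP l.tau * tw (l.br m) * ofP (incl n m.tau)⁻¹) := by
  have h1 : ofP (k := k) (toLast (l.tau p)) * ofP l.tau = ofP (incl n m.tau) * ofP (toLast p) := by
    rw [← ofP_mul, ← ofP_mul, h.toLast_tau]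
  rw [br', h.transpose.merge, young_transpose, young_transpose, br, h.split, tw_mul, tw_mul, tw_ofP,
    tw_inclA, map_mul, map_mul, inclA_ofP, inclA_ofP, map_inv]
  have h2 : ofP (k := k) l.tau⁻¹ * ofP (toLast (l.tau p))⁻¹ * ofP (incl n m.tau) = ofP (toLast p)⁻¹ := by
    rw [← ofP_mul, ← ofP_mul, ← mul_inv_rev, h.toLast_tau, mul_inv_rev, inv_mul_cancel_right]
  simp only [smul_mul_assoc, mul_smul_comm]
  rw [smul_smul, sgn_mul_self, one_smul, ← h2]
  simp only [mul_assoc]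

open Classical in
/-- The sign of the permutation that moves the entry of the box `l \ m` to the last place. -/
def boxSign (l : Part (n + 1)) (m : Part n) : k :=
  if h : ∃ p, IsBox l m p then sgn (toLast h.choose) else 1

omit [CharZero k] in
theorem IsBox.boxSign (h : IsBox l m p) : boxSign l m = sgn (k := k) (toLast p) := by
  have h' : ∃ p, IsBox l m p := ⟨p, h⟩
  rw [Part.boxSign, dif_pos h', h.unique h'.choose_spec]

omit [CharZero k] in
theorem boxSign_mul_self (l : Part (n + 1)) (m : Part n) : boxSign (k := k) l m * boxSign l m = 1 := by
  rw [boxSign]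
  split_ifs
  · exact sgn_mul_self _
  · exact one_mul 1

omit [CharZero k] in
theorem boxSign_ne_zero (l : Part (n + 1)) (m : Part n) : boxSign (k := k) l m ≠ 0 := fun h => by
  have := boxSign_mul_self (k := k) l m
  rw [h, zero_mul] at this
  exact zero_ne_one this

end Part

/-- `Part.boxSign` for diagrams of arbitrary size. -/
def diagSign (Y Z : YoungDiagram) : k :=
  if h : Y.card = Z.card + 1 then Part.boxSign (⟨Y, h⟩ : Part (Z.card + 1)) ⟨Z, rfl⟩ else 1

theorem diagSign_ne_zero (Y Z : YoungDiagram) : diagSign (k := k) Y Z ≠ 0 := by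
  rw [diagSign]
  split_ifs
  · exact Part.boxSign_ne_zero _ _
  · exact one_ne_zero

theorem diagSign_eq (l : Part (n + 1)) (m : Part n) :
    diagSign (k := k) l.1 m.1 = Part.boxSign l m := by
  obtain ⟨Y, hY⟩ := l
  obtain ⟨Z, rfl⟩ := m
  exact dif_pos hY

end

end Heis

namespace Heis

noncomputable section

section Nested

variable {C : Type*} [Category C] [MonoidalCategory C] {X Y : C}

/-- Two nested cups. -/
def nestedCup (η : 𝟙_ C ⟶ X ⊗ Y) : 𝟙_ C ⟶ (X ⊗ X) ⊗ (Y ⊗ Y) :=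
  η ≫ X ◁ ((λ_ Y).inv ≫ η ▷ Y ≫ (α_ X Y Y).hom) ≫ (α_ X X (Y ⊗ Y)).inv

/-- Two nested caps. -/
def nestedCap (ε : X ⊗ Y ⟶ 𝟙_ C) : (X ⊗ X) ⊗ (Y ⊗ Y) ⟶ 𝟙_ C :=
  (α_ X X (Y ⊗ Y)).hom ≫ X ◁ ((α_ X Y Y).inv ≫ ε ▷ Y ≫ (λ_ Y).hom) ≫ ε

/-- A snake of a cup on the right and a cap on the left. -/
def snake (η : 𝟙_ C ⟶ Y ⊗ X) (ε : X ⊗ Y ⟶ 𝟙_ C) : X ⟶ X :=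
  (ρ_ X).inv ≫ X ◁ η ≫ (α_ X Y X).inv ≫ ε ▷ X ≫ (λ_ X).hom

theorem snake_nested {η : 𝟙_ C ⟶ Y ⊗ X} {ε : X ⊗ Y ⟶ 𝟙_ C} (h : snake η ε = 𝟙 X) :
    snake (nestedCup η) (nestedCap ε) = 𝟙 (X ⊗ X) := by
  calc snake (nestedCup η) (nestedCap ε)
      = 𝟙 _ ⊗≫ X ◁ X ◁ η ⊗≫ X ◁ ((X ⊗ Y) ◁ η ≫ ε ▷ (Y ⊗ X)) ▷ X ⊗≫ ε ▷ X ▷ X ⊗≫ 𝟙 _ := by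
        simp only [snake, nestedCup, nestedCap]; monoidal
    _ = 𝟙 _ ⊗≫ X ◁ (snake η ε) ⊗≫ (snake η ε) ▷ X ⊗≫ 𝟙 _ := by
        rw [whisker_exchange]; simp only [snake]; monoidal
    _ = 𝟙 _ := by rw [h]; monoidal

/-- The morphism `X ⟶ X` rotated to an endomorphism of its dual. -/
def mate (η : 𝟙_ C ⟶ Y ⊗ X) (ε : X ⊗ Y ⟶ 𝟙_ C) (f : X ⟶ X) : Y ⟶ Y :=
  (λ_ Y).inv ≫ η ▷ Y ≫ (α_ Y X Y).hom ≫ Y ◁ (f ▷ Y ≫ ε) ≫ (ρ_ Y).hom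

theorem mate_cap {η : 𝟙_ C ⟶ Y ⊗ X} {ε : X ⊗ Y ⟶ 𝟙_ C} (h : snake η ε = 𝟙 X) (f : X ⟶ X) :
    X ◁ mate η ε f ≫ ε = f ▷ Y ≫ ε := by
  calc X ◁ mate η ε f ≫ ε
      = 𝟙 _ ⊗≫ X ◁ η ▷ Y ⊗≫ ((X ⊗ Y) ◁ (f ▷ Y ≫ ε) ≫ ε ▷ 𝟙_ C) ⊗≫ 𝟙 _ := by
        simp only [mate]; monoidal
    _ = 𝟙 _ ⊗≫ snake η ε ▷ Y ⊗≫ (f ▷ Y ≫ ε) ⊗≫ 𝟙 _ := by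
        rw [whisker_exchange]; simp only [snake]; monoidal
    _ = _ := by rw [h]; monoidal

/-- A snake of a cup on the left and a cap on the right. -/
def snake' (η : 𝟙_ C ⟶ X ⊗ Y) (ε : Y ⊗ X ⟶ 𝟙_ C) : X ⟶ X :=
  (λ_ X).inv ≫ η ▷ X ≫ (α_ X Y X).hom ≫ X ◁ ε ≫ (ρ_ X).hom

theorem snake'_nested {η : 𝟙_ C ⟶ X ⊗ Y} {ε : Y ⊗ X ⟶ 𝟙_ C} (h : snake' η ε = 𝟙 X) :
    snake' (nestedCup η) (nestedCap ε) = 𝟙 (X ⊗ X) := by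
  calc snake' (nestedCup η) (nestedCap ε)
      = 𝟙 _ ⊗≫ η ▷ X ▷ X ⊗≫ X ◁ (η ▷ (Y ⊗ X) ≫ (X ⊗ Y) ◁ ε) ▷ X ⊗≫ X ◁ X ◁ ε ⊗≫ 𝟙 _ := by
        simp only [snake', nestedCup, nestedCap]; monoidal
    _ = 𝟙 _ ⊗≫ (snake' η ε) ▷ X ⊗≫ X ◁ (snake' η ε) ⊗≫ 𝟙 _ := by
        rw [← whisker_exchange]; simp only [snake']; monoidal
    _ = 𝟙 _ := by rw [h]; monoidal

/-- The morphism `X ⟶ X` rotated in the other direction. -/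
def mate' (η : 𝟙_ C ⟶ X ⊗ Y) (ε : Y ⊗ X ⟶ 𝟙_ C) (f : X ⟶ X) : Y ⟶ Y :=
  (ρ_ Y).inv ≫ Y ◁ (η ≫ f ▷ Y) ≫ (α_ Y X Y).inv ≫ ε ▷ Y ≫ (λ_ Y).hom

theorem cup_mate' {η : 𝟙_ C ⟶ X ⊗ Y} {ε : Y ⊗ X ⟶ 𝟙_ C} (h : snake' η ε = 𝟙 X) (f : X ⟶ X) :
    η ≫ X ◁ mate' η ε f = η ≫ f ▷ Y := by
  calc η ≫ X ◁ mate' η ε f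
      = 𝟙 _ ⊗≫ (η ▷ 𝟙_ C ≫ (X ⊗ Y) ◁ (η ≫ f ▷ Y)) ⊗≫ X ◁ ε ▷ Y ⊗≫ 𝟙 _ := by
        simp only [mate']; monoidal
    _ = 𝟙 _ ⊗≫ (η ≫ f ▷ Y) ⊗≫ snake' η ε ▷ Y ⊗≫ 𝟙 _ := by
        rw [← whisker_exchange]; simp only [snake']; monoidal
    _ = _ := by rw [h]; monoidal

/-- A cap in the middle of a word. -/
def midCap (ε : X ⊗ Y ⟶ 𝟙_ C) (A B : C) : (A ⊗ X) ⊗ (Y ⊗ B) ⟶ A ⊗ B :=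
  (α_ A X (Y ⊗ B)).hom ≫ A ◁ ((α_ X Y B).inv ≫ ε ▷ B ≫ (λ_ B).hom)

/-- A cup in the middle of a word. -/
def midCup (η : 𝟙_ C ⟶ X ⊗ Y) (A B : C) : A ⊗ B ⟶ (A ⊗ X) ⊗ (Y ⊗ B) :=
  A ◁ ((λ_ B).inv ≫ η ▷ B ≫ (α_ X Y B).hom) ≫ (α_ A X (Y ⊗ B)).inv

theorem midCap_natural (ε : X ⊗ Y ⟶ 𝟙_ C) {A A' B B' : C} (f : A ⟶ A') (g : B ⟶ B') :
    (f ▷ X ⊗ₘ Y ◁ g) ≫ midCap ε A' B' = midCap ε A B ≫ (f ⊗ₘ g) := by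
  calc (f ▷ X ⊗ₘ Y ◁ g) ≫ midCap ε A' B'
      = f ▷ X ▷ (Y ⊗ B) ⊗≫ A' ◁ ((X ⊗ Y) ◁ g ≫ ε ▷ B') ⊗≫ 𝟙 _ := by
        rw [MonoidalCategory.tensorHom_def]; simp only [midCap]; monoidal
    _ = 𝟙 _ ⊗≫ (f ▷ (X ⊗ Y) ≫ A' ◁ ε) ▷ B ⊗≫ A' ◁ g ⊗≫ 𝟙 _ := by
        rw [whisker_exchange]; monoidal
    _ = _ := by
        rw [← whisker_exchange, MonoidalCategory.tensorHom_def]; simp only [midCap]; monoidal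

theorem midCup_natural (η : 𝟙_ C ⟶ X ⊗ Y) {A A' B B' : C} (f : A ⟶ A') (g : B ⟶ B') :
    midCup η A B ≫ (f ▷ X ⊗ₘ Y ◁ g) = (f ⊗ₘ g) ≫ midCup η A' B' := by
  calc midCup η A B ≫ (f ▷ X ⊗ₘ Y ◁ g)
      = 𝟙 _ ⊗≫ (A ◁ η ≫ f ▷ (X ⊗ Y)) ▷ B ⊗≫ A' ◁ ((X ⊗ Y) ◁ g) ⊗≫ 𝟙 _ := by
        rw [MonoidalCategory.tensorHom_def]; simp only [midCup]; monoidal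
    _ = 𝟙 _ ⊗≫ f ▷ B ⊗≫ A' ◁ (η ▷ B ≫ (X ⊗ Y) ◁ g) ⊗≫ 𝟙 _ := by
        rw [whisker_exchange]; monoidal
    _ = _ := by
        rw [← whisker_exchange, MonoidalCategory.tensorHom_def]; simp only [midCup]; monoidal

theorem midCap_midCap (ε : X ⊗ Y ⟶ 𝟙_ C) (A B : C) :
    midCap ε (A ⊗ X) (Y ⊗ B) ≫ midCap ε A B =
      𝟙 _ ⊗≫ A ◁ nestedCap ε ▷ B ⊗≫ 𝟙 _ := by
  simp only [midCap, nestedCap]; monoidal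

theorem midCup_midCup (η : 𝟙_ C ⟶ X ⊗ Y) (A B : C) :
    midCup η A B ≫ midCup η (A ⊗ X) (Y ⊗ B) =
      𝟙 _ ⊗≫ A ◁ nestedCup η ▷ B ⊗≫ 𝟙 _ := by
  simp only [midCup, nestedCup]; monoidal

theorem cross_midCap {ε : X ⊗ Y ⟶ 𝟙_ C} {s : X ⊗ X ⟶ X ⊗ X} {t : Y ⊗ Y ⟶ Y ⊗ Y}
    (h : (X ⊗ X) ◁ t ≫ nestedCap ε = s ▷ (Y ⊗ Y) ≫ nestedCap ε) (A B : C) :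
    (atR s A ⊗ₘ 𝟙 (Y ⊗ Y ⊗ B)) ≫ midCap ε (A ⊗ X) (Y ⊗ B) ≫ midCap ε A B =
      (𝟙 ((A ⊗ X) ⊗ X) ⊗ₘ atL t B) ≫ midCap ε (A ⊗ X) (Y ⊗ B) ≫ midCap ε A B := by
  rw [midCap_midCap, tensorHom_id, id_tensorHom]
  calc _ = 𝟙 _ ⊗≫ A ◁ (s ▷ (Y ⊗ Y) ≫ nestedCap ε) ▷ B ⊗≫ 𝟙 _ := by simp only [atR]; monoidal
    _ = _ := by rw [← h]; simp only [atL]; monoidal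

theorem midCup_cross {η : 𝟙_ C ⟶ X ⊗ Y} {s : X ⊗ X ⟶ X ⊗ X} {t : Y ⊗ Y ⟶ Y ⊗ Y}
    (h : nestedCup η ≫ (X ⊗ X) ◁ t = nestedCup η ≫ s ▷ (Y ⊗ Y)) (A B : C) :
    midCup η A B ≫ midCup η (A ⊗ X) (Y ⊗ B) ≫ (atR s A ⊗ₘ 𝟙 (Y ⊗ Y ⊗ B)) =
      midCup η A B ≫ midCup η (A ⊗ X) (Y ⊗ B) ≫ (𝟙 ((A ⊗ X) ⊗ X) ⊗ₘ atL t B) := by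
  rw [← Category.assoc, ← Category.assoc, midCup_midCup, tensorHom_id, id_tensorHom]
  calc _ = 𝟙 _ ⊗≫ A ◁ (nestedCup η ≫ s ▷ (Y ⊗ Y)) ▷ B ⊗≫ 𝟙 _ := by simp only [atR]; monoidal
    _ = _ := by rw [← h]; simp only [atL]; monoidal

end Nested

variable {k : Type u} [Field k] {n : ℕ}

namespace HeisPre

/-- The cup `1 → QP` -/
def cup' : 𝟙_ (HeisPre k) ⟶ Q ⊗ P := diag .cupQP
/-- The cap `QP → 1` -/
def cap' : (Q ⊗ P : HeisPre k) ⟶ 𝟙_ (HeisPre k) := diag .capQP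

theorem cross_nestedCap : (P ⊗ P) ◁ tQQ ≫ nestedCap (cap (k := k)) = sPP ▷ (Q ⊗ Q) ≫ nestedCap cap := by
  have h1 : snake (cup' (k := k)) cap = 𝟙 P := diag_eq .zigzag₁
  have h2 : mate (nestedCup (cup' (k := k))) (nestedCap cap) sPP = tQQ := diag_eq .rot_left
  rw [← h2, mate_cap (snake_nested h1)]

theorem nestedCup_cross : nestedCup (cup (k := k)) ≫ (P ⊗ P) ◁ tQQ = nestedCup cup ≫ sPP ▷ (Q ⊗ Q) := by
  have h1 : snake' (cup (k := k)) cap' = 𝟙 P := diag_eq .zigzag₄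
  have h2 : mate' (nestedCup (cup (k := k))) (nestedCap cap') sPP = tQQ := diag_eq .rot_right
  rw [← h2, cup_mate' (snake'_nested h1)]

theorem permP_adj {i : ℕ} (h : i < n) : permP (k := k) (n + 1) (adj n i) = crossR sPP n i :=
  (IsCoxeter.exists_hom (M := End (powR (P (k := k)) (n + 1))) n (crossR sPP n)
      (isCoxeter_crossR (diag_eq .s_s) (diag_eq .braid_s) n)).choose_spec i h

theorem permQ_adj {i : ℕ} (h : i < n) : permQ (k := k) (n + 1) (adj n i) = crossL tQQ n i :=
  (IsCoxeter.exists_hom (M := End (powL (Q (k := k)) (n + 1))) n (crossL tQQ n)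
      (isCoxeter_crossL (diag_eq .t_t) (diag_eq .braid_t) n)).choose_spec i h

theorem perm_hom_ext {M : Type*} [Monoid M] {φ ψ : Perm (Fin (n + 1)) →* M}
    (h : ∀ i < n, φ (adj n i) = ψ (adj n i)) : φ = ψ := by
  refine MonoidHom.eq_of_eqOn_denseM (Perm.mclosure_swap_castSucc_succ n) ?_
  rintro _ ⟨j, rfl⟩
  have : swap j.castSucc j.succ = adj n j.val := by rw [adj_of_lt j.isLt]; rfl
  simp only [this]
  exact h _ j.isLt

theorem permP_incl : ∀ (n : ℕ) (g : Perm (Fin n)),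
    permP (k := k) (n + 1) (incl n g) = End.asHom (permP n g) ▷ P
  | 0, g => by
    rw [Subsingleton.elim g 1, map_one, map_one, map_one]
    exact (id_whiskerRight _ _).symm
  | n + 1, g => by
    refine DFunLike.congr_fun (f := (permP (k := k) (n + 2)).comp (incl (n + 1)))
      (g := ((tensorRight P).mapEnd _).comp (permP (n + 1))) (perm_hom_ext fun i hi => ?_) g
    have h1 : permP (k := k) (n + 2) (incl (n + 1) (adj n i)) = End.asHom (permP (n + 1) (adj n i)) ▷ P := by
      rw [incl_adj hi, permP_adj (by omega), crossR_of_ne (by omega), permP_adj hi]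
    exact h1

theorem permQ_incl : ∀ (n : ℕ) (g : Perm (Fin n)),
    permQ (k := k) (n + 1) (incl n g) = Q ◁ End.asHom (permQ n g)
  | 0, g => by
    rw [Subsingleton.elim g 1, map_one, map_one, map_one]
    exact (whiskerLeft_id _ _).symm
  | n + 1, g => by
    refine DFunLike.congr_fun (f := (permQ (k := k) (n + 2)).comp (incl (n + 1)))
      (g := ((tensorLeft Q).mapEnd _).comp (permQ (n + 1))) (perm_hom_ext fun i hi => ?_) g
    have h1 : permQ (k := k) (n + 2) (incl (n + 1) (adj n i)) = Q ◁ End.asHom (permQ (n + 1) (adj n i)) := by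
      rw [incl_adj hi, permQ_adj (by omega), crossL_of_ne (by omega), permQ_adj hi]
    exact h1

instance : MonoidalLinear k (HeisPre k) where
  whiskerLeft_smul := by rintro X Y Z r ⟨f⟩; exact diag_eq (.wl_smul _ _ f)
  smul_whiskerRight := by rintro r Y Z ⟨f⟩ X; exact diag_eq (.smul_wr _ f _)

theorem algP_ofP (g : Perm (Fin n)) : algP (k := k) n (ofP g) = permP n g := MonoidAlgebra.lift_of _ _

theorem algQ_ofP (g : Perm (Fin n)) : algQ (k := k) n (ofP g) = permQ n g := MonoidAlgebra.lift_of _ _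

theorem algP_inclA (x : GA k n) : algP (n + 1) (inclA k n x) = End.asHom (algP n x) ▷ P := by
  induction x using ga_induction with
  | of g => rw [inclA_ofP, algP_ofP, algP_ofP, permP_incl]
  | add x y hx hy => rw [map_add, map_add, map_add, hx, hy]; exact (MonoidalPreadditive.add_whiskerRight _ _).symm
  | smul c x hx => rw [map_smul, map_smul, map_smul, hx]; exact (MonoidalLinear.smul_whiskerRight c _ _).symm

theorem algQ_inclA (x : GA k n) : algQ (n + 1) (inclA k n x) = Q ◁ End.asHom (algQ n x) := by
  induction x using ga_induction with
  | of g => rw [inclA_ofP, algQ_ofP, algQ_ofP, permQ_incl]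
  | add x y hx hy => rw [map_add, map_add, map_add, hx, hy]; exact (MonoidalPreadditive.whiskerLeft_add _ _).symm
  | smul c x hx => rw [map_smul, map_smul, map_smul, hx]; exact (MonoidalLinear.whiskerLeft_smul _ c _).symm

theorem algP_swA : algP (n + 2) (swA k n) = atR sPP (powR P n) := by
  rw [swA, algP_ofP, permP_adj (by omega), crossR_last]

theorem algQ_swA : algQ (n + 2) (swA k n) = atL tQQ (powL Q n) := by
  rw [swA, algQ_ofP, permQ_adj (by omega), crossL_last]

end HeisPre

open HeisPre

theorem capMid_onStrands (x y : GA k n) :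
    capMid n ≫ onStrands x y = onStrands (inclA k n x) (inclA k n y) ≫ capMid n := by
  rw [onStrands, onStrands, algP_inclA, algQ_inclA]
  exact (midCap_natural cap _ _).symm

theorem onStrands_cupMid (x y : GA k n) :
    onStrands x y ≫ cupMid n = cupMid n ≫ onStrands (inclA k n x) (inclA k n y) := by
  rw [onStrands, onStrands, algP_inclA, algQ_inclA]
  exact (midCup_natural cup _ _).symm

theorem swA_capMid_capMid : onStrands (swA k n) 1 ≫ capMid (n + 1) ≫ capMid n =
    onStrands 1 (swA k n) ≫ capMid (n + 1) ≫ capMid n := by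
  rw [onStrands, onStrands, algP_swA, algQ_swA, map_one, map_one]
  exact cross_midCap cross_nestedCap _ _

theorem cupMid_cupMid_swA : cupMid n ≫ cupMid (n + 1) ≫ onStrands (swA k n) 1 =
    cupMid n ≫ cupMid (n + 1) ≫ onStrands 1 (swA k n) := by
  rw [onStrands, onStrands, algP_swA, algQ_swA, map_one, map_one]
  exact midCup_cross nestedCup_cross _ _

variable (k n) in
/-- The action of pairs of group algebra elements as a bilinear map. -/
def onStrandsL : GA k n →ₗ[k] GA k n →ₗ[k] (strands k n ⟶ strands k n) :=
  LinearMap.mk₂ k onStrands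
    (fun x x' y => by simp only [onStrands, map_add]; exact MonoidalPreadditive.add_tensor _ _ _)
    (fun c x y => by
      simp only [onStrands, map_smul, MonoidalCategory.tensorHom_def]
      refine (congrArg (· ≫ _) (MonoidalLinear.smul_whiskerRight c _ _)).trans (Linear.smul_comp _ _ _ _ _ _))
    (fun x y y' => by simp only [onStrands, map_add]; exact MonoidalPreadditive.tensor_add _ _ _)
    (fun c x y => by
      simp only [onStrands, map_smul, MonoidalCategory.tensorHom_def]
      refine (congrArg (_ ≫ ·) (MonoidalLinear.whiskerLeft_smul _ c _)).trans (Linear.comp_smul _ _ _ _ _ _))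

theorem onStrandsL_apply (x y : GA k n) : onStrandsL k n x y = onStrands x y := rfl

theorem onStrands_one : onStrands (1 : GA k n) 1 = 𝟙 _ := by
  rw [onStrands, map_one, map_one]
  exact id_tensorHom_id _ _

end

end Heis

namespace Heis

noncomputable section

variable {k : Type u} [Field k] {n : ℕ}

/-- `tw` composed with multiplication by permutations on both sides. -/
def twist (s t : Perm (Fin n)) : GA k n →ₗ[k] GA k n :=
  LinearMap.mulRight k (ofP t⁻¹) ∘ₗ LinearMap.mulLeft k (ofP s) ∘ₗ tw

theorem twist_apply (s t : Perm (Fin n)) (x : GA k n) : twist s t x = ofP s * tw x * ofP t⁻¹ := rfl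

theorem twist_mul_twist (r s t : Perm (Fin n)) (x y : GA k n) :
    twist r s x * twist s t y = twist r t (y * x) := by
  rw [twist_apply, twist_apply, twist_apply, tw_mul]
  have : ofP (k := k) r * tw x * ofP s⁻¹ * (ofP s * tw y * ofP t⁻¹) =
    ofP r * tw x * (ofP s⁻¹ * ofP s) * tw y * ofP t⁻¹ := by simp only [mul_assoc]
  rw [this, ofP_inv_mul, mul_one, mul_assoc (ofP r)]

theorem inclA_twist (s t : Perm (Fin n)) (x : GA k n) :
    inclA k n (twist s t x) = twist (incl n s) (incl n t) (inclA k n x) := by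
  rw [twist_apply, twist_apply, tw_inclA, map_mul, map_mul, inclA_ofP, inclA_ofP, map_inv]

theorem twist_swA (t : Perm (Fin n)) :
    twist (incl _ (incl n t)) (incl _ (incl n t)) (swA k n) = - swA k n := by
  have h := swA_comm (ofP (k := k) t)
  rw [inclA_ofP, inclA_ofP] at h
  rw [twist_apply, tw_swA, mul_neg, neg_mul, ← h, mul_assoc, ofP_mul_inv, mul_one]

variable [CharZero k]

namespace Part

omit [CharZero k] in
theorem twist_young (l : Part n) : twist l.tau l.tau (l.young k) = l.transpose.young k :=
  l.young_transpose.symm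

variable {l : Part (n + 1)} {m : Part n}

omit [CharZero k] in
theorem br_transpose' (l : Part (n + 1)) (m : Part n) : l.transpose.br (k := k) m.transpose =
    boxSign (k := k) l m • twist (incl n m.tau) l.tau (l.br' m) := by
  by_cases h : ∃ p, IsBox l m p
  · obtain ⟨p, hp⟩ := h
    rw [hp.br_transpose, hp.boxSign, twist_apply]
  · push Not at h
    rw [br'_eq_zero h, map_zero, smul_zero, br_eq_zero]
    intro p hp
    have h2 := hp.transpose
    refine h (l.transpose.tau p) ?_
    convert h2 using 1 <;> exact Subtype.ext (YoungDiagram.transpose_transpose _).symm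

omit [CharZero k] in
theorem br'_transpose' (l : Part (n + 1)) (m : Part n) : l.transpose.br' (k := k) m.transpose =
    boxSign (k := k) l m • twist l.tau (incl n m.tau) (l.br m) := by
  by_cases h : ∃ p, IsBox l m p
  · obtain ⟨p, hp⟩ := h
    rw [hp.br'_transpose, hp.boxSign, twist_apply]
  · push Not at h
    rw [br_eq_zero h, map_zero, smul_zero, br'_eq_zero]
    intro p hp
    have h2 := hp.transpose
    refine h (l.transpose.tau p) ?_
    convert h2 using 1 <;> exact Subtype.ext (YoungDiagram.transpose_transpose _).symm

/-- The product of two branching elements. -/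
def chain (l : Part (n + 2)) (m : Part (n + 1)) (ν : Part n) : GA k (n + 2) :=
  inclA k _ (m.br ν) * l.br m

/-- The product of two branching elements in the other direction. -/
def chain' (l : Part (n + 2)) (m : Part (n + 1)) (ν : Part n) : GA k (n + 2) :=
  l.br' m * inclA k _ (m.br' ν)

section

variable (l l' : Part (n + 2)) (m : Part (n + 1)) (ν : Part n)

theorem chain_mul_young : l.chain m ν * l.young k = l.chain m ν := by
  rw [chain, mul_assoc, br_mul_young]

theorem young_mul_chain' : l.young k * l.chain' m ν = l.chain' m ν := by
  rw [chain', ← mul_assoc, young_mul_br']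

theorem young_mul_chain : inclA k _ (inclA k _ (ν.young k)) * l.chain m ν = l.chain m ν := by
  rw [chain, ← mul_assoc, ← map_mul, young_mul_br]

theorem chain'_mul_young : l.chain' m ν * inclA k _ (inclA k _ (ν.young k)) = l.chain' m ν := by
  rw [chain', mul_assoc, ← map_mul, br'_mul_young]

theorem sum_chain : ∑ l : Part (n + 2), ∑ m : Part (n + 1), l.chain m ν * l.chain' m ν =
    inclA k _ (inclA k _ (ν.young k)) := by
  rw [← branching (k := k) n ν, map_sum, Finset.sum_comm]
  refine Finset.sum_congr rfl fun m _ => ?_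
  have h1 : m.br ν * m.br' ν = m.br ν * m.young k * m.br' (k := k) ν := by rw [br_mul_young]
  rw [h1, map_mul, map_mul, ← branching (k := k) (n + 1) m, Finset.mul_sum, Finset.sum_mul]
  refine Finset.sum_congr rfl fun l' _ => ?_
  simp only [chain, chain', mul_assoc]

variable {l ν}

theorem eq_sum_chain {x : GA k (n + 2)} (h1 : inclA k _ (inclA k _ (ν.young k)) * x = x)
    (h2 : x * l.young k = x) : x = ∑ m : Part (n + 1), l.chain m ν * (l.chain' m ν * x) := by
  nth_rewrite 1 [← h1]
  rw [← sum_chain, Finset.sum_mul, Finset.sum_eq_single l]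
  · simp only [Finset.sum_mul, mul_assoc]
  · intro l' _ hl
    rw [Finset.sum_mul]
    refine Finset.sum_eq_zero fun m _ => ?_
    rw [mul_assoc, ← h2, ← young_mul_chain', ← mul_assoc _ x, mul_assoc (l'.young k),
      young_mul_mul_young_of_ne hl, mul_zero]
  · exact fun h => absurd (Finset.mem_univ l) h

theorem eq_sum_chain' {x : GA k (n + 2)} (h1 : x * inclA k _ (inclA k _ (ν.young k)) = x)
    (h2 : l.young k * x = x) : x = ∑ m : Part (n + 1), (x * l.chain m ν) * l.chain' m ν := by
  nth_rewrite 1 [← h1]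
  rw [← sum_chain, Finset.mul_sum, Finset.sum_eq_single l]
  · simp only [Finset.mul_sum, mul_assoc]
  · intro l' _ hl
    rw [Finset.mul_sum]
    refine Finset.sum_eq_zero fun m _ => ?_
    rw [← mul_assoc, ← h2, ← chain_mul_young, ← mul_assoc, mul_assoc (l.young k),
      young_mul_mul_young_of_ne hl.symm, zero_mul]
  · exact fun h => absurd (Finset.mem_univ l) h

end

/-- Sums over the two ways of removing two boxes vanish under forms for which the transposition of the last two
points is antisymmetric. -/
theorem sum_chain_eq_zero {V : Type*} [AddCommGroup V] [Module k V]
    (B : GA k (n + 2) →ₗ[k] GA k (n + 2) →ₗ[k] V)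
    (hB : ∀ x y, B (swA k n * x) y = - B x (y * swA k n)) (l : Part (n + 2)) (ν : Part n) :
    ∑ m : Part (n + 1), B (l.chain m ν) (l.chain' m ν) = 0 := by
  have hc : ∀ m m', ∃ c : k, l.chain' m ν * (swA k n * l.chain m' ν) = c • l.young k := fun m m' => by
    obtain ⟨c, hc⟩ := l.young_mul_mul_young (l.chain' m ν * (swA k n * l.chain m' ν))
    refine ⟨c, hc ▸ ?_⟩
    rw [← mul_assoc (l.young k), young_mul_chain', mul_assoc, mul_assoc, chain_mul_young]
  choose c hc using hc
  have h1 : ∀ m, swA k n * l.chain m ν = ∑ m', c m' m • l.chain m' ν := fun m => by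
    rw [eq_sum_chain (l := l) (ν := ν) (x := swA k n * l.chain m ν)
      (by rw [← mul_assoc, ← swA_comm, mul_assoc, young_mul_chain])
      (by rw [mul_assoc, chain_mul_young])]
    refine Finset.sum_congr rfl fun m' _ => ?_
    rw [hc, mul_smul_comm, chain_mul_young]
  have h2 : ∀ m, l.chain' m ν * swA k n = ∑ m', c m m' • l.chain' m' ν := fun m => by
    rw [eq_sum_chain' (l := l) (ν := ν) (x := l.chain' m ν * swA k n)
      (by rw [mul_assoc, swA_comm, ← mul_assoc, chain'_mul_young])
      (by rw [← mul_assoc, young_mul_chain'])]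
    refine Finset.sum_congr rfl fun m' _ => ?_
    rw [mul_assoc (l.chain' m ν), hc, smul_mul_assoc, young_mul_chain']
  have key : ∀ B' : GA k (n + 2) →ₗ[k] GA k (n + 2) →ₗ[k] V,
      ∑ m, B' (swA k n * l.chain m ν) (l.chain' m ν) =
        ∑ m, B' (l.chain m ν) (l.chain' m ν * swA k n) := fun B' => by
    simp only [h1, h2, map_sum, LinearMap.sum_apply, map_smul, LinearMap.smul_apply]
    rw [Finset.sum_comm]
  have h3 := key (B.comp (LinearMap.mulLeft k (swA k n)))
  have h4 := key B
  simp only [LinearMap.comp_apply, LinearMap.mulLeft_apply, ← mul_assoc, swA_mul_swA, one_mul] at h3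
  simp only [hB, mul_assoc, swA_mul_swA, mul_one, Finset.sum_neg_distrib] at h3 h4
  have h5 : (2 : k) • ∑ m, B (l.chain m ν) (l.chain' m ν) = 0 := by
    rw [two_smul]; nth_rewrite 1 [h3]; exact neg_add_cancel _
  exact (smul_eq_zero.1 h5).resolve_left two_ne_zero

end Part

end

end Heis

namespace Heis

noncomputable section

open Heis.Part

variable {k : Type u} [Field k] {n : ℕ}

/-- The component of `d^-`, with the sign removed, as a morphism of diagrams. -/
def down (l : Part (n + 1)) (m : Part n) : strands k (n + 1) ⟶ strands k n :=
  onStrands (l.br m) (twist (incl n m.tau) l.tau (l.br' m)) ≫ capMid n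

/-- The component of `d^+`, with the sign removed, as a morphism of diagrams. -/
def rise (l : Part (n + 1)) (m : Part n) : strands k n ⟶ strands k (n + 1) :=
  cupMid n ≫ onStrands (l.br' m) (twist l.tau (incl n m.tau) (l.br m))

variable (k) in
/-- The idempotent of `P^l Q^{l^t}`. -/
def idem (l : Part n) : strands k n ⟶ strands k n := onStrands (l.young k) (l.transpose.young k)

theorem onStrands_smul_right (x y : GA k n) (c : k) : onStrands x (c • y) = c • onStrands x y :=
  (onStrandsL k n x).map_smul c y

theorem onStrands_neg_right (x y : GA k n) : onStrands x (-y) = - onStrands x y :=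
  (onStrandsL k n x).map_neg y

theorem onStrands_zero_left (y : GA k n) : onStrands 0 y = 0 := (onStrandsL k n).map_zero₂ y

theorem idem_split_capMid (l : Part (n + 1)) (m : Part n) :
    idem k l ≫ (onStrands (l.split k m) (l.transpose.split k m.transpose) ≫ capMid n) ≫ idem k m =
      boxSign (k := k) l m • down l m := by
  rw [idem, idem, Category.assoc, capMid_onStrands, ← Category.assoc, ← Category.assoc, onStrands_comp,
    onStrands_comp, ← mul_assoc, ← mul_assoc, ← br, ← br, br_transpose', onStrands_smul_right,
    Linear.smul_comp]
  rfl

theorem idem_cupMid_merge (l : Part (n + 1)) (m : Part n) :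
    idem k m ≫ (cupMid n ≫ onStrands (l.merge k m) (l.transpose.merge k m.transpose)) ≫ idem k l =
      boxSign (k := k) l m • rise l m := by
  rw [idem, idem, Category.assoc, onStrands_comp, ← Category.assoc, onStrands_cupMid, Category.assoc,
    onStrands_comp, ← br', ← br', br'_transpose', onStrands_smul_right,
    Linear.comp_smul]
  rfl

variable [CharZero k]

theorem idem_down (l : Part (n + 1)) (m : Part n) : idem k l ≫ down l m = down l m := by
  rw [idem, down, ← Category.assoc, onStrands_comp, br_mul_young, ← twist_young, twist_mul_twist,
    young_mul_br']

theorem down_idem (l : Part (n + 1)) (m : Part n) : down l m ≫ idem k m = down l m := by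
  rw [idem, down, Category.assoc, capMid_onStrands, ← Category.assoc, onStrands_comp, young_mul_br,
    ← twist_young, inclA_twist, twist_mul_twist, br'_mul_young]

theorem idem_rise (l : Part (n + 1)) (m : Part n) : idem k m ≫ rise l m = rise l m := by
  rw [idem, rise, ← Category.assoc, onStrands_cupMid, Category.assoc, onStrands_comp, br'_mul_young,
    ← twist_young, inclA_twist, twist_mul_twist, young_mul_br]

theorem rise_idem (l : Part (n + 1)) (m : Part n) : rise l m ≫ idem k l = rise l m := by
  rw [idem, rise, Category.assoc, onStrands_comp, young_mul_br', ← twist_young, twist_mul_twist,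
    br_mul_young]

omit [CharZero k] in
theorem down_eq_zero {l : Part (n + 1)} {m : Part n} (h : ¬ Adj l m) : down (k := k) l m = 0 := by
  rw [down, br_eq_zero (not_exists.1 h), onStrands_zero_left, zero_comp]

omit [CharZero k] in
theorem rise_eq_zero {l : Part (n + 1)} {m : Part n} (h : ¬ Adj l m) : rise (k := k) l m = 0 := by
  rw [rise, br'_eq_zero (not_exists.1 h), onStrands_zero_left, comp_zero]

omit [CharZero k] in
theorem down_down (l : Part (n + 2)) (m : Part (n + 1)) (ν : Part n) : down l m ≫ down m ν =
    onStrands (l.chain m ν) (twist (incl _ (incl _ ν.tau)) l.tau (l.chain' m ν)) ≫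
      capMid (k := k) (n + 1) ≫ capMid n := by
  rw [down, down, Category.assoc, ← Category.assoc (capMid _), capMid_onStrands, Category.assoc,
    ← Category.assoc, onStrands_comp, inclA_twist, twist_mul_twist]
  rfl

omit [CharZero k] in
theorem rise_rise (l : Part (n + 2)) (m : Part (n + 1)) (ν : Part n) : rise m ν ≫ rise l m =
    (cupMid (k := k) n ≫ cupMid (n + 1)) ≫
      onStrands (l.chain' m ν) (twist l.tau (incl _ (incl _ ν.tau)) (l.chain m ν)) := by
  rw [rise, rise, Category.assoc, ← Category.assoc (onStrands _ _), onStrands_cupMid, Category.assoc,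
    onStrands_comp, inclA_twist, twist_mul_twist, Category.assoc]
  rfl

omit [CharZero k] in
theorem ofP_mul_swA (t : Perm (Fin n)) :
    ofP (k := k) (incl _ (incl _ t)) * swA k n = swA k n * ofP (incl _ (incl _ t)) := by
  rw [← inclA_ofP, ← inclA_ofP, swA_comm]

theorem sum_down_down (l : Part (n + 2)) (ν : Part n) :
    ∑ m, down l m ≫ down (k := k) m ν = 0 := by
  simp only [down_down]
  refine sum_chain_eq_zero (((onStrandsL k _).compl₂ (twist (incl _ (incl _ ν.tau)) l.tau)).compr₂
    (Linear.rightComp k _ (capMid (n + 1) ≫ capMid n))) (fun x y => ?_) l ν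
  simp only [LinearMap.compr₂_apply, LinearMap.compl₂_apply, onStrandsL_apply, Linear.rightComp_apply]
  have h1 : onStrands (swA k n * x) (twist (incl _ (incl _ ν.tau)) l.tau y) =
      onStrands x (twist (incl _ (incl _ ν.tau)) l.tau y) ≫ onStrands (swA k n) 1 := by
    rw [onStrands_comp, one_mul]
  have h2 : onStrands x (twist (incl _ (incl _ ν.tau)) l.tau (y * swA k n)) =
      -(onStrands x (twist (incl _ (incl _ ν.tau)) l.tau y) ≫ onStrands 1 (swA k n)) := by
    rw [onStrands_comp, one_mul, ← onStrands_neg_right]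
    congr 1
    rw [twist_apply, twist_apply, tw_mul, tw_swA, neg_mul, mul_neg, neg_mul, ← mul_assoc, ofP_mul_swA]
    simp only [mul_assoc]
  rw [h1, h2, Category.assoc, swA_capMid_capMid, Preadditive.neg_comp, neg_neg, Category.assoc]

theorem sum_rise_rise (l : Part (n + 2)) (ν : Part n) :
    ∑ m, rise m ν ≫ rise (k := k) l m = 0 := by
  simp only [rise_rise]
  refine sum_chain_eq_zero (((onStrandsL k _).compl₂ (twist l.tau (incl _ (incl _ ν.tau)))).compr₂
    (Linear.leftComp k _ (cupMid n ≫ cupMid (n + 1)))).flip (fun x y => ?_) l ν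
  simp only [LinearMap.flip_apply, LinearMap.compr₂_apply, LinearMap.compl₂_apply, onStrandsL_apply,
    Linear.leftComp_apply]
  have h1 : onStrands (y * swA k n) (twist l.tau (incl _ (incl _ ν.tau)) x) =
      onStrands (swA k n) 1 ≫ onStrands y (twist l.tau (incl _ (incl _ ν.tau)) x) := by
    rw [onStrands_comp, mul_one]
  have h2 : onStrands y (twist l.tau (incl _ (incl _ ν.tau)) (swA k n * x)) =
      -(onStrands 1 (swA k n) ≫ onStrands y (twist l.tau (incl _ (incl _ ν.tau)) x)) := by
    rw [onStrands_comp, mul_one, ← onStrands_neg_right]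
    congr 1
    rw [twist_apply, twist_apply, tw_mul, tw_swA, mul_neg, mul_neg, neg_mul, ← map_inv, ← map_inv]
    simp only [mul_assoc]
    rw [ofP_mul_swA]
  have h3 := cupMid_cupMid_swA (k := k) (n := n)
  rw [← Category.assoc, ← Category.assoc (cupMid n)] at h3
  rw [h1, h2, ← Category.assoc, h3, Preadditive.comp_neg, ← Category.assoc]

omit [CharZero k] in
theorem rise_down (q : Part (n + 1)) (l l' : Part n) : rise q l ≫ down (k := k) q l' =
    cupMid n ≫ onStrands (q.br l' * q.br' l)
      (twist (incl n l'.tau) (incl n l.tau) (q.br l * q.br' l')) ≫ capMid n := by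
  rw [rise, down, Category.assoc, ← Category.assoc (onStrands _ _), onStrands_comp, twist_mul_twist]

variable (k n) in
/-- A loop through the two middle strands. -/
def hump : strands k (n + 1) ⟶ strands k (n + 1) :=
  cupMid (n + 1) ≫ onStrands (swA k n) (swA k n) ≫ capMid (n + 1)

omit [CharZero k] in
theorem mackey_hump (l l' : Part (n + 1)) (m : Part n) :
    cupMid (n + 1) ≫ onStrands (mackey l' l (some m))
      (twist (incl _ l'.tau) (incl _ l.tau) (mackey l l' (some m))) ≫ capMid (n + 1) =
    -(onStrands (l.br m) (twist (incl n m.tau) l.tau (l.br' m)) ≫ hump k n ≫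
      onStrands (l'.br' m) (twist l'.tau (incl n m.tau) (l'.br m))) := by
  have h : twist (incl _ l'.tau) (incl _ l.tau) (mackey (k := k) l l' (some m)) =
      -(inclA k _ (twist l'.tau (incl n m.tau) (l'.br m)) * (swA k n *
        inclA k _ (twist (incl n m.tau) l.tau (l.br' m)))) := by
    rw [← mul_neg, ← neg_mul, ← twist_swA m.tau, inclA_twist, inclA_twist, twist_mul_twist, twist_mul_twist]
    rfl
  rw [h, onStrands_neg_right, mackey, mul_assoc, ← onStrands_comp, ← onStrands_comp]
  simp only [hump, Category.assoc]
  rw [capMid_onStrands, ← Category.assoc (onStrands (l.br m) _) (cupMid _), onStrands_cupMid]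
  simp only [Category.assoc, Preadditive.neg_comp, Preadditive.comp_neg]

theorem casimir_rise_down (l l' : Part (n + 1)) [Decidable (l' = l)] :
    ∑ q : Part (n + 2), q.hook k • (rise q l ≫ down q l') =
      (if l' = l then l.hook k • (idem k l ≫ cupMid (n + 1) ≫ capMid (n + 1)) else 0) -
      ∑ m : Part n, (l.hook k * l'.hook k / m.hook k) •
        (onStrands (l.br m) (twist (incl n m.tau) l.tau (l.br' m)) ≫ hump k n ≫
          onStrands (l'.br' m) (twist l'.tau (incl n m.tau) (l'.br m))) := by
  simp only [rise_down]
  have h := casimir_succ ((((onStrandsL k _).compl₂ (twist (incl _ l'.tau) (incl _ l.tau))).compr₂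
    (Linear.rightComp k _ (capMid (n + 1)))).compr₂ (Linear.leftComp k _ (cupMid (n + 1)))) l l'
  simp only [LinearMap.compr₂_apply, LinearMap.compl₂_apply, onStrandsL_apply,
    Linear.leftComp_apply, Linear.rightComp_apply] at h
  rw [h, Fintype.sum_option]
  simp only [mackeyWeight, mackey_hump, smul_neg, Finset.sum_neg_distrib, sub_eq_add_neg]
  congr 1
  by_cases e : l' = l
  · subst e
    have h1 : mackey (k := k) l' l' none = inclA k _ (l'.young k) := if_pos rfl
    rw [if_pos rfl, h1, ← inclA_twist, twist_young, ← Category.assoc, ← onStrands_cupMid,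
      Category.assoc, idem]
  · have h1 : mackey (k := k) l' l none = 0 := if_neg e
    rw [if_neg e, h1, onStrands_zero_left, zero_comp, comp_zero, smul_zero]

theorem casimir_rise_down_zero (l l' : Part 0) :
    ∑ q : Part 1, q.hook k • (rise q l ≫ down q l') = idem k l ≫ cupMid 0 ≫ capMid 0 := by
  simp only [rise_down]
  have h := casimir_zero ((((onStrandsL k _).compl₂ (twist (incl _ l'.tau) (incl _ l.tau))).compr₂
    (Linear.rightComp k _ (capMid 0))).compr₂ (Linear.leftComp k _ (cupMid 0))) l l'
  simp only [LinearMap.compr₂_apply, LinearMap.compl₂_apply, onStrandsL_apply,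
    Linear.leftComp_apply, Linear.rightComp_apply] at h
  rw [h, idem, young_zero, young_zero, onStrands_one, Category.id_comp, Subsingleton.elim l'.tau 1,
    Subsingleton.elim l.tau 1, ← map_one (inclA k 0), ← inclA_twist, twist_apply]
  have : tw (1 : GA k 0) = 1 := by
    rw [← ofP_one, tw_ofP, inv_one, sgn, Perm.sign_one]; simp
  rw [this, inv_one, ofP_one, mul_one, mul_one, map_one, onStrands_one, Category.id_comp]

end

end Heis

namespace Heis

noncomputable section

section Middle

variable {C : Type*} [Category C] [MonoidalCategory C] {X Y : C}

/-- An endomorphism of the two middle factors. -/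
def midEnd (A B : C) (f : X ⊗ Y ⟶ X ⊗ Y) : (A ⊗ X) ⊗ (Y ⊗ B) ⟶ (A ⊗ X) ⊗ (Y ⊗ B) :=
  ((α_ A X (Y ⊗ B)).hom ≫ A ◁ (α_ X Y B).inv) ≫ A ◁ (f ▷ B) ≫
    (A ◁ (α_ X Y B).hom ≫ (α_ A X (Y ⊗ B)).inv)

theorem midEnd_id (A B : C) : midEnd A B (𝟙 (X ⊗ Y)) = 𝟙 _ := by
  simp only [midEnd]; monoidal

/-- A loop through two strands. -/
def loop (η : 𝟙_ C ⟶ X ⊗ Y) (ε : X ⊗ Y ⟶ 𝟙_ C) (s : X ⊗ X ⟶ X ⊗ X) (t : Y ⊗ Y ⟶ Y ⊗ Y) :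
    X ⊗ Y ⟶ X ⊗ Y :=
  X ◁ ((λ_ Y).inv ≫ η ▷ Y ≫ (α_ X Y Y).hom) ≫ (α_ X X (Y ⊗ Y)).inv ≫
    (s ▷ (Y ⊗ Y) ≫ (X ⊗ X) ◁ t) ≫ (α_ X X (Y ⊗ Y)).hom ≫
      X ◁ ((α_ X Y Y).inv ≫ ε ▷ Y ≫ (λ_ Y).hom)

theorem midCup_midCap (η : 𝟙_ C ⟶ X ⊗ Y) (ε : X ⊗ Y ⟶ 𝟙_ C) (s : X ⊗ X ⟶ X ⊗ X)
    (t : Y ⊗ Y ⟶ Y ⊗ Y) (A B : C) :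
    midCup η (A ⊗ X) (Y ⊗ B) ≫ (atR s A ⊗ₘ atL t B) ≫ midCap ε (A ⊗ X) (Y ⊗ B) =
      midEnd A B (loop η ε s t) := by
  rw [MonoidalCategory.tensorHom_def]
  simp only [midEnd, loop, midCup, midCap, atR, atL]
  monoidal

theorem midCap_midCup (η : 𝟙_ C ⟶ X ⊗ Y) (ε : X ⊗ Y ⟶ 𝟙_ C) (A B : C) :
    midCap ε A B ≫ midCup η A B = midEnd A B (ε ≫ η) := by
  simp only [midEnd, midCup, midCap]
  monoidal

theorem midCup_midCap_self (η : 𝟙_ C ⟶ X ⊗ Y) (ε : X ⊗ Y ⟶ 𝟙_ C) (A B : C) :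
    midCup η A B ≫ midCap ε A B = A ◁ ((λ_ B).inv ≫ (η ≫ ε) ▷ B ≫ (λ_ B).hom) := by
  simp only [midCup, midCap]
  monoidal

end Middle

variable {k : Type u} [Field k] {K : Type} [Group K]

theorem ρ_mul {G : Type} [Group G] (A : Rep.{u} k G) (g h : G) (x : A) :
    A.ρ (g * h) x = A.ρ g (A.ρ h x) := by
  rw [map_mul]; rfl

theorem coind_one {m : ℕ} {A : Rep.{u} k (Sym K (m + 1))} (x : Rep.coind (up K m) (Rep.res (up K m) A))
    (h : Sym K m) : x.1 (up K m h) = A.ρ (up K m h) (x.1 1) := coind_up _ x h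

variable [Fintype K] [CharZero k]

theorem avg_last {m : ℕ} {B : Type*} [AddCommGroup B] [Module k B] (f : Fin (m + 1) → B) :
    (Fintype.card (Sym K m) : k)⁻¹ • ∑ y : Sym K (m + 1), f (y.1⁻¹ (Fin.last m)) = ∑ j, f j := by
  have h (y : Sym K (m + 1)) : f (y.1⁻¹ (Fin.last m)) =
      ∑ j, if y.1 j = Fin.last m then f j else 0 := by
    rw [Finset.sum_eq_single (y.1⁻¹ (Fin.last m))]
    · rw [if_pos (by simp)]
    · intro j _ hj
      rw [if_neg]
      rintro e
      exact hj (by rw [← e]; simp)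
    · simp
  rw [Finset.sum_congr rfl fun y _ => h y, Finset.sum_comm, Finset.smul_sum]
  refine Finset.sum_congr rfl fun j _ => ?_
  refine avg_eq _ (Equiv.mulRight (swap j (Fin.last m), 1)) _ (fun y hy => if_neg ?_) fun y h e => if_pos ?_
  · simpa only [Equiv.coe_mulRight, Prod.fst_mul, Perm.mul_apply, swap_apply_right] using hy
  · have : (up K m h).1 (Fin.last m) = Fin.last m := incl_last _
    rwa [← e, Equiv.coe_mulRight, Prod.fst_mul, Perm.mul_apply, swap_apply_right] at this

omit [Fintype K] [CharZero k] in
/-- A function on `S_{m+1} × K` that is invariant under left translation by `S_m × K` depends only on the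
preimage of the last point. -/
theorem eq_of_invariant {m : ℕ} {B : Type*} (φ : Sym K (m + 1) → B)
    (h : ∀ g y, φ (up K m g * y) = φ y) (y : Sym K (m + 1)) :
    φ y = φ (swap (y.1⁻¹ (Fin.last m)) (Fin.last m), 1) := by
  have : ∃ g, up K m g = y * (swap (y.1⁻¹ (Fin.last m)) (Fin.last m), 1) := by
    rw [exists_up_iff, Prod.fst_mul, Perm.mul_apply, swap_apply_right]
    simp
  obtain ⟨g, hg⟩ := this
  have hy : y = up K m g * (swap (y.1⁻¹ (Fin.last m)) (Fin.last m), 1) := by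
    rw [hg, mul_assoc]
    refine (mul_one y).symm.trans (congrArg (y * ·) ?_)
    exact Prod.ext (swap_mul_self _ _).symm (one_mul 1).symm
  exact (congrArg φ hy).trans (h _ _)

theorem avg_double {m : ℕ} {B : Type*} [AddCommGroup B] [Module k B] (φ : Sym K (m + 2) → B)
    (h : ∀ g y, φ (up K (m + 1) g * y) = φ y) :
    (Fintype.card (Sym K m) : k)⁻¹ • ∑ y : Sym K (m + 1), φ (sw K m * up K (m + 1) y) + φ 1 =
      (Fintype.card (Sym K (m + 1)) : k)⁻¹ • ∑ z, φ z := by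
  rw [Finset.sum_congr rfl fun z _ => eq_of_invariant φ h z,
    avg_last (k := k) (fun j => φ (swap j (Fin.last (m + 1)), 1)), Fin.sum_univ_castSucc]
  congr 1
  · rw [← avg_last (k := k) (K := K)]
    congr 1
    refine Finset.sum_congr rfl fun y _ => ?_
    rw [eq_of_invariant φ h]
    congr 4
    rw [Prod.fst_mul, fst_sw, mul_inv_rev, swap_inv, Perm.mul_apply, swap_apply_right, ← Prod.fst_inv,
      ← map_inv, up_castSucc, Prod.fst_inv]
  · rw [swap_self]; rfl

theorem el_one (A : Rep.{u} k (Sym K 1)) (x : Rep.coind (up K 0) (Rep.res (up K 0) A)) (g : Sym K 1) :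
    A.ρ g ((Fintype.card (Sym K 0) : k)⁻¹ • ∑ y : Sym K 1, A.ρ y⁻¹ (x.1 y)) = x.1 g := by
  have : (Fintype.card (Sym K 0) : k)⁻¹ • ∑ y : Sym K 1, A.ρ y⁻¹ (x.1 y) = x.1 1 := by
    refine avg_eq _ (Equiv.refl _) _ (fun y hy => absurd (Subsingleton.elim (α := Fin 1) _ _) hy) ?_
    rintro y h rfl
    rw [coind_one, ρ_inv_self]
  rw [this]
  obtain ⟨h, rfl⟩ := exists_up_iff.2 (Subsingleton.elim (α := Fin 1) (g.1 (Fin.last 0)) (Fin.last 0))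
  rw [coind_one]

theorem el_loop {m : ℕ} (A : Rep.{u} k (Sym K (m + 2)))
    (x : Rep.coind (up K (m + 1)) (Rep.res (up K (m + 1)) A)) (g : Sym K (m + 2)) :
    (Fintype.card (Sym K m) : k)⁻¹ • ∑ y : Sym K (m + 1), A.ρ (up K (m + 1) y⁻¹)
      (A.ρ (sw K m) (A.ρ (up K (m + 1) 1) (x.1 (sw K m * up K (m + 1) y * g)))) + x.1 g =
    A.ρ g ((Fintype.card (Sym K (m + 1)) : k)⁻¹ • ∑ y : Sym K (m + 2), A.ρ y⁻¹ (x.1 y)) := by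
  have h := avg_double (k := k) (K := K) (fun z => A.ρ z⁻¹ (x.1 (z * g))) (fun h y => by
    rw [mul_assoc, coind_res_apply, ← ρ_mul, mul_inv_rev, inv_mul_cancel_right])
  have h2 : ∑ y : Sym K (m + 2), A.ρ y⁻¹ (x.1 y) = A.ρ g⁻¹ (∑ z : Sym K (m + 2), A.ρ z⁻¹ (x.1 (z * g))) := by
    rw [map_sum]
    refine (Fintype.sum_equiv (Equiv.mulRight g) _ _ fun y => ?_).symm
    rw [Equiv.coe_mulRight, ← ρ_mul, mul_inv_rev]
  have h3 : ∀ z, A.ρ g (A.ρ g⁻¹ z) = z := fun z => by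
    rw [← ρ_mul, mul_inv_cancel, map_one]; rfl
  rw [h2, map_smul, h3, ← h]
  congr 1
  · congr 1
    refine Finset.sum_congr rfl fun y _ => ?_
    rw [← ρ_mul, ← ρ_mul, map_one, mul_one, mul_inv_rev, ← map_inv,
      inv_eq_of_mul_eq_one_left (sw_sw (K := K) m)]
  · rw [inv_one, map_one, one_mul]; rfl

open HeisPre

theorem evAt_wl (T : Tower k K) (X : HeisPre k) {Y Z : HeisPre k} (f : Y ⟶ Z) :
    (evAt T).map (X ◁ f) = (evO k K X.ob).map ((evAt T).map f) := by
  revert f; rintro ⟨f⟩; rfl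

theorem evAt_wr (T : Tower k K) {X Y : HeisPre k} (f : X ⟶ Y) (Z : HeisPre k) :
    (evAt T).map (f ▷ Z) = (evAt ((evO k K Z.ob).obj T)).map f := by
  revert f; rintro ⟨f⟩; rfl

instance (T : Tower k K) : (evAt T).Linear k where
  map_smul := by rintro X Y ⟨f⟩ c; rfl

theorem evAt_loop (T : Tower k K) : (evAt T).map (loop cup cap sPP tQQ) + 𝟙 _ = (evAt T).map (cap ≫ cup) := by
  refine tower_ext fun m x => ?_
  match m with
  | 0 => exact Subsingleton.elim (α := PUnit) _ _
  | 1 =>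
    exact coind_ext fun g => (zero_add (x.1 g)).trans (el_one (T 1) x g).symm
  | m + 2 => exact coind_ext fun g => el_loop (T (m + 2)) x g

theorem evAt_midEnd (T : Tower k K) (A B : HeisPre k) {f g : P ⊗ Q ⟶ P ⊗ Q}
    (h : (evAt ((evO k K B.ob).obj T)).map f = (evAt ((evO k K B.ob).obj T)).map g) :
    (evAt T).map (midEnd A B f) = (evAt T).map (midEnd A B g) := by
  simp only [midEnd, Functor.map_comp, evAt_wl, evAt_wr, h]

theorem midEnd_add {C : Type*} [Category C] [MonoidalCategory C] [Preadditive C] [MonoidalPreadditive C]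
    {X Y : C} (A B : C) (f g : X ⊗ Y ⟶ X ⊗ Y) : midEnd A B (f + g) = midEnd A B f + midEnd A B g := by
  simp only [midEnd, MonoidalPreadditive.whiskerLeft_add, MonoidalPreadditive.add_whiskerRight,
    Preadditive.add_comp, Preadditive.comp_add]

theorem evAt_midEnd_loop (T : Tower k K) (A B : HeisPre k) :
    (evAt T).map (midEnd A B (loop cup cap sPP tQQ)) + 𝟙 _ =
      (evAt T).map (midEnd A B (cap ≫ cup)) := by
  rw [← (evAt T).map_id, ← midEnd_id, ← (evAt T).map_add, ← midEnd_add]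
  refine evAt_midEnd T _ _ ?_
  rw [(evAt _).map_add, (evAt _).map_id, evAt_loop]

theorem evAt_hump (T : Tower k K) (n : ℕ) :
    (evAt T).map (hump k n) + 𝟙 _ = (evAt T).map (capMid n ≫ cupMid n) := by
  have h1 : hump k n = midEnd (powR P n) (powL Q n) (loop cup cap sPP tQQ) := by
    rw [hump, onStrands, algP_swA, algQ_swA]
    exact midCup_midCap _ _ _ _ _ _
  have h2 : capMid n ≫ cupMid n = midEnd (powR (P (k := k)) n) (powL Q n) (cap ≫ cup) :=
    midCap_midCup _ _ _ _
  rw [h1, h2]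
  exact evAt_midEnd_loop T _ _

/-- The family is concentrated in degree `d`. -/
def Deg (T : Tower k K) (d : ℤ) : Prop := ∀ m : ℕ, (m : ℤ) ≠ d → Subsingleton (T m)

omit [Fintype K] [CharZero k] in
theorem Deg.resF {T : Tower k K} {d : ℤ} (h : Deg T d) : Deg ((resF k K).obj T) (d - 1) := fun m hm =>
  h (m + 1) (by push_cast; omega)

omit [Fintype K] [CharZero k] in
theorem Deg.powL {T : Tower k K} {d : ℤ} (h : Deg T d) : ∀ n : ℕ,
    Deg ((evO k K (powL (Q (k := k)) n).ob).obj T) (d - n)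
  | 0 => by rw [Nat.cast_zero, sub_zero]; exact h
  | n + 1 => by
    have := (h.powL n).resF
    rw [sub_sub] at this
    exact_mod_cast this

omit [Fintype K] [CharZero k] in
theorem el_smul_zero (A : Rep.{u} k (Sym K 0)) (x : A) : (0 : A) = (((0 : ℕ) : ℤ) : k) • x := by simp

theorem el_circle {m : ℕ} (A : Rep.{u} k (Sym K (m + 1))) (x : A) :
    (Fintype.card (Sym K m) : k)⁻¹ • ∑ y : Sym K (m + 1), A.ρ y⁻¹ (A.ρ y x) =
      (((m + 1 : ℕ) : ℤ) : k) • x := by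
  simp only [ρ_inv_self]
  rw [avg_last (k := k) (K := K) (fun _ => x), Finset.sum_const, Finset.card_univ, Fintype.card_fin,
    Int.cast_natCast, Nat.cast_smul_eq_nsmul]

theorem evAt_circle {T : Tower k K} {d : ℤ} (h : Deg T d) :
    (evAt T).map (cup ≫ cap) = (d : k) • 𝟙 _ := by
  refine tower_ext fun m x => ?_
  by_cases hm : (m : ℤ) = d
  · subst hm
    cases m with
    | zero => exact el_smul_zero (T 0) x
    | succ m => exact el_circle (T (m + 1)) x
  · have := h m hm
    exact Subsingleton.elim (α := T m) _ _

theorem evAt_wl_circle {T : Tower k K} {d : ℤ} (h : Deg T d) (A : HeisPre k) (n : ℕ) :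
    (evAt T).map (A ◁ ((λ_ (powL Q n)).inv ≫ (cup ≫ cap) ▷ powL Q n ≫ (λ_ (powL Q n)).hom)) =
      ((d : k) - n) • 𝟙 _ := by
  have h2 : (evAt T).map ((cup (k := k) ≫ cap) ▷ powL Q n) = ((d : k) - n) • 𝟙 _ := by
    rw [evAt_wr, evAt_circle (h.powL n), Int.cast_sub, Int.cast_natCast]
    rfl
  have h3 : (evAt T).map ((λ_ (powL Q n)).inv ≫ (cup ≫ cap) ▷ powL Q n ≫ (λ_ (powL Q n)).hom) =
      ((d : k) - n) • 𝟙 _ := by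
    rw [(evAt T).map_comp, (evAt T).map_comp, h2, Linear.smul_comp, Linear.comp_smul,
      Category.id_comp, ← (evAt T).map_comp, Iso.inv_hom_id, (evAt T).map_id]
  rw [evAt_wl, h3, Functor.map_smul]
  exact congrArg _ (CategoryTheory.Functor.map_id _ _)

theorem evAt_cupMid_capMid {T : Tower k K} {d : ℤ} (h : Deg T d) (n : ℕ) :
    (evAt T).map (cupMid n ≫ capMid n) = ((d : k) - n) • 𝟙 _ := by
  have h1 : cupMid n ≫ capMid n = powR (P (k := k)) n ◁
      ((λ_ (powL Q n)).inv ≫ (cup ≫ cap) ▷ powL Q n ≫ (λ_ (powL Q n)).hom) :=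
    midCup_midCap_self _ _ _ _
  rw [h1]
  exact evAt_wl_circle h _ n

theorem evAt_cap_cup {T : Tower k K} (h : Deg T 1) : (evAt T).map (cap ≫ cup) = 𝟙 _ := by
  refine tower_ext fun m x => ?_
  match m with
  | 0 => exact Subsingleton.elim (α := PUnit) _ _
  | 1 => exact coind_ext fun g => el_one (T 1) x g
  | m + 2 =>
    have := h (m + 2) (by push_cast; omega)
    exact coind_ext fun g => Subsingleton.elim (α := T (m + 2)) _ _

theorem evAt_midEnd_cap_cup {T : Tower k K} (A B : HeisPre k) (h : Deg ((evO k K B.ob).obj T) 1) :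
    (evAt T).map (midEnd A B (cap ≫ cup)) = 𝟙 _ := by
  rw [← (evAt T).map_id, ← midEnd_id]
  refine evAt_midEnd T _ _ ?_
  rw [(evAt _).map_id, evAt_cap_cup h]

theorem evAt_capMid_cupMid {T : Tower k K} {n : ℕ} (h : Deg T (n + 1)) :
    (evAt T).map (capMid n ≫ cupMid n) = 𝟙 _ := by
  have h2 : capMid n ≫ cupMid n = midEnd (powR (P (k := k)) n) (powL Q n) (cap ≫ cup) :=
    midCap_midCup _ _ _ _
  rw [h2]
  refine evAt_midEnd_cap_cup _ _ ?_
  have := h.powL n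
  rwa [add_sub_cancel_left] at this

end

end Heis

namespace Heis

noncomputable section

open HeisPre

/-- The degree `m + n`, in the form in which it arises from iterated induction and restriction. -/
@[reducible] def addDeg : ℕ → ℕ → ℕ
  | 0, m => m
  | n + 1, m => addDeg n (m + 1)

theorem addDeg_eq : ∀ n m : ℕ, addDeg n m = m + n
  | 0, m => rfl
  | n + 1, m => by rw [addDeg, addDeg_eq n, add_right_comm, add_assoc]

/-- The iterated inclusion of symmetric groups. -/
def inclN : ∀ n m : ℕ, Perm (Fin m) →* Perm (Fin (addDeg n m))
  | 0, m => MonoidHom.id _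
  | n + 1, m => (inclN n (m + 1)).comp (incl m)

/-- The inclusion of the first `m` points. -/
def castN : ∀ n m : ℕ, Fin m ↪ Fin (addDeg n m)
  | 0, m => Function.Embedding.refl _
  | n + 1, m => Fin.castSuccEmb.trans (castN n (m + 1))

/-- The points that are added by `n` strands, numbered from the last one. -/
def newPoint : ∀ n m : ℕ, Fin n → Fin (addDeg n m)
  | 0, m => Fin.elim0
  | n + 1, m => Fin.lastCases (castN n (m + 1) (Fin.last m)) (newPoint n (m + 1))

theorem newPoint_castSucc (n m : ℕ) (i : Fin n) :
    newPoint (n + 1) m i.castSucc = newPoint n (m + 1) i := by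
  simp [newPoint]

theorem newPoint_last (n m : ℕ) :
    newPoint (n + 1) m (Fin.last n) = castN n (m + 1) (Fin.last m) := by
  simp [newPoint]

theorem newPoint_ne_castN : ∀ (n m : ℕ) (i : Fin n) (j : Fin m), newPoint n m i ≠ castN n m j
  | n + 1, m, i, j => by
    induction i using Fin.lastCases with
    | last =>
      rw [newPoint_last]
      exact fun h => Fin.castSucc_ne_last j ((castN n (m + 1)).injective h).symm
    | cast i =>
      rw [newPoint_castSucc]
      exact newPoint_ne_castN n (m + 1) i _

theorem newPoint_injective : ∀ n m : ℕ, Function.Injective (newPoint n m)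
  | 0, m => fun i => i.elim0
  | n + 1, m => fun i j h => by
    induction i using Fin.lastCases with
    | last =>
      induction j using Fin.lastCases with
      | last => rfl
      | cast j =>
        rw [newPoint_last, newPoint_castSucc] at h
        exact absurd h.symm (newPoint_ne_castN _ _ _ _)
    | cast i =>
      induction j using Fin.lastCases with
      | last =>
        rw [newPoint_last, newPoint_castSucc] at h
        exact absurd h (newPoint_ne_castN _ _ _ _)
      | cast j =>
        rw [newPoint_castSucc, newPoint_castSucc] at h
        rw [newPoint_injective n (m + 1) h]

theorem inclN_swap : ∀ (n m : ℕ) (i j : Fin m), inclN n m (swap i j) = swap (castN n m i) (castN n m j)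
  | 0, m, i, j => rfl
  | n + 1, m, i, j => by
    have h : incl m (swap i j) = swap i.castSucc j.castSucc := by
      ext a
      induction a using Fin.lastCases with
      | last => rw [incl_last, swap_apply_of_ne_of_ne (Fin.castSucc_ne_last _).symm (Fin.castSucc_ne_last _).symm]
      | cast a =>
        rw [incl_castSucc, ← (Fin.castSucc_injective m).swap_apply]
    rw [inclN, MonoidHom.comp_apply, h, inclN_swap]
    rfl

/-- The action of permutations of the strands on the points that they add. -/
def strandPerm (n m : ℕ) : Perm (Fin n) →* Perm (Fin (addDeg n m)) :=
  Perm.viaEmbeddingHom ⟨newPoint n m, newPoint_injective n m⟩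

theorem strandPerm_injective (n m : ℕ) : Function.Injective (strandPerm n m) :=
  Perm.viaEmbeddingHom_injective _

theorem strandPerm_swap (n m : ℕ) (i j : Fin n) :
    strandPerm n m (swap i j) = swap (newPoint n m i) (newPoint n m j) := by
  set ι : Fin n ↪ Fin (addDeg n m) := ⟨newPoint n m, newPoint_injective n m⟩ with hι
  ext a : 1
  change Perm.viaEmbedding (swap i j) ι a = _
  by_cases h : a ∈ Set.range ι
  · obtain ⟨b, rfl⟩ := h
    rw [Perm.viaEmbedding_apply, ← ι.injective.swap_apply]
    rfl
  · rw [Perm.viaEmbedding_apply_of_notMem _ _ _ h, eq_comm, swap_apply_of_ne_of_ne]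
    · exact fun e => h ⟨i, e.symm⟩
    · exact fun e => h ⟨j, e.symm⟩

theorem strandPerm_adj_of_ne {n i : ℕ} (m : ℕ) (hi : i < n + 1) (h : i ≠ n) :
    strandPerm (n + 2) m (adj (n + 1) i) = strandPerm (n + 1) (m + 1) (adj n i) := by
  rw [adj_of_lt hi, adj_of_lt (show i < n by omega), strandPerm_swap, strandPerm_swap,
    ← newPoint_castSucc, ← newPoint_castSucc]
  rfl

theorem strandPerm_adj_last (n m : ℕ) :
    strandPerm (n + 2) m (adj (n + 1) n) = inclN n (m + 2) (adj (m + 1) m) := by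
  rw [adj_last, adj_last, strandPerm_swap, inclN_swap, newPoint_castSucc, newPoint_last, newPoint_last]
  exact swap_comm _ _

variable {k : Type u} [Field k] {K : Type} [Group K]

/-- The iterated inclusion of `S_m × K`. -/
def upN (n m : ℕ) : Sym K m →* Sym K (addDeg n m) := (inclN n m).prodMap (MonoidHom.id K)

theorem upN_succ (n m : ℕ) (g : Sym K m) : upN (n + 1) m g = upN n (m + 1) (up K m g) := rfl

/-- The family `P^n M`. -/
abbrev powP (n : ℕ) (M : Tower k K) : Tower k K := (evO k K (powR (P (k := k)) n).ob).obj M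

/-- The family `Q^n M`. -/
abbrev powQ (n : ℕ) (M : Tower k K) : Tower k K := (evO k K (powL (Q (k := k)) n).ob).obj M

/-- The iterated evaluation of elements of `P^n M`. -/
def flat : ∀ (n : ℕ) (M : Tower k K) (m : ℕ), powP n M (addDeg n m) →ₗ[k] (Sym K (addDeg n m) → M m)
  | 0, M, m => LinearMap.pi fun y => (M m).ρ y
  | n + 1, M, m =>
    { toFun F y := (flat n ((indF k K).obj M) (m + 1) F y).1 1
      map_add' F G := funext fun y =>
        congrArg (fun f => (f y).1 1) (map_add (flat n ((indF k K).obj M) (m + 1)) F G)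
      map_smul' c F := funext fun y =>
        congrArg (fun f => (f y).1 1) (map_smul (flat n ((indF k K).obj M) (m + 1)) c F) }

/-- Elements of `Q^n M`. -/
def low : ∀ (n : ℕ) (M : Tower k K) (m : ℕ), powQ n M m ≃ₗ[k] M (addDeg n m)
  | 0, M, m => LinearEquiv.refl k _
  | n + 1, M, m => low n M (m + 1)

theorem low_ρ : ∀ (n : ℕ) (M : Tower k K) (m : ℕ) (g : Sym K m) (x : powQ n M m),
    low n M m ((powQ n M m).ρ g x) = (M (addDeg n m)).ρ (upN n m g) (low n M m x)
  | 0, M, m, g, x => rfl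
  | n + 1, M, m, g, x => low_ρ n M (m + 1) (up K m g) x

theorem flat_ρ : ∀ (n : ℕ) (M : Tower k K) (m : ℕ) (F : powP n M (addDeg n m)) (g : Sym K m)
    (y : Sym K (addDeg n m)), flat n M m F (upN n m g * y) = (M m).ρ g (flat n M m F y)
  | 0, M, m, F, g, y => ρ_mul _ _ _ _
  | n + 1, M, m, F, g, y => by
    rw [upN_succ]
    refine (congrArg (fun f => f.1 1) (flat_ρ n ((indF k K).obj M) (m + 1) F (up K m g) y)).trans ?_
    refine (coind_apply (M m) _ _ _).trans ?_
    rw [one_mul]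
    exact coind_up _ _ g

theorem flat_map : ∀ (n : ℕ) {M N : Tower k K} (f : M ⟶ N) (m : ℕ) (F : powP n M (addDeg n m))
    (y : Sym K (addDeg n m)), flat n N m (((evO k K (powR (P (k := k)) n).ob).map f (addDeg n m)).hom F) y =
      (f m).hom (flat n M m F y)
  | 0, M, N, f, m, F, y => (Rep.hom_comm_apply (f m) y F).symm
  | n + 1, M, N, f, m, F, y => congrArg (fun f => f.1 1) (flat_map n ((indF k K).map f) (m + 1) F y)

theorem exists_flat : ∀ (n : ℕ) (M : Tower k K) (m : ℕ) (φ : Sym K (addDeg n m) → M m),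
    (∀ g y, φ (upN n m g * y) = (M m).ρ g (φ y)) → ∃ F, flat n M m F = φ
  | 0, M, m, φ, h => ⟨φ 1, funext fun y => by
      have := h y 1
      rw [mul_one] at this
      exact this.symm⟩
  | n + 1, M, m, φ, h => by
    obtain ⟨F, hF⟩ := exists_flat n ((indF k K).obj M) (m + 1)
      (fun y => (⟨fun z => φ (upN n (m + 1) z * y), fun g z => by
        exact (congrArg (fun w => φ (w * y)) (map_mul _ _ _)).trans
          ((congrArg φ (mul_assoc _ _ _)).trans (h g _))⟩ : Rep.coind (up K m) (M m))) (fun g y => by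
        refine coind_ext fun z => ?_
        refine Eq.trans ?_ (coind_apply (M m) _ g z).symm
        change φ _ = φ _
        rw [map_mul, mul_assoc])
    refine ⟨F, funext fun y => ?_⟩
    refine (congrArg (fun f => (f y).1 1) hF).trans ?_
    change φ _ = φ _
    rw [map_one, one_mul]

variable [Fintype K] [CharZero k]

theorem flat_crossR : ∀ (n i : ℕ) (hi : i < n) (M : Tower k K) (m : ℕ) (F : powP (n + 1) M (addDeg (n + 1) m)) (y),
    flat (n + 1) M m (((evAt M).map (crossR sPP n i) (addDeg (n + 1) m)).hom F) y =
      flat (n + 1) M m F ((strandPerm (n + 1) m (adj n i), 1) * y)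
  | n + 1, i, hi, M, m, F, y => by
    obtain rfl | h := eq_or_ne i n
    · rw [crossR_last, strandPerm_adj_last]
      have h1 := flat_map i (braidI.app M) (m + 2) F y
      have h2 := flat_ρ i ((indF k K).obj ((indF k K).obj M)) (m + 2) F (sw K m) y
      refine (congrArg (fun f => (f.1 1).1 1) h1).trans ?_
      refine Eq.trans ?_ (congrArg (fun f => (f.1 1).1 1) h2).symm
      have h3 : sw K m * up K (m + 1) 1 * 1 = 1 * sw K m := by rw [map_one, mul_one, mul_one, one_mul]
      exact congrArg (fun w => ((flat i ((indF k K).obj ((indF k K).obj M)) (m + 2) F y).1 w).1 1) h3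
    · rw [crossR_of_ne h, strandPerm_adj_of_ne m hi h]
      have h1 := flat_crossR n i (by omega) ((indF k K).obj M) (m + 1) F y
      have h2 := evAt_wr M (crossR sPP n i) P
      refine (congrArg (fun f => flat (n + 2) M m ((f (addDeg (n + 2) m)).hom F) y) h2).trans ?_
      exact congrArg (fun f => f.1 1) h1

theorem low_crossL : ∀ (n i : ℕ) (hi : i < n) (M : Tower k K) (m : ℕ) (x : powQ (n + 1) M m),
    low (n + 1) M m (((evAt M).map (crossL tQQ n i) m).hom x) =
      (M (addDeg (n + 1) m)).ρ (strandPerm (n + 1) m (adj n i), 1) (low (n + 1) M m x)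
  | n + 1, i, hi, M, m, x => by
    obtain rfl | h := eq_or_ne i n
    · rw [crossL_last, strandPerm_adj_last]
      exact low_ρ i M (m + 2) (sw K m) x
    · rw [crossL_of_ne h, strandPerm_adj_of_ne m hi h]
      have h2 := evAt_wl M Q (crossL tQQ n i)
      refine (congrArg (fun f => low (n + 2) M m ((f m).hom x)) h2).trans ?_
      exact low_crossL n i (by omega) M (m + 1) x

theorem perm_induction {n : ℕ} {p : Perm (Fin (n + 1)) → Prop} (one : p 1)
    (adj : ∀ i < n, p (adj n i)) (mul : ∀ g h, p g → p h → p (g * h)) (g : Perm (Fin (n + 1))) : p g := by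
  have hg : g ∈ Submonoid.closure (Set.range fun i : Fin n => swap i.castSucc i.succ) := by
    rw [Perm.mclosure_swap_castSucc_succ]; trivial
  induction hg using Submonoid.closure_induction with
  | one => exact one
  | mem x hx =>
    obtain ⟨j, rfl⟩ := hx
    have : swap j.castSucc j.succ = Heis.adj n j.val := by rw [adj_of_lt j.isLt]; rfl
    simp only [this]
    exact adj _ j.isLt
  | mul x y _ _ hx hy => exact mul x y hx hy

theorem adj_inv {n i : ℕ} (hi : i < n) : (adj n i)⁻¹ = adj n i := by rw [adj_of_lt hi, swap_inv]

theorem flat_permP : ∀ (n : ℕ) (M : Tower k K) (m : ℕ) (g : Perm (Fin n)) (F : powP n M (addDeg n m)) (y),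
    flat n M m (((evAt M).map (End.asHom (permP n g)) (addDeg n m)).hom F) y =
      flat n M m F ((strandPerm n m g⁻¹, 1) * y)
  | 0, M, m, g, F, y => by
    rw [Subsingleton.elim g 1, inv_one, map_one, map_one]
    refine Eq.trans ?_ (congrArg (flat 0 M m F) (one_mul y)).symm
    rfl
  | n + 1, M, m, g, F, y => by
    revert F y
    refine perm_induction (p := fun g => ∀ F y,
      flat (n + 1) M m (((evAt M).map (End.asHom (permP (n + 1) g)) (addDeg (n + 1) m)).hom F) y =
        flat (n + 1) M m F ((strandPerm (n + 1) m g⁻¹, 1) * y)) ?_ ?_ ?_ g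
    · intro F y
      rw [inv_one, map_one, map_one]
      refine Eq.trans ?_ (congrArg (flat (n + 1) M m F) (one_mul y)).symm
      rfl
    · intro i hi F y
      rw [adj_inv hi, permP_adj hi]
      exact flat_crossR n i hi M m F y
    · intro g h hg hh F y
      rw [mul_inv_rev, map_mul, map_mul]
      have h1 : (evAt M).map (End.asHom (permP (n + 1) g * permP (n + 1) h)) =
        (evAt M).map (End.asHom (permP (n + 1) h)) ≫ (evAt M).map (End.asHom (permP (n + 1) g)) :=
        (evAt M).map_comp _ _
      refine (congrArg (fun f => flat (n + 1) M m ((f (addDeg (n + 1) m)).hom F) y) h1).trans ?_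
      refine (hg _ y).trans ((hh F _).trans ?_)
      have h2 : ∀ a b : Perm (Fin (addDeg (n + 1) m)),
          ((a, 1) : Sym K (addDeg (n + 1) m)) * ((b, 1) * y) = (a * b, 1) * y := fun a b =>
        (mul_assoc _ _ _).symm.trans (congrArg (· * y) (Prod.ext rfl (one_mul 1)))
      exact congrArg (flat (n + 1) M m F) (h2 _ _)

theorem low_permQ : ∀ (n : ℕ) (M : Tower k K) (m : ℕ) (g : Perm (Fin n)) (x : powQ n M m),
    low n M m (((evAt M).map (End.asHom (permQ n g)) m).hom x) =
      (M (addDeg n m)).ρ (strandPerm n m g, 1) (low n M m x)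
  | 0, M, m, g, x => by
    rw [Subsingleton.elim g 1, map_one, map_one]
    exact (LinearMap.congr_fun (map_one (M m).ρ) x).symm
  | n + 1, M, m, g, x => by
    revert x
    refine perm_induction (p := fun g => ∀ x,
      low (n + 1) M m (((evAt M).map (End.asHom (permQ (n + 1) g)) m).hom x) =
        (M (addDeg (n + 1) m)).ρ (strandPerm (n + 1) m g, 1) (low (n + 1) M m x)) ?_ ?_ ?_ g
    · intro x
      rw [map_one, map_one]
      exact (LinearMap.congr_fun (map_one (M _).ρ) _).symm
    · intro i hi x
      rw [permQ_adj hi]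
      exact low_crossL n i hi M m x
    · intro g h hg hh x
      rw [map_mul, map_mul]
      have h1 : (evAt M).map (End.asHom (permQ (n + 1) g * permQ (n + 1) h)) =
        (evAt M).map (End.asHom (permQ (n + 1) h)) ≫ (evAt M).map (End.asHom (permQ (n + 1) g)) :=
        (evAt M).map_comp _ _
      refine (congrArg (fun f => low (n + 1) M m ((f m).hom x)) h1).trans ?_
      refine (hg _).trans ((congrArg _ (hh x)).trans ?_)
      have h2 : ∀ a b : Perm (Fin (addDeg (n + 1) m)),
          ((a, 1) : Sym K (addDeg (n + 1) m)) * (b, 1) = (a * b, 1) := fun a b =>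
        Prod.ext rfl (one_mul 1)
      rw [← ρ_mul, h2]

theorem exists_flat_algP (n : ℕ) (M : Tower k K) (v : M 0) : ∃ F : powP n M (addDeg n 0),
    ∀ x : GA k n, flat n M 0 (((evAt M).map (End.asHom (algP n x)) (addDeg n 0)).hom F) 1 = tr x • v := by
  classical
  obtain ⟨F, hF⟩ := exists_flat n M 0 (fun z => if z.1 = 1 then (M 0).ρ (1, z.2) v else 0) (fun g y => by
    have h1 : (upN n 0 g * y).1 = y.1 := by
      have : g.1 = 1 := Subsingleton.elim _ _
      change inclN n 0 g.1 * y.1 = y.1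
      rw [this, map_one, one_mul]
    have h2 : g = (1, g.2) := Prod.ext (Subsingleton.elim _ _) rfl
    rw [h1]
    split_ifs
    · rw [← ρ_mul, h2]; rfl
    · rw [map_zero])
  refine ⟨F, fun x => ?_⟩
  induction x using ga_induction with
  | of g =>
    rw [algP_ofP, flat_permP, hF, tr_ofP, mul_one, ite_smul, one_smul, zero_smul]
    refine if_congr ?_ ?_ rfl
    · change strandPerm n 0 g⁻¹ = 1 ↔ _
      rw [map_eq_one_iff _ (strandPerm_injective n 0), inv_eq_one]
    · exact LinearMap.congr_fun (map_one (M 0).ρ) v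
  | add x y hx hy =>
    rw [map_add, map_add, add_smul, ← hx, ← hy]
    have h := (evAt M).map_add (f := End.asHom (algP n x)) (g := End.asHom (algP n y))
    refine (congrArg (fun f => flat n M 0 ((f (addDeg n 0)).hom F) 1) h).trans ?_
    exact congrArg (fun f => f 1) (map_add (flat n M 0) _ _)
  | smul c x hx =>
    rw [map_smul, map_smul, smul_assoc, ← hx]
    have h := (evAt M).map_smul c (End.asHom (algP n x))
    refine (congrArg (fun f => flat n M 0 ((f (addDeg n 0)).hom F) 1) h).trans ?_
    exact congrArg (fun f => f 1) (map_smul (flat n M 0) c _)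

/-- The bijection that numbers the points in degree `n`. -/
def points (n : ℕ) : Fin n ≃ Fin (addDeg n 0) := finCongr ((addDeg_eq n 0).trans (zero_add n)).symm

/-- The coefficient of a bijection in the regular bimodule. -/
def coeffAt (n : ℕ) : regular k n (addDeg n 0) →ₗ[k] k :=
  Finsupp.lapply (points n) ∘ₗ (MonoidAlgebra.coeffLinearEquiv k).toLinearMap

theorem exists_low_algQ (n : ℕ) : ∃ v : powQ n (regular k n) 0, ∀ y : GA k n,
    coeffAt n (low n (regular k n) 0 (((evAt (regular k n)).map (End.asHom (algQ n y)) 0).hom v)) = tr y := by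
  classical
  obtain ⟨v, hv⟩ := (low n (regular k n) 0).surjective
    (MonoidAlgebra.single (points n) 1 : MonoidAlgebra k (Fin n ≃ Fin (addDeg n 0)))
  refine ⟨v, fun y => ?_⟩
  induction y using ga_induction with
  | of g =>
    rw [algQ_ofP, low_permQ, hv, tr_ofP]
    have h1 : ((regular k n (addDeg n 0)).ρ (strandPerm n 0 g, 1)) (MonoidAlgebra.single (points n) 1) =
      MonoidAlgebra.single ((points n).trans (strandPerm n 0 g)) 1 := Representation.ofMulAction_single _ _ _
    rw [h1]
    have h2 : coeffAt n (MonoidAlgebra.single ((points n).trans (strandPerm n 0 g)) (1 : k)) =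
      if (points n).trans (strandPerm n 0 g) = points n then 1 else 0 := by
      exact Finsupp.single_apply
    refine h2.trans (if_congr ?_ rfl rfl)
    rw [← map_eq_one_iff _ (strandPerm_injective n 0)]
    refine ⟨fun h => Equiv.ext fun i => ?_, fun h => by rw [h]; rfl⟩
    have := congrArg (fun f => f ((points n).symm i)) h
    simpa using this
  | add x y hx hy =>
    rw [map_add, map_add, ← hx, ← hy]
    have h := (evAt (regular k n)).map_add (f := End.asHom (algQ n x)) (g := End.asHom (algQ n y))
    refine (congrArg (fun f => coeffAt n (low n (regular k n) 0 ((f 0).hom v))) h).trans ?_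
    exact (congrArg _ (map_add (low n (regular k n) 0) _ _)).trans (map_add (coeffAt n) _ _)
  | smul c x hx =>
    rw [map_smul, map_smul, ← hx]
    have h := (evAt (regular k n)).map_smul c (End.asHom (algQ n x))
    refine (congrArg (fun f => coeffAt n (low n (regular k n) 0 ((f 0).hom v))) h).trans ?_
    exact (congrArg _ (map_smul (low n (regular k n) 0) c _)).trans (map_smul (coeffAt n) c _)

theorem evAt_onStrands_ne_zero {n : ℕ} {x y : GA k n} (hx : tr x ≠ 0) (hy : tr y ≠ 0) :
    (evAt (regular k n)).map (onStrands x y) ≠ 0 := by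
  intro h
  obtain ⟨v, hv⟩ := exists_low_algQ (k := k) n
  obtain ⟨F, hF⟩ := exists_flat_algP n (powQ n (regular k n)) v
  have h1 : (evAt (regular k n)).map (onStrands x y) =
      (evAt (powQ n (regular k n))).map (End.asHom (algP n x)) ≫
        (evO k _ (powR (P (k := k)) n).ob).map ((evAt (regular k n)).map (End.asHom (algQ n y))) := by
    exact ((evAt (regular k n)).map_comp (algP n x ▷ powL Q n) (powR P n ◁ algQ n y)).trans
      (congrArg₂ (· ≫ ·) (evAt_wr _ _ _) (evAt_wl _ _ _))
  have h2 := flat_map n (M := powQ n (regular k n)) (N := powQ n (regular k n)) ((evAt (regular k n)).map (End.asHom (algQ n y))) 0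
    (((evAt (powQ n (regular k n))).map (End.asHom (algP n x)) (addDeg n 0)).hom F) 1
  have h3 := congrArg (fun f => flat n (powQ n (regular k n)) 0 ((f (addDeg n 0)).hom F) 1) (h1.symm.trans h)
  have h4 := h2.symm.trans h3
  rw [hF, map_smul] at h4
  have h5 := congrArg (fun w => coeffAt n (low n (regular k n) 0 w)) h4
  have h6 : tr x * tr y = 0 := by
    rw [← hv y]
    refine Eq.trans ?_ (h5.trans ?_)
    · exact ((congrArg _ (map_smul (low n (regular k n) 0) (tr x) _)).trans (map_smul (coeffAt n) _ _)).symm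
    · have h7 : flat n (powQ n (regular k n)) 0 0 1 = 0 :=
        congrArg (fun f => f 1) (map_zero (flat n (powQ n (regular k n)) 0))
      exact (congrArg (fun w => coeffAt n (low n (regular k n) 0 w)) h7).trans
        ((congrArg _ (map_zero (low n (regular k n) 0))).trans (map_zero _))
  exact (mul_ne_zero hx hy) h6

theorem evAt_idem_ne_zero {n : ℕ} (l : Part n) : (evAt (regular k n)).map (idem k l) ≠ 0 :=
  evAt_onStrands_ne_zero (by rw [Part.tr_young]; exact inv_ne_zero (l.hook_ne_zero))
    (by rw [Part.tr_young]; exact inv_ne_zero (l.transpose.hook_ne_zero))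

omit [CharZero k] in
theorem deg_regular (n : ℕ) : Deg (regular k n) n := fun m hm => by
  have : IsEmpty (Fin n ≃ Fin m) := ⟨fun e => hm (by
    have := Fintype.card_congr e
    simpa using this.symm)⟩
  exact (MonoidAlgebra.coeffLinearEquiv k (M := Fin n ≃ Fin m)).injective.subsingleton

end

end Heis

namespace Heis

noncomputable section

open Heis.Part

variable {k : Type u} [Field k] [CharZero k] {n : ℕ}

theorem onStrands_br_br' (l l' : Part (n + 1)) (m : Part n) [Decidable (l' = l)] [Decidable (Adj l m)] :
    onStrands (l.br m) (twist (incl n m.tau) l.tau (l.br' m)) ≫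
      onStrands (l'.br' m) (twist l'.tau (incl n m.tau) (l'.br m)) =
    if l' = l ∧ Adj l m then idem k l else 0 := by
  rw [onStrands_comp, twist_mul_twist]
  by_cases h : l' = l
  · subst h
    by_cases h' : Adj l' m
    · obtain ⟨p, hp⟩ := id h'
      rw [if_pos ⟨rfl, h'⟩, hp.br'_mul_br, twist_young, idem]
    · rw [if_neg fun h => h' h.2, br_eq_zero (by simpa [Adj] using h'), mul_zero, onStrands_zero_left]
  · rw [if_neg fun h' => h h'.1, ← young_mul_br', ← br_mul_young, mul_assoc, ← mul_assoc (l'.br' m),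
      ← mul_assoc, young_mul_mul_young_of_ne h, onStrands_zero_left]

variable {K : Type} [Group K] [Fintype K] {T : Tower k K}

/-- The relation between the two composites of `d^+` and `d^-`, in a family of degree `d`. -/
theorem evAt_rise_down_add {d : ℤ} (h : Deg T d) (l l' : Part (n + 1)) [Decidable (l' = l)] :
    ∑ q : Part (n + 2), q.hook k • (evAt T).map (rise q l ≫ down q l') +
      ∑ m : Part n, (l.hook k * l'.hook k / m.hook k) • (evAt T).map (down l m ≫ rise l' m) =
    if l' = l then (l.hook k * d) • (evAt T).map (idem k l) else 0 := by
  classical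
  have h1 := congrArg (evAt T).map (casimir_rise_down (k := k) l l')
  have h2 : ∀ m : Part n, (evAt T).map (onStrands (l.br m) (twist (incl n m.tau) l.tau (l.br' m)) ≫ hump k n ≫
        onStrands (l'.br' m) (twist l'.tau (incl n m.tau) (l'.br m))) =
      (evAt T).map (down l m ≫ rise l' m) - (evAt T).map (if l' = l ∧ Adj l m then idem k l else 0) := by
    intro m
    rw [← onStrands_br_br', down, rise, (evAt T).map_comp, (evAt T).map_comp,
      eq_sub_of_add_eq (evAt_hump T n), Preadditive.sub_comp, Preadditive.comp_sub, Category.id_comp,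
      ← (evAt T).map_comp, ← (evAt T).map_comp, ← (evAt T).map_comp]
    simp only [Category.assoc]
  have h3 : (evAt T).map (idem k l ≫ cupMid (n + 1) ≫ capMid (n + 1)) =
      ((d : k) - (n + 1)) • (evAt T).map (idem k l) := by
    rw [(evAt T).map_comp, evAt_cupMid_capMid h, Linear.comp_smul, Category.comp_id, Nat.cast_succ]
  simp only [(evAt T).map_sum, (evAt T).map_sub, (evAt T).map_smul, h2, smul_sub, Finset.sum_sub_distrib] at h1
  rw [h1]
  by_cases e : l' = l
  · subst e
    simp only [if_true, true_and, (evAt T).map_smul, h3, apply_ite (evAt T).map, (evAt T).map_zero, smul_ite,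
      smul_zero]
    rw [← Finset.sum_filter, ← Finset.sum_smul]
    have h4 : ∑ m : Part n with Adj l' m, l'.hook k * l'.hook k / m.hook k = l'.hook k * (n + 1) := by
      rw [← sum_hook, Finset.mul_sum]
      exact Finset.sum_congr (by congr) fun m _ => mul_div_assoc _ _ _
    rw [h4]
    module
  · simp only [if_neg e, e, false_and, if_false, (evAt T).map_zero, smul_zero, Finset.sum_const_zero]
    abel

theorem evAt_rise_down_zero {d : ℤ} (h : Deg T d) (l l' : Part 0) :
    ∑ q : Part 1, q.hook k • (evAt T).map (rise q l ≫ down q l') = (d : k) • (evAt T).map (idem k l) := by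
  have h1 := congrArg (evAt T).map (casimir_rise_down_zero (k := k) l l')
  simp only [(evAt T).map_sum, (evAt T).map_smul] at h1
  rw [h1, (evAt T).map_comp, evAt_cupMid_capMid h, Linear.comp_smul, Category.comp_id, Nat.cast_zero, sub_zero]

theorem evAt_down_rise (h : Deg T (n + 1)) {l : Part (n + 1)} {m : Part n} (hl : Adj l m) :
    (evAt T).map (down l m ≫ rise l m) = (evAt T).map (idem k l) := by
  classical
  have h1 := onStrands_br_br' (k := k) l l m
  rw [if_pos ⟨rfl, hl⟩] at h1
  rw [← h1, down, rise, Category.assoc, ← Category.assoc (capMid n), (evAt T).map_comp, (evAt T).map_comp,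
    evAt_capMid_cupMid h, Category.id_comp, (evAt T).map_comp]

end

end Heis

namespace Heis

noncomputable section

open Heis.Part

theorem biproduct_matrix_comp {C : Type*} [Category C] [Preadditive C] [HasFiniteBiproducts C]
    {I J L : Type} [Finite I] [Fintype J] [Finite L] {f : I → C} {g : J → C} {h : L → C}
    (A : ∀ i j, f i ⟶ g j) (B : ∀ j l, g j ⟶ h l) :
    biproduct.matrix A ≫ biproduct.matrix B = biproduct.matrix fun i l => ∑ j, A i j ≫ B j l := by
  refine biproduct.hom_ext' _ _ fun i => biproduct.hom_ext _ _ fun l => ?_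
  rw [biproduct.ι_matrix_assoc, Category.assoc, biproduct.matrix_π, biproduct.lift_desc, biproduct.ι_matrix,
    biproduct.lift_π]

theorem biproduct_matrix_injective {C : Type*} [Category C] [Preadditive C] [HasFiniteBiproducts C]
    {I J : Type} [Finite I] [Finite J] {f : I → C} {g : J → C} {A B : ∀ i j, f i ⟶ g j}
    (h : biproduct.matrix A = biproduct.matrix B) (i : I) (j : J) : A i j = B i j := by
  rw [← biproduct.matrix_components A, h, biproduct.matrix_components]

theorem biproduct_matrix_zero {C : Type*} [Category C] [Preadditive C] [HasFiniteBiproducts C]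
    {I J : Type} [Finite I] [Finite J] {f : I → C} {g : J → C} :
    biproduct.matrix (fun i j => (0 : f i ⟶ g j)) = 0 :=
  biproduct.hom_ext' _ _ fun i => biproduct.hom_ext _ _ fun j => by simp

theorem biproduct_matrix_add {C : Type*} [Category C] [Preadditive C] [HasFiniteBiproducts C]
    {I J : Type} [Finite I] [Finite J] {f : I → C} {g : J → C} (A B : ∀ i j, f i ⟶ g j) :
    biproduct.matrix A + biproduct.matrix B = biproduct.matrix fun i j => A i j + B i j :=
  biproduct.hom_ext' _ _ fun i => biproduct.hom_ext _ _ fun j => by simp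

theorem map_biproduct_matrix_eq {C D : Type*} [Category C] [Preadditive C] [HasFiniteBiproducts C]
    [Category D] [Preadditive D] (F : C ⥤ D) [F.Additive]
    {I J : Type} [Fintype I] [Fintype J] {f : I → C} {g : J → C} {A B : ∀ i j, f i ⟶ g j}
    (h : ∀ i j, F.map (A i j) = F.map (B i j)) : F.map (biproduct.matrix A) = F.map (biproduct.matrix B) := by
  have key : ∀ A : ∀ i j, f i ⟶ g j, F.map (biproduct.matrix A) =
      ∑ i, ∑ j, F.map (biproduct.π f i) ≫ F.map (A i j) ≫ F.map (biproduct.ι g j) := fun A => by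
    rw [← Category.id_comp (biproduct.matrix A), ← Category.comp_id (biproduct.matrix A),
      ← biproduct.total (f := f), ← biproduct.total (f := g), Preadditive.sum_comp, F.map_sum]
    refine Finset.sum_congr rfl fun i _ => ?_
    rw [Preadditive.comp_sum, Preadditive.comp_sum, F.map_sum]
    refine Finset.sum_congr rfl fun j _ => ?_
    rw [← F.map_comp, ← F.map_comp, Category.assoc, biproduct.ι_matrix_assoc, biproduct.lift_π_assoc]
  rw [key, key]
  simp only [h]

variable {k : Type u} [Field k] [CharZero k] {n m p : ℕ}

theorem between_f (l : Part n) (l' : Part m) (f : strands k n ⟶ strands k m) :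
    (between l l' f).f = (Mat_.embedding _).map (idem k l ≫ f ≫ idem k l') := by
  rw [Functor.map_comp, Functor.map_comp]; rfl

theorem between_eq_iff {l : Part n} {l' : Part m} {f g : strands k n ⟶ strands k m} :
    between l l' f = between l l' g ↔ idem k l ≫ f ≫ idem k l' = idem k l ≫ g ≫ idem k l' := by
  refine ⟨fun h => (Mat_.embedding (HeisPre k)).map_injective ?_, fun h => Karoubi.hom_ext _ _ ?_⟩
  · exact (between_f l l' f).symm.trans ((congrArg Karoubi.Hom.f h).trans (between_f l l' g))
  · exact (between_f l l' f).trans ((congrArg (Mat_.embedding (HeisPre k)).map h).trans (between_f l l' g).symm)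

theorem idem_idem (l : Part n) : idem k l ≫ idem k l = idem k l := by
  rw [idem, onStrands_comp, young_mul_young, young_mul_young]

theorem between_comp (l : Part n) (l' : Part m) (l'' : Part p) (f : strands k n ⟶ strands k m)
    (g : strands k m ⟶ strands k p) :
    between l l' f ≫ between l' l'' g = between l l'' (f ≫ idem k l' ≫ g) := by
  have h : idem k l ≫ (f ≫ idem k l' ≫ g) ≫ idem k l'' =
      (idem k l ≫ f ≫ idem k l') ≫ idem k l' ≫ g ≫ idem k l'' := by
    simp only [Category.assoc]
    rw [← Category.assoc (idem k l') (idem k l'), idem_idem]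
  refine Karoubi.hom_ext _ _ (Eq.trans ?_ (between_f l l'' _).symm)
  rw [h, Functor.map_comp]
  exact congrArg₂ (· ≫ ·) (between_f l l' f) (between_f l' l'' g)

theorem between_add (l : Part n) (l' : Part m) (f g : strands k n ⟶ strands k m) :
    between l l' (f + g) = between l l' f + between l l' g := by
  refine Karoubi.hom_ext _ _ ((between_f l l' _).trans ?_)
  rw [Preadditive.add_comp, Preadditive.comp_add, Functor.map_add]
  exact (congrArg₂ (· + ·) (between_f l l' f) (between_f l l' g)).symm

theorem between_zero (l : Part n) (l' : Part m) : between (k := k) l l' 0 = 0 := by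
  have := between_add (k := k) l l' 0 0
  rwa [add_zero, left_eq_add] at this

theorem between_sum {ι : Type*} (s : Finset ι) (l : Part n) (l' : Part m) (f : ι → (strands k n ⟶ strands k m)) :
    between l l' (∑ i ∈ s, f i) = ∑ i ∈ s, between l l' (f i) :=
  map_sum (AddMonoidHom.mk' (between l l') (between_add l l')) _ _

theorem between_idem (l : Part n) : between l l (idem k l) = 𝟙 (PQ k l) := by
  refine Karoubi.hom_ext _ _ ((between_f l l _).trans ?_)
  rw [idem_idem, idem_idem]
  rfl

theorem between_split (l : Part (n + 1)) (m : Part n) (c : k) :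
    between l m (c • (onStrands (l.split k m) (l.transpose.split k m.transpose) ≫ capMid n)) =
      between l m ((c * diagSign l.1 m.1) • down l m) := by
  rw [between_eq_iff, Linear.smul_comp, Linear.comp_smul, Category.assoc, ← Category.assoc (onStrands _ _),
    idem_split_capMid, Linear.smul_comp, Linear.comp_smul, down_idem, idem_down, smul_smul, diagSign_eq]

theorem between_merge (l : Part (n + 1)) (m : Part n) (c : k) :
    between m l (c • (cupMid n ≫ onStrands (l.merge k m) (l.transpose.merge k m.transpose))) =
      between m l ((c * diagSign l.1 m.1) • rise l m) := by
  rw [between_eq_iff, Linear.smul_comp, Linear.comp_smul,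
    idem_cupMid_merge, Linear.smul_comp, Linear.comp_smul, rise_idem, idem_rise, smul_smul, diagSign_eq]

theorem dMinus_eq (a : YoungDiagram → YoungDiagram → k) (n : ℕ) : dMinus a n =
    biproduct.matrix fun l m => between l m ((a l.1 m.1 * diagSign l.1 m.1) • down l m) := by
  simp only [dMinus, between_split]
  rfl

theorem dPlus_eq (b : YoungDiagram → YoungDiagram → k) (n : ℕ) : dPlus b n =
    biproduct.matrix fun m l => between m l ((b l.1 m.1 * diagSign l.1 m.1) • rise l m) := by
  simp only [dPlus, between_merge]
  rfl

theorem dMinus_comp_dMinus (a a' : YoungDiagram → YoungDiagram → k) (n : ℕ) : dMinus a (n + 1) ≫ dMinus a' n =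
    biproduct.matrix fun l ν => between l ν (∑ m : Part (n + 1),
      ((a' m.1 ν.1 * diagSign m.1 ν.1) * (a l.1 m.1 * diagSign l.1 m.1)) • (down l m ≫ down m ν)) := by
  rw [dMinus_eq, dMinus_eq]
  refine (biproduct_matrix_comp _ _).trans ?_
  simp only [between_sum, between_comp, Linear.smul_comp, Linear.comp_smul, idem_down, smul_smul]

theorem dPlus_comp_dPlus (b b' : YoungDiagram → YoungDiagram → k) (n : ℕ) : dPlus b n ≫ dPlus b' (n + 1) =
    biproduct.matrix fun ν l => between ν l (∑ m : Part (n + 1),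
      ((b' l.1 m.1 * diagSign l.1 m.1) * (b m.1 ν.1 * diagSign m.1 ν.1)) • (rise m ν ≫ rise l m)) := by
  rw [dPlus_eq, dPlus_eq]
  refine (biproduct_matrix_comp _ _).trans ?_
  simp only [between_sum, between_comp, Linear.smul_comp, Linear.comp_smul, idem_rise, smul_smul]

theorem dMinus_comp_dPlus (a b : YoungDiagram → YoungDiagram → k) (n : ℕ) : dMinus a n ≫ dPlus b n =
    biproduct.matrix fun l l' => between l l' (∑ m : Part n,
      ((b l'.1 m.1 * diagSign l'.1 m.1) * (a l.1 m.1 * diagSign l.1 m.1)) • (down l m ≫ rise l' m)) := by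
  rw [dMinus_eq, dPlus_eq]
  refine (biproduct_matrix_comp _ _).trans ?_
  simp only [between_sum, between_comp, Linear.smul_comp, Linear.comp_smul, idem_rise, smul_smul]

theorem dPlus_comp_dMinus (a b : YoungDiagram → YoungDiagram → k) (n : ℕ) : dPlus b n ≫ dMinus a n =
    biproduct.matrix fun l l' => between l l' (∑ q : Part (n + 1),
      ((a q.1 l'.1 * diagSign q.1 l'.1) * (b q.1 l.1 * diagSign q.1 l.1)) • (rise q l ≫ down q l')) := by
  rw [dPlus_eq, dMinus_eq]
  refine (biproduct_matrix_comp _ _).trans ?_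
  simp only [between_sum, between_comp, Linear.smul_comp, Linear.comp_smul, idem_down, smul_smul]

open Classical in
theorem id_sigma (n : ℕ) : 𝟙 (Sigma k n) =
    biproduct.matrix fun l l' => between l l' (if l' = l then idem k l else 0) := by
  refine biproduct.hom_ext' _ _ fun l => biproduct.hom_ext _ _ fun l' => ?_
  refine Eq.trans ?_ (by rw [biproduct.ι_matrix, biproduct.lift_π] : between l l' (if l' = l then idem k l else 0) =
    (biproduct.ι (PQ k) l ≫ biproduct.matrix fun l l' => between l l' (if l' = l then idem k l else 0)) ≫
      biproduct.π (PQ k) l')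
  refine (congrArg (· ≫ _) (Category.comp_id _)).trans ((biproduct.ι_π _ _ _).trans ?_)
  by_cases h : l = l'
  · subst h
    rw [dif_pos rfl, if_pos rfl, between_idem]
    rfl
  · rw [dif_neg h, if_neg (Ne.symm h), between_zero]

variable {K : Type} [Group K] [Fintype K]

theorem act_map_between_eq (T : Tower k K) (l : Part n) (l' : Part m) {f g : strands k n ⟶ strands k m}
    (h : (evAt T).map f = (evAt T).map g) : (act T).map (between l l' f) = (act T).map (between l l' g) := by
  have h1 : ∀ {X Y : HeisPre k} {f g : X ⟶ Y}, (evAt T).map f = (evAt T).map g →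
      (Mat_.lift (evAt T)).map ((Mat_.embedding _).map f) =
        (Mat_.lift (evAt T)).map ((Mat_.embedding _).map g) := fun {X Y f g} h => by
    rw [← cancel_mono ((Mat_.embeddingLiftIso (evAt T)).hom.app Y)]
    refine ((Mat_.embeddingLiftIso (evAt T)).hom.naturality f).trans
      (Eq.trans ?_ ((Mat_.embeddingLiftIso (evAt T)).hom.naturality g).symm)
    rw [h]
  have h2 : (Mat_.lift (evAt T)).map (between l l' f).f = (Mat_.lift (evAt T)).map (between l l' g).f := by
    refine (congrArg (Mat_.lift (evAt T)).map (between_f l l' f)).trans ((h1 ?_).trans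
      (congrArg (Mat_.lift (evAt T)).map (between_f l l' g)).symm)
    simp only [(evAt T).map_comp, h]
  let F := (functorExtension₂ (Mat_ (HeisPre k)) (Tower k K)).obj (Mat_.lift (evAt T))
  have h3 : F.map (between l l' f) = F.map (between l l' g) := Karoubi.hom_ext _ _ h2
  exact congrArg (toKaroubiEquivalence (Tower k K)).inverse.map h3

end

end Heis

namespace Heis

noncomputable section

namespace Part

variable {n : ℕ}

theorem ext_cells {l l' : Part n} (h : l.1.cells = l'.1.cells) : l = l' := Subtype.ext (YoungDiagram.ext h)

theorem card_cells (l : Part n) : l.1.cells.card = n := l.2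

theorem card_union {m m' : Part n} (h : m ≠ m') : n + 1 ≤ (m.1.cells ∪ m'.1.cells).card := by
  by_contra hlt
  have h1 : m.1.cells = m.1.cells ∪ m'.1.cells :=
    Finset.eq_of_subset_of_card_le Finset.subset_union_left (by rw [card_cells]; omega)
  have h2 : m'.1.cells = m.1.cells ∪ m'.1.cells :=
    Finset.eq_of_subset_of_card_le Finset.subset_union_right (by rw [card_cells]; omega)
  exact h (ext_cells (h1.trans h2.symm))

theorem card_inter {m m' : Part (n + 1)} (h : m ≠ m') : (m.1.cells ∩ m'.1.cells).card ≤ n := by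
  have h1 := card_union h
  have h2 := Finset.card_union_add_card_inter m.1.cells m'.1.cells
  rw [card_cells, card_cells] at h2
  omega

variable {l q : Part (n + 2)} {m m' m'' : Part (n + 1)} {ν ν' : Part n}

theorem cells_eq_union {n : ℕ} {l : Part (n + 1)} {m m' : Part n} (h : m ≠ m') (h1 : Adj l m) (h2 : Adj l m') :
    m.1.cells ∪ m'.1.cells = l.1.cells :=
  Finset.eq_of_subset_of_card_le (Finset.union_subset (adj_iff.1 h1) (adj_iff.1 h2))
    (by rw [card_cells]; exact card_union h)

theorem cells_eq_inter (h : m ≠ m') (h1 : Adj m ν) (h2 : Adj m' ν) : ν.1.cells = m.1.cells ∩ m'.1.cells :=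
  Finset.eq_of_subset_of_card_le (Finset.subset_inter (adj_iff.1 h1) (adj_iff.1 h2))
    (by rw [card_cells]; exact card_inter h)

theorem eq_of_adj_union (h : m ≠ m') (h1 : Adj l m) (h2 : Adj l m') (h3 : Adj q m) (h4 : Adj q m') : q = l :=
  ext_cells ((cells_eq_union h h3 h4).symm.trans (cells_eq_union h h1 h2))

theorem eq_of_adj_inter (h : m ≠ m') (h1 : Adj m ν) (h2 : Adj m' ν) (h3 : Adj m ν') (h4 : Adj m' ν') : ν' = ν :=
  ext_cells ((cells_eq_inter h h3 h4).trans (cells_eq_inter h h1 h2).symm)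

theorem eq_or_eq_of_adj (h : m ≠ m') (h1 : Adj l m) (h2 : Adj l m') (h3 : Adj m ν) (h4 : Adj m' ν)
    (h5 : Adj l m'') (h6 : Adj m'' ν) : m'' = m ∨ m'' = m' := by
  by_contra hne
  rw [not_or] at hne
  have h7 : m''.1.cells = ν.1.cells := by
    rw [← Finset.inter_eq_left.2 (adj_iff.1 h5), ← cells_eq_union h h1 h2, Finset.inter_union_distrib_left,
      ← cells_eq_inter hne.1 h6 h3, ← cells_eq_inter hne.2 h6 h4, Finset.union_self]
  have := congrArg Finset.card h7
  rw [card_cells, card_cells] at this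
  omega

theorem exists_adj_inter (h : m ≠ m') (h1 : Adj l m) (h2 : Adj l m') : ∃ ν : Part n, Adj m ν ∧ Adj m' ν := by
  have h3 : (m.1.cells ∩ m'.1.cells).card = n := by
    have h3 := Finset.card_union_add_card_inter m.1.cells m'.1.cells
    rw [cells_eq_union h h1 h2, card_cells, card_cells, card_cells] at h3
    omega
  exact ⟨⟨m.1 ⊓ m'.1, h3⟩, adj_iff.2 Finset.inter_subset_left, adj_iff.2 Finset.inter_subset_right⟩

/-- A function on partitions, as a function on Young diagrams. -/
def onDiagrams {α : Type*} (f : ∀ n, Part n → α) (Y : YoungDiagram) : α := f Y.card ⟨Y, rfl⟩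

theorem onDiagrams_eq {α : Type*} (f : ∀ n, Part n → α) (l : Part n) : onDiagrams f l.1 = f n l := by
  obtain ⟨Y, rfl⟩ := l; rfl

variable {k : Type u} [Field k]

/-- A potential of a family of scalars on the edges of Young's lattice: the product of the scalars along a
descending path. -/
def potential (r : YoungDiagram → YoungDiagram → k) : ∀ n, Part n → k
  | 0, _ => 1
  | n + 1, l => r l.1 l.exists_removal.choose.1 * potential r n l.exists_removal.choose

theorem potential_ne_zero {r : YoungDiagram → YoungDiagram → k} (hr : ∀ l m, r l m ≠ 0) :
    ∀ (n : ℕ) (l : Part n), potential r n l ≠ 0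
  | 0, _ => one_ne_zero
  | n + 1, l => mul_ne_zero (hr _ _) (potential_ne_zero hr n _)

theorem potential_eq {r : YoungDiagram → YoungDiagram → k}
    (h : ∀ {n : ℕ} {l : Part (n + 2)} {m m' : Part (n + 1)} {ν : Part n}, m ≠ m' → Adj l m → Adj l m' → Adj m ν →
      Adj m' ν → r l.1 m.1 * r m.1 ν.1 = r l.1 m'.1 * r m'.1 ν.1) :
    ∀ {n : ℕ} {l : Part (n + 1)} {m : Part n}, Adj l m → potential r (n + 1) l = r l.1 m.1 * potential r n m
  | 0, l, m, _ => by
    change r l.1 l.exists_removal.choose.1 * 1 = r l.1 m.1 * 1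
    rw [Subsingleton.elim l.exists_removal.choose m]
  | n + 1, l, m, hm => by
    rw [potential]
    have h0 := l.exists_removal.choose_spec
    generalize l.exists_removal.choose = m0 at h0 ⊢
    by_cases e : m0 = m
    · rw [e]
    · obtain ⟨ν, h1, h2⟩ := exists_adj_inter e h0 hm
      rw [potential_eq h h1, potential_eq h h2, ← mul_assoc, ← mul_assoc, h e h0 hm h1 h2]

end Part

open Heis.Part

variable {k : Type u} [Field k] [CharZero k] {n : ℕ}

section

variable {l : Part (n + 2)} {m m' : Part (n + 1)} {ν : Part n}

theorem evAt_down_ne_zero {l : Part (n + 1)} {m : Part n} (h : Adj l m) :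
    (evAt (regular k (n + 1))).map (down l m) ≠ 0 := fun h0 => by
  have h1 := evAt_down_rise (deg_regular (k := k) (n + 1)) h
  rw [(evAt _).map_comp, h0, zero_comp] at h1
  exact evAt_idem_ne_zero l h1.symm

theorem evAt_rise_ne_zero {l : Part (n + 1)} {m : Part n} (h : Adj l m) :
    (evAt (regular k (n + 1))).map (rise l m) ≠ 0 := fun h0 => by
  have h1 := evAt_down_rise (deg_regular (k := k) (n + 1)) h
  rw [(evAt _).map_comp, h0, comp_zero] at h1
  exact evAt_idem_ne_zero l h1.symm

theorem evAt_square (h : m ≠ m') (h1 : Adj l m) (h2 : Adj l m') (h3 : Adj m ν) (h4 : Adj m' ν)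
    {K : Type} [Group K] [Fintype K] {T : Tower k K} {d : ℤ} (hT : Deg T d) :
    l.hook k • (evAt T).map (rise l m ≫ down l m') +
      (m.hook k * m'.hook k / ν.hook k) • (evAt T).map (down m ν ≫ rise m' ν) = 0 := by
  classical
  have h5 := evAt_rise_down_add hT m m'
  rw [if_neg (Ne.symm h), Finset.sum_eq_single l, Finset.sum_eq_single ν] at h5
  · exact h5
  · intro ν' _ hne
    by_cases h6 : Adj m ν'
    · rw [rise_eq_zero fun h7 => hne (eq_of_adj_inter h h3 h4 h6 h7), comp_zero, (evAt T).map_zero, smul_zero]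
    · rw [down_eq_zero h6, zero_comp, (evAt T).map_zero, smul_zero]
  · exact fun h => (h (Finset.mem_univ _)).elim
  · intro q _ hne
    by_cases h6 : Adj q m
    · rw [down_eq_zero fun h7 => hne (eq_of_adj_union h h1 h2 h6 h7), comp_zero, (evAt T).map_zero, smul_zero]
    · rw [rise_eq_zero h6, zero_comp, (evAt T).map_zero, smul_zero]
  · exact fun h => (h (Finset.mem_univ _)).elim

theorem down_down_ne_zero (h : m ≠ m') (h1 : Adj l m) (h2 : Adj l m') (h3 : Adj m ν) (h4 : Adj m' ν) :
    down (k := k) l m ≫ down m ν ≠ 0 := fun h0 => by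
  have h5 := congrArg ((evAt (regular k (n + 2))).map (down l m) ≫ ·)
    (evAt_square h h1 h2 h3 h4 (deg_regular (k := k) (n + 2)))
  simp only [Preadditive.comp_add, Linear.comp_smul, comp_zero, ← (evAt (regular k (n + 2))).map_comp,
    ← Category.assoc] at h5
  rw [h0, zero_comp, (evAt _).map_zero, smul_zero, add_zero, (evAt _).map_comp,
    evAt_down_rise (deg_regular (k := k) (n + 2)) h1, ← (evAt _).map_comp, idem_down] at h5
  exact evAt_down_ne_zero h2 ((smul_eq_zero_iff_right l.hook_ne_zero).1 h5)

theorem rise_rise_ne_zero (h : m ≠ m') (h1 : Adj l m) (h2 : Adj l m') (h3 : Adj m ν) (h4 : Adj m' ν) :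
    rise (k := k) m ν ≫ rise l m ≠ 0 := fun h0 => by
  have h5 := congrArg (· ≫ (evAt (regular k (n + 2))).map (rise l m))
    (evAt_square h.symm h2 h1 h4 h3 (deg_regular (k := k) (n + 2)))
  simp only [Preadditive.add_comp, Linear.smul_comp, zero_comp, ← (evAt (regular k (n + 2))).map_comp,
    Category.assoc] at h5
  rw [h0, comp_zero, (evAt _).map_zero, smul_zero, add_zero, (evAt _).map_comp,
    evAt_down_rise (deg_regular (k := k) (n + 2)) h1, ← (evAt _).map_comp, rise_idem] at h5
  exact evAt_rise_ne_zero h2 ((smul_eq_zero_iff_right l.hook_ne_zero).1 h5)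

omit [CharZero k] in
theorem eq_of_smul_add {V : Type*} [AddCommGroup V] [Module k V] {v v' : V} {c c' : k} (hv : v ≠ 0)
    (h1 : v + v' = 0) (h2 : c • v + c' • v' = 0) : c = c' := by
  rw [eq_neg_of_add_eq_zero_right h1, smul_neg, ← sub_eq_add_neg, ← sub_smul] at h2
  exact sub_eq_zero.1 ((smul_eq_zero_iff_left hv).1 h2)

theorem sum_eq_add_of_adj {V : Type*} [AddCommGroup V] {f : Part (n + 1) → V} (h : m ≠ m') (h1 : Adj l m)
    (h2 : Adj l m') (h3 : Adj m ν) (h4 : Adj m' ν) (h5 : ∀ q, ¬ (Adj l q ∧ Adj q ν) → f q = 0) :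
    ∑ q, f q = f m + f m' :=
  Fintype.sum_eq_add m m' h fun q hq => h5 q fun h6 =>
    (eq_or_eq_of_adj h h1 h2 h3 h4 h6.1 h6.2).elim hq.1 hq.2

theorem square_of_dMinus {a : YoungDiagram → YoungDiagram → k} (ha : ∀ n, dMinus a (n + 1) ≫ dMinus a n = 0)
    (h : m ≠ m') (h1 : Adj l m) (h2 : Adj l m') (h3 : Adj m ν) (h4 : Adj m' ν) :
    (a l.1 m.1 * diagSign l.1 m.1) * (a m.1 ν.1 * diagSign m.1 ν.1) =
      (a l.1 m'.1 * diagSign l.1 m'.1) * (a m'.1 ν.1 * diagSign m'.1 ν.1) := by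
  have e0 := sum_down_down (k := k) l ν
  have e1 := biproduct_matrix_injective (((dMinus_comp_dMinus a a n).symm.trans (ha n)).trans
    biproduct_matrix_zero.symm) l ν
  replace e1 := e1.trans (between_zero l ν).symm
  rw [between_eq_iff] at e1
  simp only [Preadditive.sum_comp, Preadditive.comp_sum, Linear.smul_comp, Linear.comp_smul, Category.assoc,
    down_idem, zero_comp, comp_zero] at e1
  simp only [← Category.assoc, idem_down] at e1
  have hz : ∀ q, ¬ (Adj l q ∧ Adj q ν) → down (k := k) l q ≫ down q ν = 0 := fun q hq => by
    by_cases h5 : Adj l q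
    · rw [down_eq_zero fun h6 => hq ⟨h5, h6⟩, comp_zero]
    · rw [down_eq_zero h5, zero_comp]
  rw [sum_eq_add_of_adj h h1 h2 h3 h4 hz] at e0
  rw [sum_eq_add_of_adj h h1 h2 h3 h4 fun q hq => by rw [hz q hq, smul_zero]] at e1
  rw [mul_comm, eq_of_smul_add (down_down_ne_zero h h1 h2 h3 h4) e0 e1, mul_comm]

theorem square_of_dPlus {b : YoungDiagram → YoungDiagram → k} (hb : ∀ n, dPlus b n ≫ dPlus b (n + 1) = 0)
    (h : m ≠ m') (h1 : Adj l m) (h2 : Adj l m') (h3 : Adj m ν) (h4 : Adj m' ν) :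
    (b l.1 m.1 * diagSign l.1 m.1) * (b m.1 ν.1 * diagSign m.1 ν.1) =
      (b l.1 m'.1 * diagSign l.1 m'.1) * (b m'.1 ν.1 * diagSign m'.1 ν.1) := by
  have e0 := sum_rise_rise (k := k) l ν
  have e1 := biproduct_matrix_injective (((dPlus_comp_dPlus b b n).symm.trans (hb n)).trans
    biproduct_matrix_zero.symm) ν l
  replace e1 := e1.trans (between_zero ν l).symm
  rw [between_eq_iff] at e1
  simp only [Preadditive.sum_comp, Preadditive.comp_sum, Linear.smul_comp, Linear.comp_smul, Category.assoc,
    rise_idem, zero_comp, comp_zero] at e1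
  simp only [← Category.assoc, idem_rise] at e1
  have hz : ∀ q, ¬ (Adj l q ∧ Adj q ν) → rise (k := k) q ν ≫ rise l q = 0 := fun q hq => by
    by_cases h5 : Adj l q
    · rw [rise_eq_zero fun h6 => hq ⟨h5, h6⟩, zero_comp]
    · rw [rise_eq_zero h5, comp_zero]
  rw [sum_eq_add_of_adj h h1 h2 h3 h4 hz] at e0
  rw [sum_eq_add_of_adj h h1 h2 h3 h4 fun q hq => by rw [hz q hq, smul_zero]] at e1
  exact eq_of_smul_add (rise_rise_ne_zero h h1 h2 h3 h4) e0 e1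

end

theorem dMinus_diagSign (n : ℕ) : dMinus (k := k) diagSign (n + 1) ≫ dMinus diagSign n = 0 := by
  refine (dMinus_comp_dMinus _ _ n).trans (Eq.trans ?_ biproduct_matrix_zero)
  refine congrArg biproduct.matrix (funext fun l => funext fun ν => ?_)
  refine Eq.trans (congrArg (between l ν) ?_) (between_zero l ν)
  simp only [diagSign_eq, boxSign_mul_self, one_mul, one_smul]
  exact sum_down_down l ν

theorem dPlus_diagSign (n : ℕ) : dPlus (k := k) diagSign n ≫ dPlus diagSign (n + 1) = 0 := by
  refine (dPlus_comp_dPlus _ _ n).trans (Eq.trans ?_ biproduct_matrix_zero)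
  refine congrArg biproduct.matrix (funext fun ν => funext fun l => ?_)
  refine Eq.trans (congrArg (between ν l) ?_) (between_zero ν l)
  simp only [diagSign_eq, boxSign_mul_self, one_mul, one_smul]
  exact sum_rise_rise l ν

omit [CharZero k] in
theorem exists_potential {r : YoungDiagram → YoungDiagram → k} (hr : ∀ l m, r l m ≠ 0)
    (h : ∀ {n : ℕ} {l : Part (n + 2)} {m m' : Part (n + 1)} {ν : Part n}, m ≠ m' → Adj l m → Adj l m' → Adj m ν →
      Adj m' ν → r l.1 m.1 * r m.1 ν.1 = r l.1 m'.1 * r m'.1 ν.1) :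
    ∃ f : ∀ n, Part n → k, (∀ n l, f n l ≠ 0) ∧ ∀ {n : ℕ} {l : Part (n + 1)} {m : Part n}, Adj l m →
      r l.1 m.1 = f (n + 1) l / f n m :=
  ⟨potential r, potential_ne_zero hr, fun {n l m} hm => by
    rw [potential_eq h hm, mul_div_cancel_right₀ _ (potential_ne_zero hr n m)]⟩

section

variable {a b : YoungDiagram → YoungDiagram → k} {f : ∀ n, Part n → k} (hf : ∀ n l, f n l ≠ 0) {d : ℕ} (hd : d ≠ 0)
  (ha : ∀ {n : ℕ} {l : Part (n + 1)} {m : Part n}, Adj l m → a l.1 m.1 * diagSign l.1 m.1 = f (n + 1) l / f n m)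
  (hb : ∀ {n : ℕ} {l : Part (n + 1)} {m : Part n}, Adj l m → b l.1 m.1 * diagSign l.1 m.1 =
    l.hook k / m.hook k * (f n m / f (n + 1) l) / d)
  {K : Type} [Group K] [Fintype K] {T : Tower k K} (hT : Deg T d)

include hf ha hb

theorem smul_rise_down (l l' : Part n) (q : Part (n + 1)) :
    ((a q.1 l'.1 * diagSign q.1 l'.1) * (b q.1 l.1 * diagSign q.1 l.1)) •
        (rise q l ≫ down q l' : strands k n ⟶ strands k n) =
      (f n l / (l.hook k * f n l' * d)) • q.hook k • (rise q l ≫ down q l') := by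
  by_cases h1 : Adj q l
  · by_cases h2 : Adj q l'
    · rw [ha h2, hb h1, smul_smul]
      congr 1
      have := hf _ q
      have := hf _ l
      have := hf _ l'
      have := l.hook_ne_zero (k := k)
      field_simp
    · rw [down_eq_zero h2, comp_zero, smul_zero, smul_zero, smul_zero]
  · rw [rise_eq_zero h1, zero_comp, smul_zero, smul_zero, smul_zero]

theorem smul_down_rise (l l' : Part (n + 1)) (m : Part n) :
    ((b l'.1 m.1 * diagSign l'.1 m.1) * (a l.1 m.1 * diagSign l.1 m.1)) •
        (down l m ≫ rise l' m : strands k (n + 1) ⟶ strands k (n + 1)) =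
      (f (n + 1) l / (l.hook k * f (n + 1) l' * d)) • (l.hook k * l'.hook k / m.hook k) • (down l m ≫ rise l' m) := by
  by_cases h1 : Adj l m
  · by_cases h2 : Adj l' m
    · rw [ha h1, hb h2, smul_smul]
      congr 1
      have := hf _ m
      have := hf _ l
      have := hf _ l'
      have := l.hook_ne_zero (k := k)
      have := m.hook_ne_zero (k := k)
      field_simp
    · rw [rise_eq_zero h2, comp_zero, smul_zero, smul_zero, smul_zero]
  · rw [down_eq_zero h1, zero_comp, smul_zero, smul_zero, smul_zero]

include hd hT

theorem act_map_dPlus_dMinus : (act T).map (dPlus b 0 ≫ dMinus a 0) = 𝟙 _ := by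
  classical
  rw [← (act T).map_id, id_sigma, dPlus_comp_dMinus]
  refine map_biproduct_matrix_eq (act T) fun l l' => act_map_between_eq T l l' ?_
  obtain rfl := Subsingleton.elim l l'
  have h1 := evAt_rise_down_zero hT l l
  have h2 : (d : k) ≠ 0 := Nat.cast_ne_zero.2 hd
  simp only [smul_rise_down hf ha hb, ← Finset.smul_sum]
  rw [if_pos trivial, (evAt T).map_smul, (evAt T).map_sum]
  simp only [(evAt T).map_smul]
  rw [h1, smul_smul, Int.cast_natCast, hook_zero, one_mul, div_mul_eq_div_div, div_self (hf 0 l),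
    one_div_mul_cancel h2, one_smul]

theorem act_map_dMinus_dPlus_add (n : ℕ) :
    (act T).map (dMinus a n ≫ dPlus b n + dPlus b (n + 1) ≫ dMinus a (n + 1)) = 𝟙 _ := by
  classical
  rw [← (act T).map_id, id_sigma, dPlus_comp_dMinus, dMinus_comp_dPlus]
  refine (congrArg (act T).map (biproduct_matrix_add _ _)).trans ?_
  refine map_biproduct_matrix_eq (act T) fun l l' => ?_
  refine (congrArg (act T).map (between_add _ _ _ _).symm).trans (act_map_between_eq T l l' ?_)
  have h1 := (add_comm _ _).trans (evAt_rise_down_add hT l l')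
  have h2 : (d : k) ≠ 0 := Nat.cast_ne_zero.2 hd
  have h3 := l.hook_ne_zero (k := k)
  simp only [smul_rise_down hf ha hb, smul_down_rise hf ha hb, ← Finset.smul_sum]
  rw [← smul_add, (evAt T).map_smul, (evAt T).map_add, (evAt T).map_sum, (evAt T).map_sum]
  simp only [(evAt T).map_smul]
  rw [h1]
  split_ifs with h
  · subst h
    rw [smul_smul, Int.cast_natCast]
    have h4 := hf _ l'
    have : f (n + 1) l' / (l'.hook k * f (n + 1) l' * d) * (l'.hook k * d) = 1 := by field_simp
    rw [this, one_smul]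
  · rw [smul_zero, (evAt T).map_zero]

end

end

end Heis

namespace Heis

noncomputable section

open HeisPre Heis.Part

section

variable {C D : Type*} [Category C] [Category D] [Preadditive C] [Preadditive D] [HasZeroObject C]
  {ι ι' : Type*} {c : ComplexShape ι} {c' : ComplexShape ι'}

theorem map_extend_contractible (F : C ⥤ D) [F.Additive] {K : HomologicalComplex C c} (e : c.Embedding c')
    [e.IsRelIff] (h : ∀ i j, K.X i ⟶ K.X j) (hz : ∀ i j, ¬ c.Rel j i → h i j = 0)
    (hF : ∀ i, F.map ((Homotopy.nullHomotopicMap h).f i) = 𝟙 _) :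
    Nonempty (Homotopy (𝟙 ((F.mapHomologicalComplex c').obj (K.extend e))) 0) := by
  have H := F.mapHomotopy ((Homotopy.nullHomotopy h hz).extend e)
  rw [HomologicalComplex.extendMap_zero, Functor.map_zero] at H
  refine ⟨(Homotopy.ofEq (HomologicalComplex.hom_ext _ _ fun i' => ?_)).trans H⟩
  rw [HomologicalComplex.id_f, Functor.mapHomologicalComplex_map_f]
  by_cases hi : ∃ i, e.f i = i'
  · obtain ⟨i, rfl⟩ := hi
    rw [HomologicalComplex.extendMap_f _ _ rfl, F.map_comp, F.map_comp, hF, Category.id_comp, ← F.map_comp,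
      Iso.hom_inv_id, F.map_id]
    rfl
  · exact (F.map_isZero (HomologicalComplex.isZero_extend_X _ _ _ (by tauto))).eq_of_src _ _

theorem homotopyEquiv_of_contractible {K L : HomologicalComplex D c} (hK : Nonempty (Homotopy (𝟙 K) 0))
    (hL : Nonempty (Homotopy (𝟙 L) 0)) : Nonempty (HomotopyEquiv K L) := by
  obtain ⟨hK⟩ := hK
  obtain ⟨hL⟩ := hL
  exact ⟨{ hom := 0, inv := 0
           homotopyHomInvId := (Homotopy.ofEq zero_comp).trans hK.symm
           homotopyInvHomId := (Homotopy.ofEq zero_comp).trans hL.symm }⟩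

theorem isZero_map_extend (F : C ⥤ D) [F.Additive] {K : HomologicalComplex C c} (e : c.Embedding c') {i₀ : ι}
    (hK : ∀ i, i ≠ i₀ → IsZero (F.obj (K.X i))) (i' : ι') (h : i' ≠ e.f i₀) :
    IsZero (((F.mapHomologicalComplex c').obj (K.extend e)).X i') := by
  by_cases hi : ∃ i, e.f i = i'
  · obtain ⟨i, rfl⟩ := hi
    exact (hK i fun hi => h (by rw [hi])).of_iso (F.mapIso (K.extendXIso e rfl))
  · exact F.map_isZero (HomologicalComplex.isZero_extend_X _ _ _ (by tauto))

theorem iso_of_concentrated {K L : HomologicalComplex D c} {i₀ : ι} (h₀ : ¬ c.Rel i₀ i₀)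
    (hK : ∀ i, i ≠ i₀ → IsZero (K.X i)) (hL : ∀ i, i ≠ i₀ → IsZero (L.X i)) (φ : K.X i₀ ≅ L.X i₀) :
    Nonempty (K ≅ L) := by
  classical
  refine ⟨HomologicalComplex.Hom.isoOfComponents
    (fun i => if h : i = i₀ then h ▸ φ else (hK i h).iso (hL i h)) fun i j hij => ?_⟩
  by_cases hi : i = i₀
  · exact (hL j fun hj => h₀ (by rwa [hi, hj] at hij)).eq_of_tgt _ _
  · exact (hK i hi).eq_of_src _ _

end

variable {k : Type u} [Field k] [CharZero k]

theorem evAt_id_strands_eq_zero {K : Type} [Group K] [Fintype K] {T : Tower k K} (h : Deg T 0) (n : ℕ) :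
    (evAt T).map (𝟙 (strands k (n + 1))) = 0 := by
  have h1 := h.powL (n + 1)
  have h2 : 𝟙 ((evO k K (powL (Q (k := k)) (n + 1)).ob).obj T) = 0 := tower_ext fun m x => by
    have := h1 m (by push_cast; omega)
    exact Subsingleton.elim _ _
  have h3 := congrArg (evO k K (powR (P (k := k)) (n + 1)).ob).map h2
  rw [Functor.map_zero] at h3
  exact ((evAt T).map_id _).trans (((evO k K (powR (P (k := k)) (n + 1)).ob).map_id _).symm.trans h3)

theorem isZero_toHn_sigma (n : ℕ) (hn : n ≠ 0) : IsZero ((toHn k 0).obj (Sigma k n)) := by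
  obtain ⟨n, rfl⟩ := Nat.exists_eq_succ_of_ne_zero hn
  classical
  rw [IsZero.iff_id_eq_zero, ← (toHn k 0).map_id, id_sigma]
  have h : (toHn k 0).map (biproduct.matrix fun (l l' : Part (n + 1)) => between (k := k) l l' 0) = 0 := by
    simp only [between_zero]
    rw [biproduct_matrix_zero, Functor.map_zero]
  refine (map_biproduct_matrix_eq (toHn k 0) fun l l' => act_map_between_eq (regular k 0) l l' ?_).trans h
  rw [← Category.id_comp (if l' = l then idem k l else 0), (evAt _).map_comp,
    evAt_id_strands_eq_zero (deg_regular (k := k) 0), zero_comp, (evAt _).map_zero]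

variable {a b : YoungDiagram → YoungDiagram → k}

theorem sigmaMinus_contractible (ha : ∀ n, dMinus a (n + 1) ≫ dMinus a n = 0) {n : ℕ}
    (h0 : (toHn k n).map (dPlus b 0 ≫ dMinus a 0) = 𝟙 _)
    (h1 : ∀ m, (toHn k n).map (dMinus a m ≫ dPlus b m + dPlus b (m + 1) ≫ dMinus a (m + 1)) = 𝟙 _) :
    Nonempty (Homotopy (𝟙 (((toHn k n).mapHomologicalComplex (ComplexShape.up ℤ)).obj (sigmaMinus a ha))) 0) := by
  refine map_extend_contractible (toHn k n) _ (fun i j => CochainComplex.of.d (Sigma k) (dPlus b) i j)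
    (fun i j hij => dif_neg hij) fun i => ?_
  obtain _ | i := i
  · rw [Homotopy.nullHomotopicMap_f_of_not_rel_left (k₁ := 1) (k₀ := 0) (zero_add 1) (fun l => Nat.succ_ne_zero l)]
    simpa [CochainComplex.of.d, ChainComplex.of.d] using h0
  · rw [Homotopy.nullHomotopicMap_f (k₂ := i + 2) (k₁ := i + 1) (k₀ := i) rfl rfl]
    simpa [CochainComplex.of.d, ChainComplex.of.d] using h1 i

theorem sigmaPlus_contractible (hb : ∀ n, dPlus b n ≫ dPlus b (n + 1) = 0) {n : ℕ}
    (h0 : (toHn k n).map (dPlus b 0 ≫ dMinus a 0) = 𝟙 _)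
    (h1 : ∀ m, (toHn k n).map (dMinus a m ≫ dPlus b m + dPlus b (m + 1) ≫ dMinus a (m + 1)) = 𝟙 _) :
    Nonempty (Homotopy (𝟙 (((toHn k n).mapHomologicalComplex (ComplexShape.up ℤ)).obj (sigmaPlus b hb))) 0) := by
  refine map_extend_contractible (toHn k n) _ (fun i j => ChainComplex.of.d (Sigma k) (dMinus a) i j)
    (fun i j hij => dif_neg fun h => hij h.symm) fun i => ?_
  obtain _ | i := i
  · rw [Homotopy.nullHomotopicMap_f_of_not_rel_right (k₁ := 0) (k₀ := 1) (zero_add 1) (fun l => Nat.succ_ne_zero l)]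
    simpa [CochainComplex.of.d, ChainComplex.of.d] using h0
  · rw [Homotopy.nullHomotopicMap_f (k₂ := i) (k₁ := i + 1) (k₀ := i + 2) rfl rfl]
    refine (congrArg _ (add_comm _ _)).trans ?_
    simpa [CochainComplex.of.d, ChainComplex.of.d] using h1 i

theorem homotopyEquiv_zero (ha : ∀ n, dMinus a (n + 1) ≫ dMinus a n = 0)
    (hb : ∀ n, dPlus b n ≫ dPlus b (n + 1) = 0) : Nonempty (HomotopyEquiv
      (((toHn k 0).mapHomologicalComplex (ComplexShape.up ℤ)).obj (sigmaPlus b hb))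
      (((toHn k 0).mapHomologicalComplex (ComplexShape.up ℤ)).obj (sigmaMinus a ha))) := by
  obtain ⟨φ⟩ := iso_of_concentrated (c := ComplexShape.up ℤ) (i₀ := 0) (fun h => absurd h (by simp))
    (isZero_map_extend (toHn k 0) (K := CochainComplex.of (Sigma k) (dPlus b) hb) ComplexShape.embeddingUpNat
      (i₀ := 0) isZero_toHn_sigma)
    (isZero_map_extend (toHn k 0) (K := ChainComplex.of (Sigma k) (dMinus a) ha) ComplexShape.embeddingDownNat
      (i₀ := 0) isZero_toHn_sigma)
    ((toHn k 0).mapIso (HomologicalComplex.extendXIso _ ComplexShape.embeddingUpNat (i := 0) rfl ≪≫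
      (HomologicalComplex.extendXIso (ChainComplex.of (Sigma k) (dMinus a) ha) ComplexShape.embeddingDownNat
        (i := 0) rfl).symm))
  exact ⟨HomotopyEquiv.ofIso φ⟩

theorem exists_dPlus (ha0 : ∀ l m, a l m ≠ 0) (ha : ∀ n, dMinus a (n + 1) ≫ dMinus a n = 0) {d : ℕ} (hd : d ≠ 0) :
    ∃ b : YoungDiagram → YoungDiagram → k, (toHn k d).map (dPlus b 0 ≫ dMinus a 0) = 𝟙 _ ∧
      ∀ m, (toHn k d).map (dMinus a m ≫ dPlus b m + dPlus b (m + 1) ≫ dMinus a (m + 1)) = 𝟙 _ := by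
  obtain ⟨f, hf, hr⟩ := exists_potential (r := fun l m => a l m * diagSign l m)
    (fun l m => mul_ne_zero (ha0 l m) (diagSign_ne_zero l m)) (square_of_dMinus ha)
  let b : YoungDiagram → YoungDiagram → k := fun l m =>
    onDiagrams (fun _ => hook k) l / onDiagrams (fun _ => hook k) m *
      (onDiagrams f m / onDiagrams f l) / d * (diagSign l m)⁻¹
  have hb : ∀ {n : ℕ} {l : Part (n + 1)} {m : Part n}, Adj l m → b l.1 m.1 * diagSign l.1 m.1 =
      l.hook k / m.hook k * (f n m / f (n + 1) l) / d := fun {n l m} _ => by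
    simp only [b, onDiagrams_eq]
    rw [inv_mul_cancel_right₀ (diagSign_ne_zero _ _)]
  exact ⟨b, act_map_dPlus_dMinus hf hd hr hb (deg_regular d),
    act_map_dMinus_dPlus_add hf hd hr hb (deg_regular d)⟩

theorem exists_dMinus (hb0 : ∀ l m, b l m ≠ 0) (hb : ∀ n, dPlus b n ≫ dPlus b (n + 1) = 0) {d : ℕ} (hd : d ≠ 0) :
    ∃ a : YoungDiagram → YoungDiagram → k, (toHn k d).map (dPlus b 0 ≫ dMinus a 0) = 𝟙 _ ∧
      ∀ m, (toHn k d).map (dMinus a m ≫ dPlus b m + dPlus b (m + 1) ≫ dMinus a (m + 1)) = 𝟙 _ := by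
  obtain ⟨g, hg, hr⟩ := exists_potential (r := fun l m => b l m * diagSign l m)
    (fun l m => mul_ne_zero (hb0 l m) (diagSign_ne_zero l m)) (square_of_dPlus hb)
  have hd' : (d : k) ≠ 0 := Nat.cast_ne_zero.2 hd
  let f : ∀ n, Part n → k := fun n l => l.hook k / (g n l * d ^ n)
  have hf : ∀ n l, f n l ≠ 0 := fun n l =>
    div_ne_zero l.hook_ne_zero (mul_ne_zero (hg n l) (pow_ne_zero n hd'))
  let a : YoungDiagram → YoungDiagram → k := fun l m => onDiagrams f l / onDiagrams f m * (diagSign l m)⁻¹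
  have ha : ∀ {n : ℕ} {l : Part (n + 1)} {m : Part n}, Adj l m → a l.1 m.1 * diagSign l.1 m.1 =
      f (n + 1) l / f n m := fun {n l m} _ => by
    simp only [a, onDiagrams_eq]
    rw [inv_mul_cancel_right₀ (diagSign_ne_zero _ _)]
  have hb' : ∀ {n : ℕ} {l : Part (n + 1)} {m : Part n}, Adj l m → b l.1 m.1 * diagSign l.1 m.1 =
      l.hook k / m.hook k * (f n m / f (n + 1) l) / d := fun {n l m} hm => by
    rw [hr hm]
    have := hg _ l
    have := hg _ m
    have := l.hook_ne_zero (k := k)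
    have := m.hook_ne_zero (k := k)
    simp only [f, pow_succ]
    field_simp
  exact ⟨a, act_map_dPlus_dMinus hf hd ha hb' (deg_regular d),
    act_map_dMinus_dPlus_add hf hd ha hb' (deg_regular d)⟩

end

end Heis

theorem mainTheorem8 {k : Type*} [Field k] [CharZero k] :
    (∃ a : YoungDiagram → YoungDiagram → k, (∀ l m, a l m ≠ 0) ∧
      ∀ n, Heis.dMinus a (n + 1) ≫ Heis.dMinus a n = 0) ∧
    (∃ b : YoungDiagram → YoungDiagram → k, (∀ l m, b l m ≠ 0) ∧
      ∀ n, Heis.dPlus b n ≫ Heis.dPlus b (n + 1) = 0) ∧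
    ∀ (a b : YoungDiagram → YoungDiagram → k) (_ : ∀ l m, a l m ≠ 0) (_ : ∀ l m, b l m ≠ 0)
      (ha : ∀ n, Heis.dMinus a (n + 1) ≫ Heis.dMinus a n = 0)
      (hb : ∀ n, Heis.dPlus b n ≫ Heis.dPlus b (n + 1) = 0) (n : ℕ),
      Nonempty (HomotopyEquiv
        (((Heis.toHn k n).mapHomologicalComplex (ComplexShape.up ℤ)).obj (Heis.sigmaPlus b hb))
        (((Heis.toHn k n).mapHomologicalComplex (ComplexShape.up ℤ)).obj (Heis.sigmaMinus a ha))) := by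
  refine ⟨⟨Heis.diagSign, Heis.diagSign_ne_zero, Heis.dMinus_diagSign⟩,
    ⟨Heis.diagSign, Heis.diagSign_ne_zero, Heis.dPlus_diagSign⟩, fun a b ha0 hb0 ha hb n => ?_⟩
  obtain rfl | hn := eq_or_ne n 0
  · exact Heis.homotopyEquiv_zero ha hb
  · obtain ⟨b', h0, h1⟩ := Heis.exists_dPlus ha0 ha hn
    obtain ⟨a', h0', h1'⟩ := Heis.exists_dMinus hb0 hb hn
    exact Heis.homotopyEquiv_of_contractible (Heis.sigmaPlus_contractible hb h0' h1')
      (Heis.sigmaMinus_contractible ha h0 h1)
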